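/- Let $N\in\mathbb{N}$, $s\in(0,1)$, $1<p<\infty$ with $N>sp$, and put $p_s^*=\frac{Np}{N-sp}$. Let $V:\mathbb{R}^N\to\mathbb{R}$ be continuous with $$V_\infty:=\liminf_{|x|\to\infty}V(x)>V_0:=\inf_{\mathbb{R}^N}V>0,$$ where $V_\infty=+\infty$ is allowed. Let $f:\mathbb{R}\to\mathbb{R}$ be continuous with $f(t)=0$ for $t<0$, put $F(t)=\int_0^t f(\tau)\,d\tau$, and suppose that - $\lim_{|t|\to0}\frac{|f(t)|}{|t|^{p-1}}=0$; - there is $q\in(p,p_s^*)$ with $\lim_{|t|\to\infty}\frac{|f(t)|}{|t|^{q-1}}=0$; - there is $\vartheta>p$ with $0<\vartheta F(t)\le t f(t)$ for all $t>0$; - $t\mapsto f(t)/t^{p-1}$ is increasing on $(0,\infty)$ (nondecreasing is enough). Let $W^{s,p}(\mathbb{R}^N)$ be the set of $u\in L^p(\mathbb{R}^N)$ with $[u]^p=\iint_{\mathbb{R}^{2N}}\frac{|u(x)-u(y)|^p}{|x-y|^{N+sp}}\,dx\,dy<\infty$. For a continuous $W:\mathbb{R}^N\to(0,\infty)$ let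 $X_W=\{u\in W^{s,p}(\mathbb{R}^N):\int_{\mathbb{R}^N} W|u|^p\,dx<\infty\}$ and, for $u,\varphi\in X_W$, $$I_W(u)=\frac1p\Big([u]^p+\int_{\mathbb{R}^N}W|u|^p\,dx\Big)-\int_{\mathbb{R}^N}F(u)\,dx,$$ $$\langle I_W'(u),\varphi\rangle=\iint_{\mathbb{R}^{2N}}\frac{|u(x)-u(y)|^{p-2}(u(x)-u(y))(\varphi(x)-\varphi(y))}{|x-y|^{N+sp}}\,dx\,dy+\int_{\mathbb{R}^N}W|u|^{p-2}u\varphi\,dx-\int_{\mathbb{R}^N}f(u)\varphi\,dx.$$ Put $\mathcal{N}_W=\{u\in X_W\setminus\{0\}:\langle I_W'(u),u\rangle=0\}$ and $c_W=\inf_{\mathcal{N}_W}I_W$. For $\varepsilon>0$ write $V_\varepsilon(x)=V(\varepsilon x)$, and consider the problem $$(P_\varepsilon)\qquad (-\Delta)_p^s u+V(\varepsilon x)|u|^{p-2}u=f(u)\ \text{ in }\mathbb{R}^N,\qquad u\in W^{s,p}(\mathbb{R}^N),\qquad u(x)>0\ \text{ for all }x\in\mathbb{R}^N.$$ Then there is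 $\varepsilon_0>0$ such that for every $\varepsilon\in(0,\varepsilon_0)$ problem $(P_\varepsilon)$ has a ground state solution, that is, there is $u\in X_{V_\varepsilon}$ with $u(x)>0$ for all $x\in\mathbb{R}^N$, $\langle I_{V_\varepsilon}'(u),\varphi\rangle=0$ for all $\varphi\in X_{V_\varepsilon}$, $u\in\mathcal{N}_{V_\varepsilon}$ and $I_{V_\varepsilon}(u)=\min_{\mathcal{N}_{V_\varepsilon}}I_{V_\varepsilon}=c_{V_\varepsilon}$. Moreover, if $V_\infty<\infty$, then $c_{V_\varepsilon}<c_{V_\infty}$ for every $\varepsilon\in(0,\varepsilon_0)$, where $c_{V_\infty}$ is the level $c_W$ for the constant potential $W\equiv V_\infty$. -/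

import Mathlib

open MeasureTheory Filter Topology

noncomputable section

namespace FracSchrodinger

/-- `ℝ^N` with its Euclidean norm and Lebesgue measure. -/
abbrev Space (N : ℕ) : Type := EuclideanSpace ℝ (Fin N)

/-- The Gagliardo integrand `|u(x) - u(y)|^p / |x - y|^(N + s p)` at `z = (x, y)`. -/
def gagliardoIntegrand (N : ℕ) (s p : ℝ) (u : Space N → ℝ) (z : Space N × Space N) : ℝ :=
  |u z.1 - u z.2| ^ p / ‖z.1 - z.2‖ ^ ((N : ℝ) + s * p)

/-- `u ∈ W^{s,p}(ℝ^N)`: `u ∈ L^p` and the Gagliardo double integral is finite. -/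
def MemSobolev (N : ℕ) (s p : ℝ) (u : Space N → ℝ) : Prop :=
  MemLp u (ENNReal.ofReal p) volume ∧ Integrable (gagliardoIntegrand N s p u) volume

/-- Membership in the weighted space
`{u ∈ W^{s,p}(ℝ^N) : ∫ W |u|^p < ∞}` attached to a nonnegative potential `W`. -/
def MemEnergySpace (N : ℕ) (s p : ℝ) (W : Space N → ℝ) (u : Space N → ℝ) : Prop :=
  MemSobolev N s p u ∧ Integrable (fun x => W x * |u x| ^ p) volume

/-- The `p`-th power of the norm of the weighted space: `[u]^p_{W^{s,p}} + ∫ W |u|^p`. -/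
def normPow (N : ℕ) (s p : ℝ) (W : Space N → ℝ) (u : Space N → ℝ) : ℝ :=
  (∫ z, gagliardoIntegrand N s p u z) + ∫ x, W x * |u x| ^ p

/-- The primitive `F(t) = ∫_0^t f(τ) dτ`. -/
def primitive (f : ℝ → ℝ) (t : ℝ) : ℝ := ∫ τ in (0 : ℝ)..t, f τ

/-- The energy functional `(1/p) ‖u‖^p - ∫ F(u)` of the equation
`(-Δ)_p^s u + W |u|^{p-2} u = f(u)`. -/
def energy (N : ℕ) (s p : ℝ) (W : Space N → ℝ) (f : ℝ → ℝ) (u : Space N → ℝ) : ℝ :=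
  1 / p * normPow N s p W u - ∫ x, primitive f (u x)

/-- The differential of the energy at `u` in the direction `φ`, i.e. the weak form of
`(-Δ)_p^s u + W |u|^{p-2} u - f(u)` tested against `φ`. -/
def energyDeriv (N : ℕ) (s p : ℝ) (W : Space N → ℝ) (f : ℝ → ℝ) (u φ : Space N → ℝ) : ℝ :=
  (∫ z : Space N × Space N,
      |u z.1 - u z.2| ^ (p - 2) * (u z.1 - u z.2) / ‖z.1 - z.2‖ ^ ((N : ℝ) + s * p)
        * (φ z.1 - φ z.2))
    + (∫ x, W x * (|u x| ^ (p - 2) * u x) * φ x)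
    - ∫ x, f (u x) * φ x

/-- `u` is a positive weak solution of `(-Δ)_p^s u + W |u|^{p-2} u = f(u)` in `ℝ^N`, in the
energy space, tested against the whole energy space. -/
structure IsPositiveWeakSolution (N : ℕ) (s p : ℝ) (W : Space N → ℝ) (f : ℝ → ℝ)
    (u : Space N → ℝ) : Prop where
  mem : MemEnergySpace N s p W u
  weak_eq : ∀ φ : Space N → ℝ, MemEnergySpace N s p W φ → energyDeriv N s p W f u φ = 0
  pos : ∀ x, 0 < u x

/-- The Nehari manifold: the nonzero `u` in the energy space with `⟨I'(u), u⟩ = 0`. -/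
def nehari (N : ℕ) (s p : ℝ) (W : Space N → ℝ) (f : ℝ → ℝ) : Set (Space N → ℝ) :=
  {u | MemEnergySpace N s p W u ∧ ¬ u =ᵐ[volume] 0 ∧ energyDeriv N s p W f u u = 0}

/-- The ground state level: the infimum of the energy over the Nehari manifold. -/
def groundLevel (N : ℕ) (s p : ℝ) (W : Space N → ℝ) (f : ℝ → ℝ) : ℝ :=
  sInf (energy N s p W f '' nehari N s p W f)

/-- A ground state solution: a positive weak solution which attains the minimum of the energy on
the Nehari manifold. -/
structure IsGroundStateSolution (N : ℕ) (s p : ℝ) (W : Space N → ℝ) (f : ℝ → ℝ)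
    (u : Space N → ℝ) : Prop extends IsPositiveWeakSolution N s p W f u where
  mem_nehari : u ∈ nehari N s p W f
  minimal : ∀ v ∈ nehari N s p W f, energy N s p W f u ≤ energy N s p W f v

/-- `liminf_{|x| → ∞} V(x)`, possibly `+∞`. -/
def liminfAtInfinity {N : ℕ} (V : Space N → ℝ) : EReal :=
  liminf (fun x => (V x : EReal)) (cocompact (Space N))

/-- Rabinowitz' condition on a continuous potential:
`liminf_{|x| → ∞} V(x) > inf V > 0` (the liminf may be `+∞`). -/
structure IsRabinowitzPotential {N : ℕ} (V : Space N → ℝ) : Prop where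
  continuous : Continuous V
  inf_pos : 0 < ⨅ x, (V x : EReal)
  inf_lt_liminf : (⨅ x, (V x : EReal)) < liminfAtInfinity V

/-- The assumptions on the subcritical nonlinearity. -/
structure IsSubcriticalNonlinearity (N : ℕ) (s p : ℝ) (f : ℝ → ℝ) : Prop where
  continuous : Continuous f
  eq_zero_of_neg : ∀ t < 0, f t = 0
  limit_zero : Tendsto (fun t => |f t| / |t| ^ (p - 1)) (𝓝[≠] 0) (𝓝 0)
  limit_infinity : ∃ q : ℝ, p < q ∧ q < N * p / (N - s * p) ∧
    Tendsto (fun t => |f t| / |t| ^ (q - 1)) (cocompact ℝ) (𝓝 0)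
  superlinear : ∃ θ : ℝ, p < θ ∧
    ∀ t > 0, 0 < θ * primitive f t ∧ θ * primitive f t ≤ t * f t
  monotone : MonotoneOn (fun t => f t / t ^ (p - 1)) (Set.Ioi 0)

end FracSchrodinger

end

/-!
Ground states are found by direct minimisation on the Nehari manifold; loss of compactness is
excluded by comparing `c_ε`, the level of `V(ε ·)`, with the level `c_μ` of a constant potential
`inf V < μ < liminf V`.

**The level.** Write `H(t) = f(t) t / p - F(t)`. On the Nehari manifold the energy equals `∫ H(u)`,
and the monotonicity of `f(t) / t^{p-1}` makes `H` nondecreasing. If `u ≠ 0` and `⟨I'(u), u⟩ ≤ 0`,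
the ray through `u` meets the Nehari manifold at some `t ≤ 1`, so `c ≤ ∫ H(u)`
(`IsSetting.groundLevel_le_integral`). The constraint `⟨I'(u), u⟩ ≤ 0` is stable under lowering the
potential, under passing to the positive part and under small perturbations of strict inequalities;
nearly everything below goes through this bound.

**Comparison.** A near-minimiser for the constant `ν`, projected to the Nehari manifold of a smaller
constant, lies below `c_ν` by a fixed amount, because functions on the Nehari manifold of bounded
energy stay away from `0` in `L^p` (`IsSetting.exists_below_const`,
`IsSetting.exists_lower_bound`). Truncated to bounded support and translated to `x₀ / ε`, where
`V x₀ < μ`, it is admissible for `V(ε ·)` once `ε` is small. Hence `c_ε < c_ν` for every constant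
`ν > μ` (`IsSetting.exists_groundLevel_le`), in particular `c_ε < c_{V_∞}` when `V_∞` is finite.

**Existence.** A minimising sequence is bounded, and a subsequence converges almost everywhere and
in `L^p` of balls to some `u` (`exists_subseq_tendsto`). If `u = 0`, only the part near infinity
matters, where the potential exceeds some `ν' > ν`, and `c_ε ≥ c_ν` results. If `u ≠ 0`, the Brezis–Lieb
lemma splits `⟨I'(·), ·⟩` and `∫ H` into the contributions of `u` and of the remainders; if
`⟨I'(u), u⟩ > 0`, the remainders would be admissible and `∫ H(u) ≤ 0`, which is absurd. So `u` is
admissible and its projection is a minimiser (`IsSetting.exists_minimizer`).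

**Regularity of the argument.** Since `f(t) / t^{p-1}` is only nondecreasing, rays may meet the
Nehari manifold in a whole segment; the Euler–Lagrange equation is obtained without a smooth
projection in `IsSetting.energyDeriv_nonneg_of_minimal`. Positivity comes from the strong maximum
principle `IsSetting.ae_pos_of_weak_solution`, which tests with cutoffs concentrating on
`{v = 0}`.

The analysis of `W^{s,p}` is elementary. The subcritical Sobolev inequality is a bootstrap from a
pointwise bound by the inner Gagliardo integral (`exists_pointwise_bootstrap`), and compactness
compares a function with its averages over small balls (`integral_sub_ballAverage_le`). Throughout,
`[u]` and the weighted norm are treated as `L^p` norms of `diffQuotient N s p u` and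
`weighted p W u`, which are linear in `u`.
-/

noncomputable section

namespace FracSchrodinger

/-! ### The nonlinearity -/

section

/-- The density `f(t) t / p - F(t)` of the energy on the Nehari manifold. -/
def nehariDensity (p : ℝ) (f : ℝ → ℝ) (t : ℝ) : ℝ := f t * t / p - primitive f t

/-- `f` is `o(|t|^{q-1})` at infinity. -/
def SubcriticalAt (f : ℝ → ℝ) (q : ℝ) : Prop :=
  Tendsto (fun t => |f t| / |t| ^ (q - 1)) (cocompact ℝ) (𝓝 0)

theorem rpow_mul_eq {a : ℝ} (ha : 0 < a) (p : ℝ) : a ^ (p - 1) * a = a ^ p := by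
  rw [Real.rpow_sub_one ha.ne']; field_simp

theorem abs_rpow_sub_one_mul {r : ℝ} (hr : r ≠ 0) (t : ℝ) : |t| ^ (r - 1) * |t| = |t| ^ r := by
  rcases eq_or_ne t 0 with rfl | h
  · simp [hr]
  · exact rpow_mul_eq (abs_pos.2 h) r

theorem SubcriticalAt.le_near_infinity {f : ℝ → ℝ} {q : ℝ} (hq : SubcriticalAt f q)
    {τ : ℝ} (hτ : 0 < τ) : ∃ R > 0, ∀ t, R ≤ |t| → f t ≤ τ * |t| ^ (q - 1) := by
  have h := hq.eventually (gt_mem_nhds hτ)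
  rw [← Metric.cobounded_eq_cocompact, (Metric.hasBasis_cobounded_compl_closedBall
    (0 : ℝ)).eventually_iff] at h
  obtain ⟨R, -, h⟩ := h
  refine ⟨max R 0 + 1, by positivity, fun t ht => ?_⟩
  have h1 : R < |t| := by linarith [le_max_left R 0]
  have h0 : 0 < |t| := by linarith [le_max_right R 0]
  have h2 := h (x := t) (by simpa using h1)
  rw [div_lt_iff₀ (Real.rpow_pos_of_pos h0 _)] at h2
  exact (le_abs_self _).trans h2.le

namespace IsSubcriticalNonlinearity

variable {N : ℕ} {s p : ℝ} {f : ℝ → ℝ}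

theorem map_zero (hf : IsSubcriticalNonlinearity N s p f) : f 0 = 0 := by
  have h1 : Tendsto f (𝓝[<] 0) (𝓝 (f 0)) :=
    hf.continuous.continuousAt.tendsto.mono_left inf_le_left
  have h2 : Tendsto f (𝓝[<] 0) (𝓝 0) :=
    tendsto_const_nhds.congr' (by
      filter_upwards [self_mem_nhdsWithin] with t ht
      exact (hf.eq_zero_of_neg t ht).symm)
  exact tendsto_nhds_unique h1 h2

theorem apply_of_nonpos (hf : IsSubcriticalNonlinearity N s p f) {t : ℝ} (ht : t ≤ 0) :
    f t = 0 := by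
  rcases ht.lt_or_eq with h | h
  · exact hf.eq_zero_of_neg t h
  · rw [h, hf.map_zero]

theorem primitive_of_nonpos (hf : IsSubcriticalNonlinearity N s p f) {t : ℝ} (ht : t ≤ 0) :
    primitive f t = 0 := by
  unfold primitive
  rw [intervalIntegral.integral_congr (g := fun _ => 0)]
  · simp
  · intro x hx
    rw [Set.uIcc_of_ge ht] at hx
    exact hf.apply_of_nonpos hx.2

theorem hasDerivAt_primitive (hf : IsSubcriticalNonlinearity N s p f) (t : ℝ) :
    HasDerivAt (primitive f) (f t) t :=
  intervalIntegral.integral_hasDerivAt_right (hf.continuous.intervalIntegrable _ _)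
    (hf.continuous.stronglyMeasurableAtFilter _ _) hf.continuous.continuousAt

theorem continuous_primitive (hf : IsSubcriticalNonlinearity N s p f) :
    Continuous (primitive f) :=
  continuous_iff_continuousAt.2 fun t => (hf.hasDerivAt_primitive t).continuousAt

/-- The Ambrosetti–Rabinowitz condition, with the inequality extended to all real arguments. -/
theorem exists_ambrosetti_rabinowitz (hf : IsSubcriticalNonlinearity N s p f) (hp : 1 < p) :
    ∃ θ : ℝ, p < θ ∧ (∀ t > 0, 0 < primitive f t) ∧ ∀ t, θ * primitive f t ≤ f t * t := by
  obtain ⟨θ, hθ, h⟩ := hf.superlinear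
  refine ⟨θ, hθ, fun t ht => ?_, fun t => ?_⟩
  · exact (mul_pos_iff_of_pos_left (by linarith)).1 (h t ht).1
  · rcases le_or_gt t 0 with ht | ht
    · simp [hf.primitive_of_nonpos ht, hf.apply_of_nonpos ht]
    · rw [mul_comm (f t)]; exact (h t ht).2

theorem primitive_pos (hf : IsSubcriticalNonlinearity N s p f) (hp : 1 < p) {t : ℝ} (ht : 0 < t) :
    0 < primitive f t := by
  obtain ⟨θ, -, h, -⟩ := hf.exists_ambrosetti_rabinowitz hp
  exact h t ht

theorem primitive_nonneg (hf : IsSubcriticalNonlinearity N s p f) (hp : 1 < p) (t : ℝ) :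
    0 ≤ primitive f t := by
  rcases le_or_gt t 0 with ht | ht
  · rw [hf.primitive_of_nonpos ht]
  · exact (hf.primitive_pos hp ht).le

theorem pos (hf : IsSubcriticalNonlinearity N s p f) (hp : 1 < p) {t : ℝ} (ht : 0 < t) :
    0 < f t := by
  obtain ⟨θ, hθ, h, h'⟩ := hf.exists_ambrosetti_rabinowitz hp
  have h1 : 0 < θ * primitive f t := mul_pos (by linarith) (h t ht)
  exact (mul_pos_iff_of_pos_right ht).1 (h1.trans_le (h' t))

theorem nonneg (hf : IsSubcriticalNonlinearity N s p f) (hp : 1 < p) (t : ℝ) : 0 ≤ f t := by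
  rcases le_or_gt t 0 with ht | ht
  · rw [hf.apply_of_nonpos ht]
  · exact (hf.pos hp ht).le

theorem mul_self_nonneg (hf : IsSubcriticalNonlinearity N s p f) (hp : 1 < p) (t : ℝ) :
    0 ≤ f t * t := by
  rcases le_or_gt t 0 with ht | ht
  · rw [hf.apply_of_nonpos ht, zero_mul]
  · exact mul_nonneg (hf.nonneg hp t) ht.le

/-- The Ambrosetti–Rabinowitz condition makes `F(t) / t^θ` nondecreasing. -/
theorem exists_primitive_mul_ge (hf : IsSubcriticalNonlinearity N s p f) (hp : 1 < p) :
    ∃ θ : ℝ, p < θ ∧ ∀ t r, 1 ≤ t → t ^ θ * primitive f r ≤ primitive f (t * r) := by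
  obtain ⟨θ, hθ, h, h'⟩ := hf.exists_ambrosetti_rabinowitz hp
  refine ⟨θ, hθ, fun t r ht => ?_⟩
  rcases le_or_gt r 0 with hr | hr
  · rw [hf.primitive_of_nonpos hr, mul_zero]; exact hf.primitive_nonneg hp _
  have hmono : MonotoneOn (fun t => primitive f t * t ^ (-θ)) (Set.Ioi 0) := by
    have hder : ∀ x ∈ Set.Ioi (0 : ℝ), HasDerivAt (fun t => primitive f t * t ^ (-θ))
        (f x * x ^ (-θ) + primitive f x * (-θ * x ^ (-θ - 1))) x := fun x hx =>
      (hf.hasDerivAt_primitive x).mul (Real.hasDerivAt_rpow_const (Or.inl (ne_of_gt hx)))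
    refine monotoneOn_of_deriv_nonneg (convex_Ioi 0)
      (fun x hx => (hder x hx).continuousAt.continuousWithinAt)
      (fun x hx => (hder x (interior_subset hx)).differentiableAt.differentiableWithinAt)
      (fun x hx => ?_)
    have hx' : (0 : ℝ) < x := interior_subset hx
    rw [(hder x hx').deriv]
    have e : x ^ (-θ) = x ^ (-θ - 1) * x := by
      rw [Real.rpow_sub_one hx'.ne']; field_simp
    rw [e]
    have := h' x
    have h2 : 0 ≤ x ^ (-θ - 1) * (f x * x - θ * primitive f x) :=
      mul_nonneg (Real.rpow_nonneg hx'.le _) (by linarith)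
    linarith
  have ht0 : 0 < t := by linarith
  have := hmono (a := r) (b := t * r) hr (mul_pos ht0 hr) (by nlinarith)
  simp only [Real.mul_rpow ht0.le hr.le] at this
  rw [Real.rpow_neg ht0.le, Real.rpow_neg hr.le, ← mul_assoc] at this
  have hr' : 0 < r ^ θ := Real.rpow_pos_of_pos hr _
  have ht' : 0 < t ^ θ := Real.rpow_pos_of_pos ht0 _
  have h3 := le_of_mul_le_mul_right this (inv_pos.2 hr')
  rw [← div_eq_mul_inv, le_div_iff₀ ht'] at h3
  linarith

theorem div_rpow_le (hf : IsSubcriticalNonlinearity N s p f) {a b : ℝ} (ha : 0 < a)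
    (hab : a ≤ b) : f a / a ^ (p - 1) ≤ f b / b ^ (p - 1) :=
  hf.monotone (Set.mem_Ioi.2 ha) (Set.mem_Ioi.2 (ha.trans_le hab)) hab

/-- `∫_a^b f ≤ (f(b) / b^{p-1}) ∫_a^b τ^{p-1} dτ`. -/
theorem primitive_sub_le (hf : IsSubcriticalNonlinearity N s p f) (hp : 1 < p) {a b : ℝ}
    (ha : 0 < a) (hab : a ≤ b) :
    primitive f b - primitive f a ≤ f b / b ^ (p - 1) * ((b ^ p - a ^ p) / p) := by
  have hb : 0 < b := ha.trans_le hab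
  have hi := hf.continuous.intervalIntegrable (μ := volume)
  have h1 : primitive f b - primitive f a = ∫ τ in a..b, f τ := by
    unfold primitive
    exact intervalIntegral.integral_interval_sub_left (hi _ _) (hi _ _)
  have h2 : ∫ τ in a..b, f b / b ^ (p - 1) * τ ^ (p - 1)
      = f b / b ^ (p - 1) * ((b ^ p - a ^ p) / p) := by
    rw [intervalIntegral.integral_const_mul, integral_rpow (Or.inl (by linarith))]
    simp
  rw [h1, ← h2]
  have hc : Continuous fun τ : ℝ => f b / b ^ (p - 1) * τ ^ (p - 1) :=
    continuous_const.mul (Real.continuous_rpow_const (by linarith))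
  refine intervalIntegral.integral_mono_on hab (hi _ _) (hc.intervalIntegrable _ _) ?_
  intro τ hτ
  have hτ0 : 0 < τ := ha.trans_le hτ.1
  have := hf.div_rpow_le hτ0 hτ.2
  rwa [div_le_iff₀ (Real.rpow_pos_of_pos hτ0 _)] at this

theorem nehariDensity_of_nonpos (hf : IsSubcriticalNonlinearity N s p f) {t : ℝ} (ht : t ≤ 0) :
    nehariDensity p f t = 0 := by
  simp [nehariDensity, hf.apply_of_nonpos ht, hf.primitive_of_nonpos ht]

/-- `f(t) t` is controlled by the density of the energy on the Nehari manifold, with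
`κ = 1 / p - 1 / θ`; hence bounds on the energy give bounds on the norm. -/
theorem exists_nehariDensity_ge (hf : IsSubcriticalNonlinearity N s p f) (hp : 1 < p) :
    ∃ κ : ℝ, 0 < κ ∧ ∀ t, κ * (f t * t) ≤ nehariDensity p f t := by
  obtain ⟨θ, hθ, h, h'⟩ := hf.exists_ambrosetti_rabinowitz hp
  have hp0 : 0 < p := by linarith
  have hθ0 : 0 < θ := by linarith
  refine ⟨1 / p - 1 / θ, sub_pos.2 (one_div_lt_one_div_of_lt hp0 hθ), fun t => ?_⟩
  have := h' t
  have h2 : primitive f t ≤ f t * t / θ := by rw [le_div_iff₀ hθ0]; linarith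
  unfold nehariDensity
  calc (1 / p - 1 / θ) * (f t * t) = f t * t / p - f t * t / θ := by ring
    _ ≤ _ := by linarith

theorem nehariDensity_nonneg (hf : IsSubcriticalNonlinearity N s p f) (hp : 1 < p) (t : ℝ) :
    0 ≤ nehariDensity p f t := by
  obtain ⟨κ, hκ, h⟩ := hf.exists_nehariDensity_ge hp
  exact (mul_nonneg hκ.le (hf.mul_self_nonneg hp t)).trans (h t)

theorem nehariDensity_pos (hf : IsSubcriticalNonlinearity N s p f) (hp : 1 < p) {t : ℝ}
    (ht : 0 < t) : 0 < nehariDensity p f t := by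
  obtain ⟨κ, hκ, h⟩ := hf.exists_nehariDensity_ge hp
  exact (mul_pos hκ (mul_pos (hf.pos hp ht) ht)).trans_le (h t)

theorem nehariDensity_le (hf : IsSubcriticalNonlinearity N s p f) (hp : 1 < p) (t : ℝ) :
    nehariDensity p f t ≤ f t * t := by
  have h1 := hf.primitive_nonneg hp t
  have h2 : f t * t / p ≤ f t * t := div_le_self (hf.mul_self_nonneg hp t) hp.le
  unfold nehariDensity; linarith

theorem continuous_nehariDensity (hf : IsSubcriticalNonlinearity N s p f) :
    Continuous (nehariDensity p f) :=
  ((hf.continuous.mul continuous_id).div_const _).sub hf.continuous_primitive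

/-- The monotonicity of `f(t) / t^{p-1}` makes `f(t) t / p - F(t)` nondecreasing. -/
theorem nehariDensity_mono (hf : IsSubcriticalNonlinearity N s p f) (hp : 1 < p) :
    Monotone (nehariDensity p f) := by
  intro a b hab
  rcases le_or_gt a 0 with ha | ha
  · simpa [hf.nehariDensity_of_nonpos ha] using hf.nehariDensity_nonneg hp b
  · have hb := ha.trans_le hab
    have h := hf.div_rpow_le ha hab
    have h1 := hf.primitive_sub_le hp ha hab
    have ea : f a * a = f a / a ^ (p - 1) * a ^ p := by
      rw [← rpow_mul_eq ha p]
      have := (Real.rpow_pos_of_pos ha (p - 1)).ne'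
      field_simp
    have eb : f b * b = f b / b ^ (p - 1) * b ^ p := by
      rw [← rpow_mul_eq hb p]
      have := (Real.rpow_pos_of_pos hb (p - 1)).ne'
      field_simp
    have h2 : f a / a ^ (p - 1) * (a ^ p / p) ≤ f b / b ^ (p - 1) * (a ^ p / p) :=
      mul_le_mul_of_nonneg_right h (div_nonneg (Real.rpow_nonneg ha.le _) (by linarith))
    unfold nehariDensity
    rw [ea, eb]
    have e1 : f b / b ^ (p - 1) * ((b ^ p - a ^ p) / p)
      = f b / b ^ (p - 1) * b ^ p / p - f b / b ^ (p - 1) * (a ^ p / p) := by ring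
    have e2 : f a / a ^ (p - 1) * (a ^ p / p) = f a / a ^ (p - 1) * a ^ p / p := by ring
    linarith

/-- The pointwise inequality which makes the energy maximal, on the ray through a point of the
Nehari manifold, at that point. -/
theorem primitive_sub_mul_le (hf : IsSubcriticalNonlinearity N s p f) (hp : 1 < p) {t : ℝ}
    (ht : 0 < t) (r : ℝ) :
    primitive f r - primitive f (t * r) ≤ (1 - t ^ p) / p * (f r * r) := by
  rcases le_or_gt r 0 with hr | hr
  · simp [hf.primitive_of_nonpos hr, hf.apply_of_nonpos hr,
      hf.primitive_of_nonpos (mul_nonpos_of_nonneg_of_nonpos ht.le hr)]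
  have er : f r * r = f r / r ^ (p - 1) * r ^ p := by
    rw [← rpow_mul_eq hr p]
    have := (Real.rpow_pos_of_pos hr (p - 1)).ne'
    field_simp
  have htr : 0 < t * r := mul_pos ht hr
  rcases le_total t 1 with h1 | h1
  · have := hf.primitive_sub_le hp (a := t * r) (b := r) htr (by nlinarith)
    rw [Real.mul_rpow ht.le hr.le] at this
    rw [er]
    calc _ ≤ _ := this
      _ = _ := by ring
  · -- for `t ≥ 1` the lower bound `f(τ) ≥ (f(r) / r^{p-1}) τ^{p-1}` on `[r, t r]` is integrated
    have hle : r ≤ t * r := by nlinarith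
    have hi := hf.continuous.intervalIntegrable (μ := volume)
    have e1 : primitive f (t * r) - primitive f r = ∫ τ in r..(t * r), f τ := by
      unfold primitive
      exact intervalIntegral.integral_interval_sub_left (hi _ _) (hi _ _)
    have e2 : ∫ τ in r..(t * r), f r / r ^ (p - 1) * τ ^ (p - 1)
        = f r / r ^ (p - 1) * (((t * r) ^ p - r ^ p) / p) := by
      rw [intervalIntegral.integral_const_mul, integral_rpow (Or.inl (by linarith))]
      simp
    have hc : Continuous fun τ : ℝ => f r / r ^ (p - 1) * τ ^ (p - 1) :=
      continuous_const.mul (Real.continuous_rpow_const (by linarith))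
    have h3 : ∫ τ in r..(t * r), f r / r ^ (p - 1) * τ ^ (p - 1) ≤ ∫ τ in r..(t * r), f τ := by
      refine intervalIntegral.integral_mono_on hle (hc.intervalIntegrable _ _) (hi _ _) ?_
      intro τ hτ
      have hτ0 : 0 < τ := hr.trans_le hτ.1
      have := hf.div_rpow_le hr hτ.1
      rwa [le_div_iff₀ (Real.rpow_pos_of_pos hτ0 _)] at this
    rw [e2, ← e1, Real.mul_rpow ht.le hr.le] at h3
    rw [er]
    have e3 : f r / r ^ (p - 1) * ((t ^ p * r ^ p - r ^ p) / p)
      = - ((1 - t ^ p) / p * (f r / r ^ (p - 1) * r ^ p)) := by ring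
    linarith

theorem abs_le_near_zero (hf : IsSubcriticalNonlinearity N s p f) {τ : ℝ} (hτ : 0 < τ) :
    ∃ δ > 0, ∀ t, |t| < δ → f t ≤ τ * |t| ^ (p - 1) := by
  have h := hf.limit_zero
  rw [Metric.tendsto_nhdsWithin_nhds] at h
  obtain ⟨δ, hδ, h⟩ := h τ hτ
  refine ⟨δ, hδ, fun t ht => ?_⟩
  by_cases h0 : t = 0
  · rw [h0, hf.map_zero]; positivity
  · have h1 := h (Set.mem_compl_singleton_iff.2 h0) (by simpa using ht)
    have hpos : 0 < |t| ^ (p - 1) := Real.rpow_pos_of_pos (abs_pos.2 h0) _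
    rw [Real.dist_eq, sub_zero, abs_of_nonneg (div_nonneg (abs_nonneg _) hpos.le),
      div_lt_iff₀ hpos] at h1
    exact (le_abs_self _).trans h1.le

theorem growth (hf : IsSubcriticalNonlinearity N s p f) (hp : 1 < p) {q : ℝ} (hpq : p < q)
    (hq : SubcriticalAt f q) {τ : ℝ} (hτ : 0 < τ) :
    ∃ C > 0, ∀ t, f t ≤ τ * |t| ^ (p - 1) + C * |t| ^ (q - 1) := by
  obtain ⟨δ, hδ, h0⟩ := hf.abs_le_near_zero hτ
  obtain ⟨R, hR, hinf⟩ := hq.le_near_infinity one_pos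
  obtain ⟨M, hM⟩ := (isCompact_Icc (a := -R) (b := R)).exists_bound_of_continuousOn
    hf.continuous.continuousOn
  have hδq : 0 < δ ^ (q - 1) := Real.rpow_pos_of_pos hδ _
  refine ⟨1 + |M| / δ ^ (q - 1), by positivity, fun t => ?_⟩
  have n1 : 0 ≤ τ * |t| ^ (p - 1) := by positivity
  have n2 : 0 ≤ |t| ^ (q - 1) := by positivity
  have n3 : 0 ≤ |M| / δ ^ (q - 1) * |t| ^ (q - 1) := by positivity
  rw [add_mul, one_mul]
  rcases lt_or_ge |t| δ with h | h
  · linarith [h0 t h]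
  rcases le_or_gt R |t| with h' | h'
  · linarith [hinf t h']
  · have h1 := hM t (abs_le.1 h'.le)
    have h2 : f t ≤ |M| := (le_abs_self _).trans (h1.trans (le_abs_self _))
    have h3 : |M| ≤ |M| / δ ^ (q - 1) * |t| ^ (q - 1) := by
      rw [div_mul_eq_mul_div, le_div_iff₀ hδq]
      exact mul_le_mul_of_nonneg_left (Real.rpow_le_rpow hδ.le h (by linarith)) (abs_nonneg _)
    linarith

theorem mul_self_le (hf : IsSubcriticalNonlinearity N s p f) (hp : 1 < p) {A t : ℝ}
    (h : f t ≤ A) : f t * t ≤ A * |t| :=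
  (mul_le_mul_of_nonneg_left (le_abs_self t) (hf.nonneg hp t)).trans
    (mul_le_mul_of_nonneg_right h (abs_nonneg t))

theorem growth_mul (hf : IsSubcriticalNonlinearity N s p f) (hp : 1 < p) {q : ℝ} (hpq : p < q)
    (hq : SubcriticalAt f q) {τ : ℝ} (hτ : 0 < τ) :
    ∃ C > 0, ∀ t, f t * t ≤ τ * |t| ^ p + C * |t| ^ q := by
  obtain ⟨C, hC, h⟩ := hf.growth hp hpq hq hτ
  refine ⟨C, hC, fun t => (hf.mul_self_le hp (h t)).trans_eq ?_⟩
  rw [add_mul, mul_assoc, mul_assoc, abs_rpow_sub_one_mul (by linarith),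
    abs_rpow_sub_one_mul (by linarith)]

end IsSubcriticalNonlinearity

/-! ### The Brezis–Lieb lemma -/

/-- The function `|t|^p + |t|^q` controlling subcritical densities. -/
def twoPower (p q t : ℝ) : ℝ := |t| ^ p + |t| ^ q

theorem twoPower_nonneg (p q t : ℝ) : 0 ≤ twoPower p q t := by unfold twoPower; positivity

theorem continuous_twoPower {p q : ℝ} (hp : 0 < p) (hq : 0 < q) : Continuous (twoPower p q) :=
  ((Real.continuous_rpow_const hp.le).comp continuous_abs).add
    ((Real.continuous_rpow_const hq.le).comp continuous_abs)

/-- The structural condition of the Brezis–Lieb lemma for a density `j` with control `Φ`. -/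
def BrezisLiebCondition (Φ j : ℝ → ℝ) : Prop :=
  ∀ ε > 0, ∃ C ≥ 0, ∀ a b, |j (a + b) - j a| ≤ ε * Φ a + C * Φ b

theorem abs_add_rpow_le {r : ℝ} (hr : 0 ≤ r) (a b : ℝ) :
    |a + b| ^ r ≤ 2 ^ r * (|a| ^ r + |b| ^ r) := by
  have h : |a + b| ≤ 2 * max |a| |b| :=
    (abs_add_le a b).trans (by linarith [le_max_left |a| |b|, le_max_right |a| |b|])
  have hm : 0 ≤ max |a| |b| := le_max_of_le_left (abs_nonneg a)
  have h2 : (max |a| |b|) ^ r ≤ |a| ^ r + |b| ^ r := by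
    rcases max_choice |a| |b| with h | h <;> rw [h] <;>
      linarith [Real.rpow_nonneg (abs_nonneg a) r, Real.rpow_nonneg (abs_nonneg b) r]
  calc |a + b| ^ r ≤ (2 * max |a| |b|) ^ r := Real.rpow_le_rpow (abs_nonneg _) h hr
    _ = 2 ^ r * (max |a| |b|) ^ r := Real.mul_rpow (by norm_num) hm
    _ ≤ _ := mul_le_mul_of_nonneg_left h2 (by positivity)

theorem twoPower_add_le {p q : ℝ} (hp : 0 < p) (hpq : p < q) (a b : ℝ) :
    twoPower p q (a + b) ≤ 2 ^ q * (twoPower p q a + twoPower p q b) := by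
  have h1 := abs_add_rpow_le hp.le a b
  have h2 := abs_add_rpow_le (hp.trans hpq).le a b
  have h3 : (2 : ℝ) ^ p ≤ 2 ^ q := Real.rpow_le_rpow_of_exponent_le (by norm_num) hpq.le
  have h4 : (2 : ℝ) ^ p * (|a| ^ p + |b| ^ p) ≤ 2 ^ q * (|a| ^ p + |b| ^ p) :=
    mul_le_mul_of_nonneg_right h3 (by positivity)
  unfold twoPower
  linarith

/-- A continuous density which is `o(|t|^p)` at `0` and `o(|t|^q)` at infinity satisfies the
condition of the Brezis–Lieb lemma with control `|t|^p + |t|^q`. -/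
theorem brezisLiebCondition_of_littleO {p q : ℝ} (hp : 0 < p) (hpq : p < q) {j : ℝ → ℝ}
    (hj : Continuous j)
    (h0 : ∀ τ > 0, ∃ δ > 0, ∀ t, |t| < δ → |j t| ≤ τ * twoPower p q t)
    (hinf : ∀ τ > 0, ∃ R > 0, ∀ t, R ≤ |t| → |j t| ≤ τ * twoPower p q t) :
    BrezisLiebCondition (twoPower p q) j := by
  intro ε hε
  set K : ℝ := 2 ^ q with hK
  have hK0 : 0 < K := by positivity
  set τ : ℝ := ε / (2 * (1 + K)) with hτd
  have hτ : 0 < τ := by positivity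
  have hτε : τ * (1 + K) ≤ ε := by rw [hτd]; field_simp; norm_num
  obtain ⟨δ, hδ, h0⟩ := h0 τ hτ
  obtain ⟨R, hR, hinf⟩ := hinf τ hτ
  obtain ⟨M, hM⟩ := (isCompact_Icc (a := -R) (b := R)).exists_bound_of_continuousOn
    hj.continuousOn
  have hM0 : 0 ≤ M := (norm_nonneg _).trans (hM 0 ⟨by linarith, hR.le⟩)
  have hall : ∀ t, |j t| ≤ τ * twoPower p q t + M := by
    intro t
    have := twoPower_nonneg p q t
    rcases le_or_gt R |t| with h | h
    · linarith [hinf t h]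
    · have h1 := hM t (abs_le.1 h.le)
      rw [Real.norm_eq_abs] at h1
      nlinarith [mul_nonneg hτ.le this]
  -- uniform continuity on a compact interval handles moderate `a` and small `b`
  have huc := (isCompact_Icc (a := -(R + 2)) (b := R + 2)).uniformContinuousOn_of_continuous
    hj.continuousOn
  rw [Metric.uniformContinuousOn_iff] at huc
  obtain ⟨η₀, hη₀, huc⟩ := huc (τ * (δ / 2) ^ p) (by positivity)
  set η := min η₀ (min (δ / 2) 1) with hη
  have hη0 : 0 < η := lt_min hη₀ (lt_min (by linarith) one_pos)
  have e1 : η ≤ η₀ := min_le_left _ _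
  have e2 : η ≤ δ / 2 := (min_le_right _ _).trans (min_le_left _ _)
  have e3 : η ≤ 1 := (min_le_right _ _).trans (min_le_right _ _)
  have hηp : 0 < η ^ p := Real.rpow_pos_of_pos hη0 _
  refine ⟨τ * K + 2 * M / η ^ p, by positivity, fun a b => ?_⟩
  have ha0 := twoPower_nonneg p q a
  have hb0 := twoPower_nonneg p q b
  have hadd := mul_le_mul_of_nonneg_left (twoPower_add_le hp hpq a b) hτ.le
  have hMb : 0 ≤ 2 * M / η ^ p * twoPower p q b := by positivity
  have habs := abs_sub (j (a + b)) (j a)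
  have hε' : τ * (1 + K) * twoPower p q a ≤ ε * twoPower p q a :=
    mul_le_mul_of_nonneg_right hτε ha0
  have hτKb : 0 ≤ τ * K * twoPower p q b := by positivity
  rw [← hK] at hadd
  have hsmall : |j (a + b)| ≤ τ * twoPower p q (a + b) → |j a| ≤ τ * twoPower p q a →
      |j (a + b) - j a| ≤ ε * twoPower p q a + (τ * K + 2 * M / η ^ p) * twoPower p q b := by
    intro h1 h2
    nlinarith
  rcases le_or_gt η |b| with hb | hb
  · have h1 := hall (a + b)
    have h2 := hall a
    have h3 : 2 * M ≤ 2 * M / η ^ p * twoPower p q b := by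
      rw [div_mul_eq_mul_div, le_div_iff₀ hηp]
      refine mul_le_mul_of_nonneg_left ?_ (by linarith)
      have := Real.rpow_le_rpow hη0.le hb hp.le
      have h5 : 0 ≤ |b| ^ q := by positivity
      unfold twoPower; linarith
    nlinarith
  rcases lt_or_ge |a| (δ / 2) with ha | ha
  · refine hsmall (h0 _ ?_) (h0 _ (by linarith))
    linarith [abs_add_le a b]
  rcases le_or_gt (R + 1) |a| with ha' | ha'
  · refine hsmall (hinf _ ?_) (hinf _ (by linarith))
    have := abs_sub_abs_le_abs_sub a (-b)
    rw [abs_neg, sub_neg_eq_add] at this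
    linarith
  · have hamem : a ∈ Set.Icc (-(R + 2)) (R + 2) := abs_le.1 (by linarith)
    have habmem : a + b ∈ Set.Icc (-(R + 2)) (R + 2) :=
      abs_le.1 (by linarith [abs_add_le a b])
    have h1 := huc (a + b) habmem a hamem (by
      rw [Real.dist_eq]; simpa using hb.trans_le e1)
    rw [Real.dist_eq] at h1
    have h2 : (δ / 2) ^ p ≤ twoPower p q a := by
      have := Real.rpow_le_rpow (by linarith) ha hp.le
      have h5 : 0 ≤ |a| ^ q := by positivity
      unfold twoPower; linarith
    have h3 := mul_le_mul_of_nonneg_left h2 hτ.le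
    nlinarith [mul_nonneg (mul_nonneg hτ.le hK0.le) ha0]

/-- `|t|^p` satisfies the condition of the Brezis–Lieb lemma with itself as control. -/
theorem brezisLiebCondition_rpow {p : ℝ} (hp : 1 < p) :
    BrezisLiebCondition (fun t => |t| ^ p) (fun t => |t| ^ p) := by
  -- convexity: `|a+b|^p ≤ (1-λ)^{1-p} |a|^p + λ^{1-p} |b|^p` with `λ` small
  have key : ∀ l : ℝ, 0 < l → l < 1 → ∀ a b : ℝ,
      |a + b| ^ p ≤ (1 - l) ^ (1 - p) * |a| ^ p + l ^ (1 - p) * |b| ^ p := by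
    intro l h0 h1 a b
    have hl' : 0 < 1 - l := by linarith
    have hc := (convexOn_rpow hp.le).2 (Set.mem_Ici.2 (show 0 ≤ |a| / (1 - l) by positivity))
      (Set.mem_Ici.2 (show 0 ≤ |b| / l by positivity)) hl'.le h0.le (by ring)
    simp only [smul_eq_mul] at hc
    rw [mul_div_cancel₀ _ hl'.ne', mul_div_cancel₀ _ h0.ne',
      Real.div_rpow (abs_nonneg _) hl'.le, Real.div_rpow (abs_nonneg _) h0.le] at hc
    refine (Real.rpow_le_rpow (abs_nonneg _) (abs_add_le a b) (by linarith)).trans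
      (hc.trans_eq ?_)
    rw [Real.rpow_sub hl', Real.rpow_sub h0, Real.rpow_one, Real.rpow_one]
    ring
  intro ε hε
  have hlim : Tendsto (fun l : ℝ => (1 - l) ^ (1 - p)) (𝓝[>] 0) (𝓝 1) := by
    have : ContinuousAt (fun l : ℝ => (1 - l) ^ (1 - p)) 0 :=
      ContinuousAt.rpow_const (by fun_prop) (Or.inl (by norm_num))
    have h := this.tendsto
    simp only [sub_zero, Real.one_rpow] at h
    exact h.mono_left inf_le_left
  have hev := hlim.eventually (gt_mem_nhds (show (1 : ℝ) < 1 + min ε 1 / 2 by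
    have : 0 < min ε 1 := lt_min hε one_pos
    linarith))
  obtain ⟨l, hl, hl0, hl1⟩ := (hev.and (Ioo_mem_nhdsGT (show (0 : ℝ) < 1 by norm_num))).exists
  set A := (1 - l) ^ (1 - p)
  set B := l ^ (1 - p)
  have hB : 0 < B := Real.rpow_pos_of_pos hl0 _
  have hA : 0 ≤ A := Real.rpow_nonneg (by linarith) _
  have m1 : min ε 1 ≤ ε := min_le_left _ _
  have m2 : min ε 1 ≤ 1 := min_le_right _ _
  refine ⟨2 * B, by linarith, fun a b => ?_⟩
  have ha : 0 ≤ |a| ^ p := by positivity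
  have hb : 0 ≤ |b| ^ p := by positivity
  have hab : 0 ≤ |a + b| ^ p := by positivity
  have k1 := key l hl0 hl1 a b
  have k2 := key l hl0 hl1 (a + b) (-b)
  rw [add_neg_cancel_right, abs_neg] at k2
  have k3 : A * |a + b| ^ p ≤ (1 + min ε 1 / 2) * |a + b| ^ p :=
    mul_le_mul_of_nonneg_right hl.le hab
  have k4 : A * |a| ^ p ≤ (1 + min ε 1 / 2) * |a| ^ p := mul_le_mul_of_nonneg_right hl.le ha
  have hBb : 0 ≤ B * |b| ^ p := by positivity
  have hεa : min ε 1 * |a| ^ p ≤ ε * |a| ^ p := mul_le_mul_of_nonneg_right m1 ha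
  have hm0 : 0 < min ε 1 := lt_min hε one_pos
  have hm0a : 0 ≤ min ε 1 * |a| ^ p := by positivity
  rw [abs_le]
  constructor
  · have hmm : min ε 1 * (min ε 1 * |a| ^ p) ≤ 1 * (min ε 1 * |a| ^ p) :=
      mul_le_mul_of_nonneg_right m2 hm0a
    have hmB : min ε 1 * (B * |b| ^ p) ≤ 1 * (B * |b| ^ p) :=
      mul_le_mul_of_nonneg_right m2 hBb
    -- either `|a+b|^p ≥ |a|^p`, or it may be replaced by `|a|^p` in the error term
    rcases le_total (|a| ^ p) (|a + b| ^ p) with h | h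
    · nlinarith
    · have : min ε 1 * |a + b| ^ p ≤ min ε 1 * |a| ^ p := mul_le_mul_of_nonneg_left h hm0.le
      nlinarith
  · nlinarith

end

section

/-- Every continuous density between `0` and `f(t) t` satisfies the condition of the Brezis–Lieb
lemma, since `f(t) t` is `o(|t|^p)` at `0` and `o(|t|^q)` at infinity. -/
theorem IsSubcriticalNonlinearity.brezisLiebCondition {N : ℕ} {s p q : ℝ} {f : ℝ → ℝ}
    (hf : IsSubcriticalNonlinearity N s p f) (hp : 1 < p) (hpq : p < q) (hq : SubcriticalAt f q)
    {j : ℝ → ℝ} (hj : Continuous j) (hj0 : ∀ t, 0 ≤ j t) (hjf : ∀ t, j t ≤ f t * t) :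
    BrezisLiebCondition (twoPower p q) j := by
  refine brezisLiebCondition_of_littleO (by linarith) hpq hj (fun τ hτ => ?_) (fun τ hτ => ?_)
  · obtain ⟨δ, hδ, h⟩ := hf.abs_le_near_zero hτ
    refine ⟨δ, hδ, fun t ht => ?_⟩
    rw [abs_of_nonneg (hj0 t)]
    have h1 := hf.mul_self_le hp (h t ht)
    rw [mul_assoc, abs_rpow_sub_one_mul (by linarith)] at h1
    have h2 : 0 ≤ τ * |t| ^ q := by positivity
    unfold twoPower
    linarith [hjf t]
  · obtain ⟨R, hR, h⟩ := hq.le_near_infinity hτ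
    refine ⟨R, hR, fun t ht => ?_⟩
    rw [abs_of_nonneg (hj0 t)]
    have h1 := hf.mul_self_le hp (h t ht)
    rw [mul_assoc, abs_rpow_sub_one_mul (by linarith)] at h1
    have h2 : 0 ≤ τ * |t| ^ p := by positivity
    unfold twoPower
    linarith [hjf t]

variable {α : Type*} [MeasurableSpace α] {μ : Measure α}

/-- The Brezis–Lieb lemma for a continuous density `j` controlled by `Φ`. Only almost everywhere
convergence and a bound on `∫ Φ(g_n - g)` are needed. -/
theorem tendsto_integral_sub_of_brezisLieb {Φ j : ℝ → ℝ} (hΦc : Continuous Φ)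
    (hΦ0 : ∀ t, 0 ≤ Φ t) (hΦz : Φ 0 = 0) (hj : Continuous j) (hjz : j 0 = 0)
    (hBL : BrezisLiebCondition Φ j) {g : ℕ → α → ℝ} {g₀ : α → ℝ}
    (hg : ∀ n, AEStronglyMeasurable (g n) μ) (hg₀ : AEStronglyMeasurable g₀ μ)
    (hlim : ∀ᵐ x ∂μ, Tendsto (fun n => g n x) atTop (𝓝 (g₀ x)))
    (hint : ∀ n, Integrable (fun x => Φ (g n x)) μ)
    (hintd : ∀ n, Integrable (fun x => Φ (g n x - g₀ x)) μ)
    (hint₀ : Integrable (fun x => Φ (g₀ x)) μ) {M : ℝ}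
    (hM : ∀ n, ∫ x, Φ (g n x - g₀ x) ∂μ ≤ M) :
    Tendsto (fun n => ∫ x, j (g n x) ∂μ - ∫ x, j (g n x - g₀ x) ∂μ) atTop
      (𝓝 (∫ x, j (g₀ x) ∂μ)) := by
  have hjint : ∀ {h : α → ℝ}, AEStronglyMeasurable h μ → Integrable (fun x => Φ (h x)) μ →
      Integrable (fun x => j (h x)) μ := by
    intro h hh hi
    obtain ⟨C, -, hC⟩ := hBL 1 one_pos
    refine (hi.const_mul C).mono' (hj.comp_aestronglyMeasurable hh) (ae_of_all _ fun x => ?_)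
    have := hC 0 (h x)
    simpa [hΦz, hjz] using this
  have i1 := fun n => hjint (hg n) (hint n)
  have i2 : ∀ n, Integrable (fun x => j (g n x - g₀ x)) μ := fun n =>
    hjint ((hg n).sub hg₀) (hintd n)
  have i3 := hjint hg₀ hint₀
  have hM0 : 0 ≤ M := (integral_nonneg fun x => hΦ0 _).trans (hM 0)
  rw [Metric.tendsto_atTop]
  intro e he
  obtain ⟨ε, hε, hεM⟩ : ∃ ε > 0, ε * M < e / 2 := by
    refine ⟨e / (4 * (M + 1)), by positivity, ?_⟩
    rw [div_mul_eq_mul_div, div_lt_div_iff₀ (by positivity) (by norm_num)]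
    nlinarith
  obtain ⟨C, hC0, hC⟩ := hBL ε hε
  -- `r n` is the part of the defect `d n` which `ε Φ(g n - g₀)` does not absorb; it is dominated
  set d : ℕ → α → ℝ := fun n x => j (g n x) - j (g n x - g₀ x) - j (g₀ x) with hd
  set r : ℕ → α → ℝ := fun n x => max (|d n x| - ε * Φ (g n x - g₀ x)) 0 with hr
  have hbd : ∀ n x, |d n x| ≤ ε * Φ (g n x - g₀ x) + (C * Φ (g₀ x) + |j (g₀ x)|) := by
    intro n x
    have h1 := hC (g n x - g₀ x) (g₀ x)
    rw [sub_add_cancel] at h1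
    have h2 := abs_sub (j (g n x) - j (g n x - g₀ x)) (j (g₀ x))
    simp only [hd]
    linarith
  have hdm : ∀ n, Integrable (d n) μ := fun n => ((i1 n).sub (i2 n)).sub i3
  have hrint : ∀ n, Integrable (r n) μ := fun n =>
    ((hdm n).abs.sub ((hintd n).const_mul ε)).pos_part
  have hrlim : Tendsto (fun n => ∫ x, r n x ∂μ) atTop (𝓝 (∫ _, (0 : ℝ) ∂μ)) := by
    refine tendsto_integral_of_dominated_convergence (fun x => C * Φ (g₀ x) + |j (g₀ x)|)
      (fun n => (hrint n).aestronglyMeasurable) ((hint₀.const_mul C).add i3.abs)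
      (fun n => ae_of_all _ fun x => ?_) ?_
    · rw [Real.norm_eq_abs, abs_of_nonneg (le_max_right _ _)]
      refine max_le (by linarith [hbd n x]) ?_
      have := mul_nonneg hC0 (hΦ0 (g₀ x))
      positivity
    · filter_upwards [hlim] with x hx
      have hx0 : Tendsto (fun n => g n x - g₀ x) atTop (𝓝 0) := by
        simpa using hx.sub_const (g₀ x)
      have t1 := (hj.tendsto (g₀ x)).comp hx
      have t2 := (hj.tendsto 0).comp hx0
      have t3 := (hΦc.tendsto 0).comp hx0
      have t4 := ((((t1.sub t2).sub_const (j (g₀ x))).abs).sub (t3.const_mul ε)).max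
        (tendsto_const_nhds (x := (0 : ℝ)))
      simpa [hjz, hΦz, Function.comp_def] using t4
  rw [integral_zero] at hrlim
  obtain ⟨n₀, hn₀⟩ := (Metric.tendsto_atTop.1 hrlim) (e / 2) (by linarith)
  refine ⟨n₀, fun n hn => ?_⟩
  have h1 := hn₀ n hn
  rw [Real.dist_eq, sub_zero] at h1
  have e1 : ∫ x, j (g n x) ∂μ - ∫ x, j (g n x - g₀ x) ∂μ - ∫ x, j (g₀ x) ∂μ
      = ∫ x, d n x ∂μ := by
    rw [← integral_sub (i1 n) (i2 n)]
    exact (integral_sub ((i1 n).sub (i2 n)) i3).symm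
  rw [Real.dist_eq, e1]
  calc |∫ x, d n x ∂μ| ≤ ∫ x, |d n x| ∂μ := abs_integral_le_integral_abs
    _ ≤ ∫ x, (ε * Φ (g n x - g₀ x) + r n x) ∂μ := by
        refine integral_mono (hdm n).abs (((hintd n).const_mul ε).add (hrint n)) fun x => ?_
        simp only [hr]
        linarith [le_max_left (|d n x| - ε * Φ (g n x - g₀ x)) 0]
    _ = ε * ∫ x, Φ (g n x - g₀ x) ∂μ + ∫ x, r n x ∂μ := by
        rw [integral_add ((hintd n).const_mul ε) (hrint n), integral_const_mul]
    _ < e := by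
        have h3 := mul_le_mul_of_nonneg_left (hM n) hε.le
        have h4 := (le_abs_self _).trans_lt h1
        linarith

/-! ### Tools for `L^p` functions -/

theorem ofReal_ne_zero_of_one_lt {p : ℝ} (hp : 1 < p) : ENNReal.ofReal p ≠ 0 := by
  simp; linarith

theorem memLp_iff_integrable_abs_rpow {p : ℝ} (hp : 0 < p) {g : α → ℝ} :
    MemLp g (ENNReal.ofReal p) μ ↔
      AEStronglyMeasurable g μ ∧ Integrable (fun x => |g x| ^ p) μ := by
  have h0 : ENNReal.ofReal p ≠ 0 := by simpa using hp
  constructor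
  · intro h
    refine ⟨h.1, ?_⟩
    have := h.integrable_norm_rpow h0 ENNReal.ofReal_ne_top
    simpa [ENNReal.toReal_ofReal hp.le] using this
  · rintro ⟨h1, h2⟩
    rw [← integrable_norm_rpow_iff h1 h0 ENNReal.ofReal_ne_top]
    simpa [ENNReal.toReal_ofReal hp.le] using h2

theorem integrable_abs_rpow {p : ℝ} (hp : 0 < p) {g : α → ℝ}
    (hg : MemLp g (ENNReal.ofReal p) μ) : Integrable (fun x => |g x| ^ p) μ :=
  ((memLp_iff_integrable_abs_rpow hp).1 hg).2

theorem abs_rpow_mul_abs_le {r : ℝ} (hr : 1 < r) (a b : ℝ) :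
    |a| ^ (r - 1) * |b| ≤ |a| ^ r + |b| ^ r := by
  have hr0 : r ≠ 0 := by linarith
  rcases le_total |a| |b| with h | h
  · have h1 : |a| ^ (r - 1) ≤ |b| ^ (r - 1) := Real.rpow_le_rpow (abs_nonneg _) h (by linarith)
    have h2 := mul_le_mul_of_nonneg_right h1 (abs_nonneg b)
    rw [abs_rpow_sub_one_mul hr0] at h2
    have : 0 ≤ |a| ^ r := by positivity
    linarith
  · have h2 := mul_le_mul_of_nonneg_left h (show 0 ≤ |a| ^ (r - 1) by positivity)
    rw [abs_rpow_sub_one_mul hr0] at h2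
    have : 0 ≤ |b| ^ r := by positivity
    linarith

theorem abs_rpow_sub_two_mul_mul {p : ℝ} (hp : p ≠ 0) (a : ℝ) :
    |a| ^ (p - 2) * a * a = |a| ^ p := by
  rcases eq_or_ne a 0 with h | h
  · simp [h, hp]
  · have h0 : 0 < |a| := abs_pos.2 h
    rw [mul_assoc, ← abs_mul_abs_self a, ← mul_assoc]
    have e : p - 2 = p - 1 - 1 := by ring
    rw [e, rpow_mul_eq h0, rpow_mul_eq h0]

theorem abs_abs_rpow_sub_two_mul {p : ℝ} (hp : 1 < p) (a : ℝ) :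
    |(|a| ^ (p - 2) * a)| = |a| ^ (p - 1) := by
  rw [abs_mul, abs_of_nonneg (by positivity)]
  have e : p - 2 = p - 1 - 1 := by ring
  rw [e, abs_rpow_sub_one_mul (by linarith)]

theorem continuous_abs_rpow_sub_two_mul {p : ℝ} (hp : 1 < p) :
    Continuous fun a : ℝ => |a| ^ (p - 2) * a := by
  rw [continuous_iff_continuousAt]
  intro a
  rcases eq_or_ne a 0 with rfl | h
  · have h1 : Tendsto (fun a : ℝ => |a| ^ (p - 1)) (𝓝 0) (𝓝 0) := by
      have : Continuous fun a : ℝ => |a| ^ (p - 1) :=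
        (Real.continuous_rpow_const (by linarith)).comp continuous_abs
      have h := this.tendsto 0
      rwa [abs_zero, Real.zero_rpow (by linarith)] at h
    change Tendsto _ _ (𝓝 (|(0 : ℝ)| ^ (p - 2) * 0))
    rw [mul_zero]
    refine squeeze_zero_norm (fun a => ?_) h1
    rw [Real.norm_eq_abs, abs_abs_rpow_sub_two_mul hp]
  · exact (ContinuousAt.rpow_const continuous_abs.continuousAt (Or.inl (by simpa))).mul
      continuousAt_id

theorem integrable_abs_rpow_sub_two_mul_mul {p : ℝ} (hp : 1 < p) {a b : α → ℝ}
    (ha : MemLp a (ENNReal.ofReal p) μ) (hb : MemLp b (ENNReal.ofReal p) μ) :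
    Integrable (fun x => |a x| ^ (p - 2) * a x * b x) μ := by
  have hp0 : 0 < p := by linarith
  refine ((integrable_abs_rpow hp0 ha).add (integrable_abs_rpow hp0 hb)).mono'
    (((continuous_abs_rpow_sub_two_mul hp).comp_aestronglyMeasurable ha.1).mul hb.1)
    (ae_of_all _ fun x => ?_)
  rw [Real.norm_eq_abs, abs_mul, abs_abs_rpow_sub_two_mul hp]
  exact abs_rpow_mul_abs_le hp _ _

theorem convexOn_abs_rpow {p : ℝ} (hp : 1 < p) : ConvexOn ℝ Set.univ fun t : ℝ => |t| ^ p := by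
  refine ⟨convex_univ, fun x _ y _ c d hc hd hcd => ?_⟩
  have h := (convexOn_rpow hp.le).2 (Set.mem_Ici.2 (abs_nonneg x))
    (Set.mem_Ici.2 (abs_nonneg y)) hc hd hcd
  simp only [smul_eq_mul] at h ⊢
  refine (Real.rpow_le_rpow (abs_nonneg _) ?_ (by linarith)).trans h
  refine (abs_add_le _ _).trans_eq ?_
  rw [abs_mul, abs_mul, abs_of_nonneg hc, abs_of_nonneg hd]

theorem continuous_abs_rpow {p : ℝ} (hp : 0 < p) : Continuous fun t : ℝ => |t| ^ p :=
  (Real.continuous_rpow_const hp.le).comp continuous_abs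

/-- A bound, uniform in `σ`, for the difference quotients of `|·|^p` at `a` in direction `b`. -/
theorem abs_slope_rpow_le {p : ℝ} (hp : 1 < p) (a b : ℝ) {σ : ℝ} (h0 : 0 < σ) (h1 : σ ≤ 1) :
    |(|a + σ * b| ^ p - |a| ^ p) / σ| ≤ 2 ^ p * (|a| ^ p + |b| ^ p) + |a| ^ p := by
  have hconv := convexOn_abs_rpow hp
  -- convexity on the segments from `a` to `a + b` and from `a + σ b` to `a - b`
  have hup := hconv.2 (Set.mem_univ a) (Set.mem_univ (a + b)) (sub_nonneg.2 h1) h0.le (by ring)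
  have hlow := hconv.2 (Set.mem_univ (a + σ * b)) (Set.mem_univ (a - b))
    (show 0 ≤ 1 / (1 + σ) by positivity) (show 0 ≤ σ / (1 + σ) by positivity) (by field_simp)
  simp only [smul_eq_mul] at hup hlow
  have e1 : (1 - σ) * a + σ * (a + b) = a + σ * b := by ring
  have e2 : 1 / (1 + σ) * (a + σ * b) + σ / (1 + σ) * (a - b) = a := by field_simp; ring
  rw [e1] at hup
  rw [e2, ← mul_div_right_comm, ← mul_div_right_comm, ← add_div, le_div_iff₀ (by positivity)]
    at hlow
  have k1 := abs_add_rpow_le (r := p) (by linarith) a b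
  have k2 := abs_add_rpow_le (r := p) (by linarith) a (-b)
  rw [abs_neg, ← sub_eq_add_neg] at k2
  have na : 0 ≤ |a| ^ p := by positivity
  rw [abs_le, le_div_iff₀ h0, div_le_iff₀ h0]
  constructor
  · nlinarith
  · nlinarith

/-- Directional derivative of `a ↦ ∫ |a|^p`, along sequences. -/
theorem tendsto_slope_integral_abs_rpow {p : ℝ} (hp : 1 < p) {a b : α → ℝ}
    (ha : MemLp a (ENNReal.ofReal p) μ) (hb : MemLp b (ENNReal.ofReal p) μ) {σ : ℕ → ℝ}
    (hσ0 : ∀ n, 0 < σ n) (hσ1 : ∀ n, σ n ≤ 1) (hσ : Tendsto σ atTop (𝓝 0)) :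
    Tendsto (fun n => (∫ x, |a x + σ n * b x| ^ p ∂μ - ∫ x, |a x| ^ p ∂μ) / σ n) atTop
      (𝓝 (p * ∫ x, |a x| ^ (p - 2) * a x * b x ∂μ)) := by
  have hp0 : 0 < p := by linarith
  have ia := integrable_abs_rpow hp0 ha
  have ib := integrable_abs_rpow hp0 hb
  have iab : ∀ n, Integrable (fun x => |a x + σ n * b x| ^ p) μ := fun n =>
    integrable_abs_rpow hp0 (ha.add (hb.const_mul (σ n)))
  have e : ∀ n, (∫ x, |a x + σ n * b x| ^ p ∂μ - ∫ x, |a x| ^ p ∂μ) / σ n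
      = ∫ x, (|a x + σ n * b x| ^ p - |a x| ^ p) / σ n ∂μ := fun n => by
    rw [integral_div, integral_sub (iab n) ia]
  simp only [e]
  rw [← integral_const_mul]
  refine tendsto_integral_of_dominated_convergence
    (fun x => 2 ^ p * (|a x| ^ p + |b x| ^ p) + |a x| ^ p)
    (fun n => (((iab n).sub ia).div_const _).aestronglyMeasurable)
    (((ia.add ib).const_mul _).add ia)
    (fun n => ae_of_all _ fun x => abs_slope_rpow_le hp _ _ (hσ0 n) (hσ1 n))
    (ae_of_all _ fun x => ?_)
  have hd : HasDerivAt (fun σ : ℝ => |a x + σ * b x| ^ p)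
      (p * |a x| ^ (p - 2) * a x * b x) 0 := by
    have h1 := hasDerivAt_abs_rpow (a x + 0 * b x) hp
    have h2 : HasDerivAt (fun σ : ℝ => a x + σ * b x) (b x) 0 := by
      simpa using ((hasDerivAt_id (0 : ℝ)).mul_const (b x)).const_add (a x)
    have h3 := h1.comp (0 : ℝ) h2
    have e : p * |a x + 0 * b x| ^ (p - 2) * (a x + 0 * b x) * b x
        = p * |a x| ^ (p - 2) * a x * b x := by simp
    rw [e] at h3
    exact h3
  have hs := hd.tendsto_slope
  have hσ' : Tendsto σ atTop (𝓝[≠] 0) :=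
    tendsto_nhdsWithin_iff.2 ⟨hσ, Eventually.of_forall fun n => (hσ0 n).ne'⟩
  have := hs.comp hσ'
  simp only [Function.comp_def, slope_def_field, sub_zero, zero_mul, add_zero] at this
  convert this using 2
  ring

/-- Fatou's lemma for `L^p` bounds. -/
theorem memLp_of_tendsto_of_integral_le {p : ℝ} (hp : 1 < p) {g : ℕ → α → ℝ} {g₀ : α → ℝ}
    (hg : ∀ n, MemLp (g n) (ENNReal.ofReal p) μ) {M : ℝ} (hM : ∀ n, ∫ x, |g n x| ^ p ∂μ ≤ M)
    (hlim : ∀ᵐ x ∂μ, Tendsto (fun n => g n x) atTop (𝓝 (g₀ x))) :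
    MemLp g₀ (ENNReal.ofReal p) μ ∧ ∫ x, |g₀ x| ^ p ∂μ ≤ M := by
  have hp0 : 0 < p := by linarith
  have hm : AEStronglyMeasurable g₀ μ :=
    aestronglyMeasurable_of_tendsto_ae atTop (fun n => (hg n).1) hlim
  have hc : Continuous fun t : ℝ => |t| ^ p :=
    (Real.continuous_rpow_const hp0.le).comp continuous_abs
  have hM0 : 0 ≤ M := (integral_nonneg fun x => by positivity).trans (hM 0)
  have hle : ∫⁻ x, ENNReal.ofReal (|g₀ x| ^ p) ∂μ ≤ ENNReal.ofReal M := by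
    calc ∫⁻ x, ENNReal.ofReal (|g₀ x| ^ p) ∂μ
        = ∫⁻ x, liminf (fun n => ENNReal.ofReal (|g n x| ^ p)) atTop ∂μ := by
          refine lintegral_congr_ae ?_
          filter_upwards [hlim] with x hx
          exact ((ENNReal.continuous_ofReal.tendsto _).comp
            ((hc.tendsto _).comp hx)).liminf_eq.symm
      _ ≤ liminf (fun n => ∫⁻ x, ENNReal.ofReal (|g n x| ^ p) ∂μ) atTop :=
          lintegral_liminf_le' fun n =>
            (hc.comp_aestronglyMeasurable (hg n).1).aemeasurable.ennreal_ofReal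
      _ ≤ ENNReal.ofReal M := by
          refine liminf_le_of_frequently_le' (Frequently.of_forall fun n => ?_)
          rw [← ofReal_integral_eq_lintegral_ofReal (integrable_abs_rpow hp0 (hg n))
            (ae_of_all _ fun x => by positivity)]
          exact ENNReal.ofReal_le_ofReal (hM n)
  have hint : Integrable (fun x => |g₀ x| ^ p) μ := by
    refine ⟨hc.comp_aestronglyMeasurable hm, ?_⟩
    rw [hasFiniteIntegral_iff_ofReal (ae_of_all _ fun x => by positivity)]
    exact hle.trans_lt ENNReal.ofReal_lt_top
  refine ⟨(memLp_iff_integrable_abs_rpow hp0).2 ⟨hm, hint⟩, ?_⟩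
  rw [← ofReal_integral_eq_lintegral_ofReal hint (ae_of_all _ fun x => by positivity)] at hle
  exact (ENNReal.ofReal_le_ofReal_iff hM0).1 hle

end

/-! ### The fractional Sobolev space and subcritical inequalities -/

section

variable {N : ℕ} {s p : ℝ}

/-- The difference quotient `(u(x) - u(y)) / |x - y|^{(N + s p) / p}`, linear in `u`, whose
`p`-th power is the Gagliardo integrand. -/
def diffQuotient (N : ℕ) (s p : ℝ) (u : Space N → ℝ) (z : Space N × Space N) : ℝ :=
  (u z.1 - u z.2) / ‖z.1 - z.2‖ ^ (((N : ℝ) + s * p) / p)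

theorem gagliardoIntegrand_eq (hp : 1 < p) (u : Space N → ℝ) (z : Space N × Space N) :
    gagliardoIntegrand N s p u z = |diffQuotient N s p u z| ^ p := by
  have hp0 : p ≠ 0 := by linarith
  unfold gagliardoIntegrand diffQuotient
  rw [abs_div, Real.div_rpow (abs_nonneg _) (abs_nonneg _),
    abs_of_nonneg (Real.rpow_nonneg (norm_nonneg _) _), ← Real.rpow_mul (norm_nonneg _),
    div_mul_cancel₀ _ hp0]

theorem gagliardoIntegrand_eq_fun (hp : 1 < p) (u : Space N → ℝ) :
    gagliardoIntegrand N s p u = fun z => |diffQuotient N s p u z| ^ p :=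
  funext fun z => gagliardoIntegrand_eq hp u z

theorem gagliardoIntegrand_nonneg (u : Space N → ℝ) (z : Space N × Space N) :
    0 ≤ gagliardoIntegrand N s p u z := by
  unfold gagliardoIntegrand; positivity

theorem aestronglyMeasurable_diffQuotient {u : Space N → ℝ}
    (hu : AEStronglyMeasurable u volume) :
    AEStronglyMeasurable (diffQuotient N s p u) volume := by
  have h1 : AEStronglyMeasurable (fun z : Space N × Space N => u z.1) volume := hu.comp_fst
  have h2 : AEStronglyMeasurable (fun z : Space N × Space N => u z.2) volume := hu.comp_snd
  have h3 : Measurable fun z : Space N × Space N =>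
      ‖z.1 - z.2‖ ^ (((N : ℝ) + s * p) / p) := by fun_prop
  exact ((h1.sub h2).aemeasurable.div h3.aemeasurable).aestronglyMeasurable

theorem memSobolev_iff (hp : 1 < p) {u : Space N → ℝ} :
    MemSobolev N s p u ↔ MemLp u (ENNReal.ofReal p) volume ∧
      MemLp (diffQuotient N s p u) (ENNReal.ofReal p) volume := by
  have hp0 : 0 < p := by linarith
  unfold MemSobolev
  rw [gagliardoIntegrand_eq_fun hp]
  refine and_congr_right fun h => ?_
  rw [memLp_iff_integrable_abs_rpow hp0]
  exact (and_iff_right (aestronglyMeasurable_diffQuotient h.1)).symm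

theorem volume_ball_eq (hN : N ≠ 0) (x : Space N) {h : ℝ} (hh : 0 ≤ h) :
    volume (Metric.ball x h) =
      ENNReal.ofReal (h ^ N * (volume (Metric.ball (0 : Space N) 1)).toReal) := by
  have : NeZero N := ⟨hN⟩
  have : Nontrivial (Space N) := inferInstance
  rw [Measure.addHaar_ball volume x hh, ENNReal.ofReal_mul (by positivity),
    ENNReal.ofReal_toReal measure_ball_lt_top.ne]
  simp

theorem unitBall_pos (N : ℕ) : 0 < (volume (Metric.ball (0 : Space N) 1)).toReal :=
  ENNReal.toReal_pos (Metric.measure_ball_pos _ _ one_pos).ne' measure_ball_lt_top.ne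

/-- One step of the bootstrap towards the Sobolev exponent. If `∫ |u|^r ≤ B`, then for `u(x) ≠ 0`
the set where `|u| ≥ |u(x)| / 2` fills at most half of a suitable ball around `x`; on the rest of
the ball `|u(x) - u(y)| ≥ |u(x)| / 2`, which bounds `|u(x)|^{p + r s p / N}` by the inner Gagliardo
integral at `x`. -/
theorem exists_pointwise_bootstrap (hs : 0 < s) (hp : 1 < p) (hN : N ≠ 0) {r B : ℝ} (hr : 0 < r)
    (hB : 0 < B) : ∃ C > 0, ∀ u : Space N → ℝ, AEStronglyMeasurable u volume →
      (∫⁻ y, ENNReal.ofReal (|u y| ^ r)) ≤ ENNReal.ofReal B → ∀ x,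
      ENNReal.ofReal (|u x| ^ (p + r * (s * p / N))) ≤
        ENNReal.ofReal C * ∫⁻ y, ENNReal.ofReal (gagliardoIntegrand N s p u (x, y)) := by
  set ω := (volume (Metric.ball (0 : Space N) 1)).toReal with hω
  have hω0 : 0 < ω := unitBall_pos N
  have hN0 : (0 : ℝ) < N := by positivity
  have hp0 : 0 < p := by linarith
  have hsp : 0 < s * p := by positivity
  set C : ℝ := 2 / ω * 2 ^ p * (2 * 2 ^ r * B / ω) ^ (s * p / N) with hC
  refine ⟨C, by positivity, fun u hu hur x => ?_⟩
  rcases eq_or_ne (u x) 0 with h0 | h0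
  · have : p + r * (s * p / N) ≠ 0 := by positivity
    simp [h0, this]
  set G := ∫⁻ y, ENNReal.ofReal (gagliardoIntegrand N s p u (x, y)) with hG
  by_cases hGt : G = ⊤
  · rw [hGt, ENNReal.mul_top (by simp; positivity)]; exact le_top
  set a := |u x| with ha
  have ha0 : 0 < a := abs_pos.2 h0
  set h : ℝ := (2 * (2 / a) ^ r * B / ω) ^ (1 / (N : ℝ)) with hh
  have hh0 : 0 < h := by positivity
  have hhN : h ^ N = 2 * (2 / a) ^ r * B / ω := by
    rw [hh, ← Real.rpow_natCast, ← Real.rpow_mul (by positivity), one_div,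
      inv_mul_cancel₀ hN0.ne', Real.rpow_one]
  set m1 : ℝ := (a / 2) ^ p / h ^ ((N : ℝ) + s * p) with hm1
  have hm10 : 0 < m1 := by positivity
  set S1 := {y | ENNReal.ofReal m1 ≤ ENNReal.ofReal (gagliardoIntegrand N s p u (x, y))}
  set S2 := {y | ENNReal.ofReal ((a / 2) ^ r) ≤ ENNReal.ofReal (|u y| ^ r)}
  have hcover : Metric.ball x h ⊆ S1 ∪ S2 := by
    intro y hy
    rw [Metric.mem_ball, dist_comm, dist_eq_norm] at hy
    rcases le_or_gt (a / 2) |u y| with h2 | h2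
    · right
      exact ENNReal.ofReal_le_ofReal (Real.rpow_le_rpow (by positivity) h2 hr.le)
    · left
      refine ENNReal.ofReal_le_ofReal ?_
      have h3 : a / 2 ≤ |u x - u y| := by
        have := abs_sub_abs_le_abs_sub (u x) (u y); linarith
      have hxy : 0 < ‖x - y‖ := by
        rw [norm_pos_iff, sub_ne_zero]
        rintro rfl
        rw [sub_self, abs_zero] at h3; linarith
      unfold gagliardoIntegrand
      exact div_le_div₀ (by positivity) (Real.rpow_le_rpow (by positivity) h3 hp0.le)
        (by positivity) (Real.rpow_le_rpow hxy.le hy.le (by positivity))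
  have hmeas1 : AEMeasurable (fun y => ENNReal.ofReal (gagliardoIntegrand N s p u (x, y)))
      volume := by
    refine AEMeasurable.ennreal_ofReal ?_
    unfold gagliardoIntegrand
    have h1 : AEMeasurable (fun y => |u x - u y| ^ p) volume :=
      ((hu.aemeasurable.const_sub (u x)).abs).pow_const p
    have h2 : Measurable fun y => ‖x - y‖ ^ ((N : ℝ) + s * p) := by fun_prop
    exact h1.div h2.aemeasurable
  have hmeas2 : AEMeasurable (fun y => ENNReal.ofReal (|u y| ^ r)) volume :=
    (hu.aemeasurable.abs.pow_const r).ennreal_ofReal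
  have hv1 := mul_meas_ge_le_lintegral₀ hmeas1 (ENNReal.ofReal m1)
  have hv2 := (mul_meas_ge_le_lintegral₀ hmeas2 (ENNReal.ofReal ((a / 2) ^ r))).trans hur
  have hm1' : ENNReal.ofReal m1 ≠ 0 := by simpa using hm10
  have hm2 : 0 < (a / 2) ^ r := by positivity
  have hm2' : ENNReal.ofReal ((a / 2) ^ r) ≠ 0 := by simpa using hm2
  have hS1 : volume S1 ≠ ⊤ := fun ht => by
    rw [show volume {y | _} = ⊤ from ht, ENNReal.mul_top hm1'] at hv1
    exact hGt (top_le_iff.1 hv1)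
  have hS2 : volume S2 ≠ ⊤ := fun ht => by
    rw [show volume {y | _} = ⊤ from ht, ENNReal.mul_top hm2'] at hv2
    exact ENNReal.ofReal_ne_top (top_le_iff.1 hv2)
  have r1 : m1 * (volume S1).toReal ≤ G.toReal := by
    have := ENNReal.toReal_mono hGt hv1
    rwa [ENNReal.toReal_mul, ENNReal.toReal_ofReal hm10.le] at this
  have r2 : (a / 2) ^ r * (volume S2).toReal ≤ B := by
    have := ENNReal.toReal_mono ENNReal.ofReal_ne_top hv2
    rwa [ENNReal.toReal_mul, ENNReal.toReal_ofReal hm2.le, ENNReal.toReal_ofReal hB.le] at this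
  have r3 : h ^ N * ω ≤ (volume S1).toReal + (volume S2).toReal := by
    have h1 := (measure_mono (μ := volume) hcover).trans (measure_union_le S1 S2)
    have h2 := ENNReal.toReal_mono (ENNReal.add_ne_top.2 ⟨hS1, hS2⟩) h1
    rwa [volume_ball_eq hN x hh0.le, ENNReal.toReal_ofReal (by positivity),
      ENNReal.toReal_add hS1 hS2] at h2
  have e2 : (2 / a) ^ r * (a / 2) ^ r = 1 := by
    rw [← Real.mul_rpow (by positivity) (by positivity)]
    have : 2 / a * (a / 2) = 1 := by field_simp
    rw [this, Real.one_rpow]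
  have r2' : (volume S2).toReal ≤ h ^ N * ω / 2 := by
    rw [hhN]
    have h1 := mul_le_mul_of_nonneg_left r2 (show 0 ≤ (2 / a) ^ r by positivity)
    rw [← mul_assoc, e2, one_mul] at h1
    refine h1.trans_eq ?_
    field_simp
  have hg0 : 0 ≤ G.toReal := ENNReal.toReal_nonneg
  have r4 : h ^ N * ω / 2 * m1 ≤ G.toReal := by
    have h1 : h ^ N * ω / 2 ≤ (volume S1).toReal := by linarith
    have := mul_le_mul_of_nonneg_left h1 hm10.le
    linarith
  have e3 : h ^ N * ω / 2 * m1 = (ω / 2 / 2 ^ p) * a ^ p / h ^ (s * p) := by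
    rw [hm1, Real.rpow_add hh0, Real.rpow_natCast, Real.div_rpow ha0.le (by norm_num)]
    field_simp
  have e4 : h ^ (s * p) = (2 * 2 ^ r * B / ω) ^ (s * p / N) / a ^ (r * (s * p / N)) := by
    have e : 2 * (2 / a) ^ r * B / ω = (2 * 2 ^ r * B / ω) / a ^ r := by
      rw [Real.div_rpow (by norm_num) ha0.le]; field_simp
    rw [hh, ← Real.rpow_mul (by positivity), e, Real.div_rpow (by positivity) (by positivity),
      ← Real.rpow_mul ha0.le]
    congr 2 <;> ring
  have r5 : a ^ (p + r * (s * p / N)) ≤ C * G.toReal := by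
    rw [e3, e4] at r4
    have hA : 0 < (2 * 2 ^ r * B / ω) ^ (s * p / N) := by positivity
    rw [Real.rpow_add ha0, hC]
    have e5 : ω / 2 / 2 ^ p * a ^ p / ((2 * 2 ^ r * B / ω) ^ (s * p / N) / a ^ (r * (s * p / N)))
      = (a ^ p * a ^ (r * (s * p / N))) / (2 / ω * 2 ^ p * (2 * 2 ^ r * B / ω) ^ (s * p / N)) := by
      have : 0 < a ^ (r * (s * p / N)) := by positivity
      field_simp
    rw [e5, div_le_iff₀ (by positivity)] at r4
    linarith
  calc ENNReal.ofReal (a ^ (p + r * (s * p / N))) ≤ ENNReal.ofReal (C * G.toReal) :=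
        ENNReal.ofReal_le_ofReal r5
    _ = ENNReal.ofReal C * G := by
        rw [ENNReal.ofReal_mul (by positivity), ENNReal.ofReal_toReal hGt]

/-- `|u|^r` is integrable with a uniform bound on the unit ball of `W^{s,p}`. -/
def UnitBallBound (N : ℕ) (s p r : ℝ) : Prop :=
  ∃ C > 0, ∀ u : Space N → ℝ, MemSobolev N s p u →
    (∫ z, gagliardoIntegrand N s p u z) + ∫ x, |u x| ^ p ≤ 1 →
    Integrable (fun x => |u x| ^ r) ∧ ∫ x, |u x| ^ r ≤ C

theorem lintegral_gagliardo_eq {u : Space N → ℝ} (hu : MemSobolev N s p u) :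
    ∫⁻ x, ∫⁻ y, ENNReal.ofReal (gagliardoIntegrand N s p u (x, y)) =
      ENNReal.ofReal (∫ z, gagliardoIntegrand N s p u z) := by
  rw [ofReal_integral_eq_lintegral_ofReal hu.2
    (ae_of_all _ fun z => gagliardoIntegrand_nonneg u z)]
  exact (lintegral_prod (μ := (volume : Measure (Space N))) (ν := (volume : Measure (Space N)))
    (fun z => ENNReal.ofReal (gagliardoIntegrand N s p u z))
    hu.2.1.aemeasurable.ennreal_ofReal).symm

theorem integrable_of_lintegral_le {α : Type*} [MeasurableSpace α] {μ : Measure α} {g : α → ℝ}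
    (hg : AEStronglyMeasurable g μ) (h0 : ∀ x, 0 ≤ g x) {C : ℝ} (hC : 0 ≤ C)
    (h : ∫⁻ x, ENNReal.ofReal (g x) ∂μ ≤ ENNReal.ofReal C) :
    Integrable g μ ∧ ∫ x, g x ∂μ ≤ C := by
  have hi : Integrable g μ := by
    refine ⟨hg, ?_⟩
    rw [hasFiniteIntegral_iff_ofReal (ae_of_all _ h0)]
    exact h.trans_lt ENNReal.ofReal_lt_top
  refine ⟨hi, ?_⟩
  rw [← ofReal_integral_eq_lintegral_ofReal hi (ae_of_all _ h0)] at h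
  exact (ENNReal.ofReal_le_ofReal_iff hC).1 h

theorem UnitBallBound.step (hs : 0 < s) (hp : 1 < p) (hN : N ≠ 0) {r : ℝ} (hr : 0 < r)
    (h : UnitBallBound N s p r) : UnitBallBound N s p (p + r * (s * p / N)) := by
  obtain ⟨B, hB, h⟩ := h
  obtain ⟨C, hC, hpt⟩ := exists_pointwise_bootstrap (N := N) hs hp hN hr hB
  refine ⟨C, hC, fun u hu h1 => ?_⟩
  obtain ⟨hi, hle⟩ := h u hu h1
  have hlr : ∫⁻ y, ENNReal.ofReal (|u y| ^ r) ≤ ENNReal.ofReal B := by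
    rw [← ofReal_integral_eq_lintegral_ofReal hi (ae_of_all _ fun x => by positivity)]
    exact ENNReal.ofReal_le_ofReal hle
  have hpt' := hpt u hu.1.1 hlr
  have hp' : 0 ≤ ∫ x, |u x| ^ p := integral_nonneg fun x => by positivity
  refine integrable_of_lintegral_le ?_ (fun x => by positivity) hC.le ?_
  · exact (hu.1.1.aemeasurable.abs.pow_const _).aestronglyMeasurable
  · calc _ ≤ ∫⁻ x, ENNReal.ofReal C *
          ∫⁻ y, ENNReal.ofReal (gagliardoIntegrand N s p u (x, y)) := lintegral_mono hpt'
      _ = ENNReal.ofReal C *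
          ∫⁻ x, ∫⁻ y, ENNReal.ofReal (gagliardoIntegrand N s p u (x, y)) :=
          lintegral_const_mul' _ _ ENNReal.ofReal_ne_top
      _ ≤ ENNReal.ofReal C * ENNReal.ofReal 1 := by
          rw [lintegral_gagliardo_eq hu]
          gcongr
          linarith
      _ = ENNReal.ofReal C := by simp

theorem unitBallBound_self (hp : 1 < p) : UnitBallBound N s p p := by
  refine ⟨1, one_pos, fun u hu h1 => ⟨integrable_abs_rpow (by linarith) hu.1, ?_⟩⟩
  have : 0 ≤ ∫ z, gagliardoIntegrand N s p u z :=
    integral_nonneg fun z => gagliardoIntegrand_nonneg u z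
  linarith

/-- Iterating the bootstrap `r ↦ p + r s p / N` from `p` reaches every subcritical exponent. -/
theorem exists_unitBallBound_gt (hs : 0 < s) (hp : 1 < p) (hN : s * p < N) {q : ℝ}
    (hq : q < N * p / (N - s * p)) : ∃ r, q < r ∧ UnitBallBound N s p r := by
  have hsp : 0 < s * p := by nlinarith
  have hN0 : (0 : ℝ) < N := hsp.trans hN
  have hN' : N ≠ 0 := by rintro rfl; simp at hN0
  have hd : 0 < N - s * p := by linarith
  set P := N * p / (N - s * p) with hP
  set l := s * p / N with hl
  have hl0 : 0 < l := by positivity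
  have hl1 : l < 1 := (div_lt_one hN0).2 hN
  have hPp : p < P := by
    rw [hP, lt_div_iff₀ hd]
    nlinarith
  have hfix : p + P * l = P := by
    have h1 : P * (N - s * p) = N * p := div_mul_cancel₀ _ hd.ne'
    have h2 : P * (s * p / N) * N = P * (s * p) := by field_simp
    have h3 : (p + P * (s * p / N)) * N = P * N := by linarith
    exact mul_right_cancel₀ hN0.ne' h3
  have hk : ∀ k : ℕ, UnitBallBound N s p (P - l ^ k * (P - p)) := by
    intro k
    induction k with
    | zero => simpa using unitBallBound_self hp
    | succ k ih =>
      have hpos : 0 < P - l ^ k * (P - p) := by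
        have := pow_le_one₀ hl0.le hl1.le (n := k)
        nlinarith
      have := ih.step hs hp hN' hpos
      have e : p + (P - l ^ k * (P - p)) * (s * p / N) = P - l ^ (k + 1) * (P - p) := by
        rw [← hl, pow_succ]
        linear_combination hfix
      rwa [e] at this
  have hlim : Tendsto (fun k : ℕ => P - l ^ k * (P - p)) atTop (𝓝 (P - 0 * (P - p))) :=
    ((tendsto_pow_atTop_nhds_zero_of_lt_one hl0.le hl1).mul_const _).const_sub _
  rw [zero_mul, sub_zero] at hlim
  obtain ⟨k, hk'⟩ := (hlim.eventually (lt_mem_nhds hq)).exists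
  exact ⟨_, hk', hk k⟩

theorem exists_rpow_le_interpolation {q r η : ℝ} (hp : 0 < p) (hpq : p < q) (hqr : q < r)
    (hη : 0 < η) : ∃ C > 0, ∀ t : ℝ, |t| ^ q ≤ η * |t| ^ r + C * |t| ^ p := by
  have hlim := (tendsto_rpow_neg_atTop (y := r - q) (by linarith)).eventually (gt_mem_nhds hη)
  obtain ⟨R, hR, hR1⟩ := (hlim.and (eventually_ge_atTop 1)).exists
  refine ⟨R ^ (q - p), by positivity, fun t => ?_⟩
  have n1 : 0 ≤ η * |t| ^ r := by positivity
  have n2 : 0 ≤ R ^ (q - p) * |t| ^ p := by positivity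
  rcases eq_or_ne t 0 with rfl | h0
  · rw [abs_zero, Real.zero_rpow (by linarith)]
    rw [abs_zero] at n1 n2
    linarith
  have ht : 0 < |t| := abs_pos.2 h0
  rcases le_total |t| R with h | h
  · have e : |t| ^ q = |t| ^ (q - p) * |t| ^ p := by rw [← Real.rpow_add ht]; ring_nf
    rw [e]
    have := mul_le_mul_of_nonneg_right (Real.rpow_le_rpow ht.le h (by linarith : 0 ≤ q - p))
      (show 0 ≤ |t| ^ p by positivity)
    linarith
  · have e : |t| ^ q = |t| ^ (-(r - q)) * |t| ^ r := by rw [← Real.rpow_add ht]; ring_nf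
    rw [e]
    have h1 : |t| ^ (-(r - q)) ≤ R ^ (-(r - q)) :=
      Real.rpow_le_rpow_of_nonpos (by linarith) h (by linarith)
    have := mul_le_mul_of_nonneg_right (h1.trans hR.le) (show 0 ≤ |t| ^ r by positivity)
    linarith

theorem diffQuotient_const_mul (c : ℝ) (u : Space N → ℝ) (z : Space N × Space N) :
    diffQuotient N s p (fun x => c * u x) z = c * diffQuotient N s p u z := by
  unfold diffQuotient; ring

theorem diffQuotient_add (u v : Space N → ℝ) (z : Space N × Space N) :
    diffQuotient N s p (fun x => u x + v x) z =
      diffQuotient N s p u z + diffQuotient N s p v z := by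
  unfold diffQuotient; ring

theorem diffQuotient_sub (u v : Space N → ℝ) (z : Space N × Space N) :
    diffQuotient N s p (fun x => u x - v x) z =
      diffQuotient N s p u z - diffQuotient N s p v z := by
  unfold diffQuotient; ring

theorem gagliardoIntegrand_const_mul (hp : 1 < p) (c : ℝ) (u : Space N → ℝ)
    (z : Space N × Space N) :
    gagliardoIntegrand N s p (fun x => c * u x) z = |c| ^ p * gagliardoIntegrand N s p u z := by
  rw [gagliardoIntegrand_eq hp, gagliardoIntegrand_eq hp, diffQuotient_const_mul, abs_mul,
    Real.mul_rpow (abs_nonneg _) (abs_nonneg _)]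

theorem MemSobolev.const_mul (hp : 1 < p) {u : Space N → ℝ} (hu : MemSobolev N s p u) (c : ℝ) :
    MemSobolev N s p (fun x => c * u x) := by
  refine ⟨hu.1.const_mul c, ?_⟩
  have : gagliardoIntegrand N s p (fun x => c * u x) =
      fun z => |c| ^ p * gagliardoIntegrand N s p u z :=
    funext fun z => gagliardoIntegrand_const_mul hp c u z
  rw [this]
  exact hu.2.const_mul _

/-- Subcritical Gagliardo–Nirenberg inequality in `W^{s,p}`. With `S = [u]^p + ‖u‖_p^p`, one has
`‖u‖_q^q ≤ S^{(q-p)/p} (η S + C_η ‖u‖_p^p)`. -/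
theorem exists_integral_rpow_le (hs : 0 < s) (hp : 1 < p) (hN : s * p < N) {q : ℝ} (hpq : p < q)
    (hq : q < N * p / (N - s * p)) {η : ℝ} (hη : 0 < η) :
    ∃ C > 0, ∀ u : Space N → ℝ, MemSobolev N s p u → Integrable (fun x => |u x| ^ q) ∧
      ∫ x, |u x| ^ q ≤
        ((∫ z, gagliardoIntegrand N s p u z) + ∫ x, |u x| ^ p) ^ ((q - p) / p) *
        (η * ((∫ z, gagliardoIntegrand N s p u z) + ∫ x, |u x| ^ p) + C * ∫ x, |u x| ^ p) := by
  obtain ⟨r, hqr, B, hB, hr⟩ := exists_unitBallBound_gt hs hp hN hq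
  have hp0 : 0 < p := by linarith
  obtain ⟨C, hC, hint⟩ := exists_rpow_le_interpolation hp0 hpq hqr (η := η / B)
    (by positivity)
  refine ⟨C, hC, fun u hu => ?_⟩
  set S := (∫ z, gagliardoIntegrand N s p u z) + ∫ x, |u x| ^ p with hS
  have hg0 : 0 ≤ ∫ z, gagliardoIntegrand N s p u z :=
    integral_nonneg fun z => gagliardoIntegrand_nonneg u z
  have hu0 : 0 ≤ ∫ x, |u x| ^ p := integral_nonneg fun x => by positivity
  have hup := integrable_abs_rpow hp0 hu.1
  have hS0 : 0 ≤ S := by positivity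
  rcases hS0.eq_or_lt with h0 | h0
  · have hz : ∫ x, |u x| ^ p = 0 := by linarith
    rw [integral_eq_zero_iff_of_nonneg (fun x => by positivity) hup] at hz
    have hz' : (fun x => |u x| ^ q) =ᵐ[volume] fun _ => 0 := by
      filter_upwards [hz] with x hx
      have : |u x| = 0 := by
        have hx' : |u x| ^ p = 0 := hx
        exact (Real.rpow_eq_zero (abs_nonneg _) hp0.ne').1 hx'
      rw [this, Real.zero_rpow (by linarith)]
    refine ⟨(integrable_zero _ _ _).congr hz'.symm, ?_⟩
    rw [integral_congr_ae hz', integral_zero]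
    positivity
  · set l := S ^ (1 / p) with hl
    have hl0 : 0 < l := by positivity
    have hlp : l ^ p = S := by
      rw [hl, ← Real.rpow_mul h0.le, one_div, inv_mul_cancel₀ hp0.ne', Real.rpow_one]
    set w : Space N → ℝ := fun x => l⁻¹ * u x with hw
    have hwS : MemSobolev N s p w := hu.const_mul hp _
    have habs : |l⁻¹| = l⁻¹ := abs_of_pos (by positivity)
    have hwr : ∀ (m : ℝ) x, |w x| ^ m = (l ^ m)⁻¹ * |u x| ^ m := fun m x => by
      simp only [hw]
      rw [abs_mul, habs, Real.mul_rpow (by positivity) (abs_nonneg _), Real.inv_rpow hl0.le]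
    have hw1 : (∫ z, gagliardoIntegrand N s p w z) + ∫ x, |w x| ^ p ≤ 1 := by
      simp only [hwr]
      simp only [hw, gagliardoIntegrand_const_mul hp]
      rw [integral_const_mul, integral_const_mul, habs, Real.inv_rpow hl0.le, ← mul_add, hlp,
        ← hS, inv_mul_cancel₀ h0.ne']
    obtain ⟨hri, hrB⟩ := hr w hwS hw1
    have hwp := integrable_abs_rpow hp0 hwS.1
    have hdom := (hri.const_mul (η / B)).add (hwp.const_mul C)
    have hwq : Integrable (fun x => |w x| ^ q) := by
      refine hdom.mono' (hwS.1.1.aemeasurable.abs.pow_const _).aestronglyMeasurable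
        (ae_of_all _ fun x => ?_)
      rw [Real.norm_eq_abs, abs_of_nonneg (by positivity)]
      exact hint (w x)
    have hle : ∫ x, |w x| ^ q ≤ η + C * ∫ x, |w x| ^ p := by
      calc ∫ x, |w x| ^ q ≤ ∫ x, (η / B * |w x| ^ r + C * |w x| ^ p) :=
            integral_mono hwq hdom fun x => hint (w x)
        _ = η / B * (∫ x, |w x| ^ r) + C * ∫ x, |w x| ^ p := by
            rw [integral_add (hri.const_mul _) (hwp.const_mul _), integral_const_mul,
              integral_const_mul]
        _ ≤ η / B * B + C * ∫ x, |w x| ^ p := by gcongr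
        _ = _ := by rw [div_mul_cancel₀ _ hB.ne']
    simp only [hwr] at hle hwq
    rw [integral_const_mul, integral_const_mul, hlp] at hle
    have hlq : 0 < l ^ q := by positivity
    have huq : Integrable (fun x => |u x| ^ q) := by
      have := hwq.const_mul (l ^ q)
      simpa [← mul_assoc, hlq.ne'] using this
    refine ⟨huq, ?_⟩
    have e : l ^ q = S ^ ((q - p) / p) * S := by
      rw [hl, ← Real.rpow_mul h0.le, ← Real.rpow_add_one h0.ne']
      congr 1
      field_simp
      ring
    rw [inv_mul_le_iff₀ hlq, e] at hle
    refine hle.trans_eq ?_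
    field_simp

end

/-! ### Local compactness -/

section

variable {N : ℕ} {s p : ℝ}

section CompleteLp

variable {α : Type*} [MeasurableSpace α] {μ : Measure α}

theorem eLpNorm_eq_ofReal_integral (hp : 1 < p) {g : α → ℝ}
    (hg : MemLp g (ENNReal.ofReal p) μ) :
    eLpNorm g (ENNReal.ofReal p) μ = ENNReal.ofReal ((∫ x, |g x| ^ p ∂μ) ^ p⁻¹) := by
  rw [hg.eLpNorm_eq_integral_rpow_norm (ofReal_ne_zero_of_one_lt hp) ENNReal.ofReal_ne_top,
    ENNReal.toReal_ofReal (by linarith)]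
  rfl

theorem tendsto_eLpNorm_zero_iff (hp : 1 < p) {ι : Type*} {l : Filter ι} {g : ι → α → ℝ}
    (hg : ∀ n, MemLp (g n) (ENNReal.ofReal p) μ) :
    Tendsto (fun n => eLpNorm (g n) (ENNReal.ofReal p) μ) l (𝓝 0) ↔
      Tendsto (fun n => ∫ x, |g n x| ^ p ∂μ) l (𝓝 0) := by
  have hp0 : 0 < p := by linarith
  have h0 : ∀ n, 0 ≤ ∫ x, |g n x| ^ p ∂μ := fun n => integral_nonneg fun x => by positivity
  simp only [fun n => eLpNorm_eq_ofReal_integral hp (hg n)]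
  constructor
  · intro h
    have h1 := (ENNReal.tendsto_toReal ENNReal.zero_ne_top).comp h
    have h2 := h1.rpow_const (p := p) (Or.inr hp0.le)
    simp only [Function.comp_def, ENNReal.toReal_zero, Real.zero_rpow hp0.ne'] at h2
    refine h2.congr fun n => ?_
    rw [ENNReal.toReal_ofReal (Real.rpow_nonneg (h0 n) _), Real.rpow_inv_rpow (h0 n) hp0.ne']
  · intro h
    have h1 := h.rpow_const (p := p⁻¹) (Or.inr (by positivity))
    rw [Real.zero_rpow (by positivity)] at h1
    have h2 := ENNReal.tendsto_ofReal h1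
    rwa [ENNReal.ofReal_zero] at h2

/-- Completeness of `L^p` together with almost everywhere convergence of a subsequence, for
sequences of functions. -/
theorem exists_tendsto_integral_of_cauchy (hp : 1 < p) {g : ℕ → α → ℝ}
    (hg : ∀ n, MemLp (g n) (ENNReal.ofReal p) μ)
    (hc : ∀ ε > 0, ∃ n₀, ∀ n ≥ n₀, ∀ m ≥ n₀, ∫ x, |g n x - g m x| ^ p ∂μ ≤ ε) :
    ∃ g₀ : α → ℝ, MemLp g₀ (ENNReal.ofReal p) μ ∧
      Tendsto (fun n => ∫ x, |g n x - g₀ x| ^ p ∂μ) atTop (𝓝 0) ∧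
      ∃ φ : ℕ → ℕ, StrictMono φ ∧ ∀ᵐ x ∂μ, Tendsto (fun n => g (φ n) x) atTop (𝓝 (g₀ x)) := by
  have : Fact (1 ≤ ENNReal.ofReal p) := ⟨by rw [ENNReal.one_le_ofReal]; exact hp.le⟩
  set G : ℕ → Lp ℝ (ENNReal.ofReal p) μ := fun n => (hg n).toLp (g n) with hG
  have hGc : CauchySeq G := by
    rw [Lp.cauchySeq_Lp_iff_cauchySeq_eLpNorm]
    have e : ∀ n : ℕ × ℕ, eLpNorm (⇑(G n.1) - ⇑(G n.2)) (ENNReal.ofReal p) μ =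
        eLpNorm (fun x => g n.1 x - g n.2 x) (ENNReal.ofReal p) μ := fun n => by
      refine eLpNorm_congr_ae ?_
      filter_upwards [(hg n.1).coeFn_toLp, (hg n.2).coeFn_toLp] with x h1 h2
      simp [hG, h1, h2]
    simp only [e]
    refine (tendsto_eLpNorm_zero_iff (g := fun (n : ℕ × ℕ) x => g n.1 x - g n.2 x) hp
      fun n => (hg n.1).sub (hg n.2)).2 (Metric.tendsto_atTop.2 ?_)
    intro ε hε
    obtain ⟨n₀, h⟩ := hc (ε / 2) (by linarith)
    refine ⟨(n₀, n₀), fun n hn => ?_⟩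
    have h0 : 0 ≤ ∫ x, |g n.1 x - g n.2 x| ^ p ∂μ := integral_nonneg fun x => by positivity
    rw [Real.dist_eq, sub_zero, abs_of_nonneg h0]
    linarith [h n.1 hn.1 n.2 hn.2]
  obtain ⟨G₀, hG₀⟩ := cauchySeq_tendsto_of_complete hGc
  have hmem := Lp.memLp G₀
  rw [Lp.tendsto_Lp_iff_tendsto_eLpNorm'] at hG₀
  have e : ∀ n, eLpNorm (⇑(G n) - ⇑G₀) (ENNReal.ofReal p) μ =
      eLpNorm (g n - ⇑G₀) (ENNReal.ofReal p) μ := fun n => by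
    refine eLpNorm_congr_ae ?_
    filter_upwards [(hg n).coeFn_toLp] with x h1
    simp [hG, h1]
  simp only [e] at hG₀
  refine ⟨G₀, hmem, (tendsto_eLpNorm_zero_iff (g := fun n x => g n x - G₀ x) hp
    fun n => (hg n).sub hmem).1 hG₀, ?_⟩
  exact (tendstoInMeasure_of_tendsto_eLpNorm (ofReal_ne_zero_of_one_lt hp)
    (fun n => (hg n).1) hmem.1 hG₀).exists_seq_tendsto_ae

/-- Jensen's inequality for averages: `|a - ⨍ u|^p ≤ ⨍ |a - u|^p`. -/
theorem abs_sub_average_rpow_le (hp : 1 < p) {t : Set α} (h0 : μ t ≠ 0) (ht : μ t ≠ ⊤)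
    {u : α → ℝ} (hu : MemLp u (ENNReal.ofReal p) μ) (a : ℝ) :
    IntegrableOn (fun y => |a - u y| ^ p) t μ ∧
    |a - ⨍ y in t, u y ∂μ| ^ p ≤ (μ.real t)⁻¹ * ∫ y in t, |a - u y| ^ p ∂μ := by
  have hp1 : (1 : ENNReal) ≤ ENNReal.ofReal p := by rw [ENNReal.one_le_ofReal]; exact hp.le
  have : Fact (μ t < ⊤) := ⟨lt_top_iff_ne_top.2 ht⟩
  have hut := hu.restrict t
  have hd : MemLp (fun y => a - u y) (ENNReal.ofReal p) (μ.restrict t) :=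
    (memLp_const a).sub hut
  have hi := integrable_abs_rpow (by linarith) hd
  have hJ := (convexOn_abs_rpow hp).map_set_average_le (μ := μ) (t := t)
    (f := fun y => a - u y) (continuous_abs_rpow (by linarith)).continuousOn isClosed_univ h0 ht
    (ae_of_all _ fun _ => Set.mem_univ _) (hd.integrable hp1) hi
  refine ⟨hi, ?_⟩
  rw [setAverage_eq, setAverage_eq, smul_eq_mul, smul_eq_mul] at hJ
  rw [setAverage_eq, smul_eq_mul]
  have hr : μ.real t ≠ 0 := (ENNReal.toReal_pos h0 ht).ne'
  have e : (μ.real t)⁻¹ * ∫ y in t, (a - u y) ∂μ = a - (μ.real t)⁻¹ * ∫ y in t, u y ∂μ := by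
    rw [integral_sub (integrable_const a) (hut.integrable hp1)]
    simp only [integral_const, smul_eq_mul, measureReal_restrict_apply_univ]
    field_simp
  rwa [e] at hJ

end CompleteLp

/-- A measurable choice of a point at distance less than `h` in a countable dense set. -/
theorem exists_measurable_index (N : ℕ) {h : ℝ} (hh : 0 < h) : ∃ i : Space N → ℕ,
    Measurable i ∧ ∀ x, dist x (TopologicalSpace.denseSeq (Space N) (i x)) < h := by
  classical
  have hex : ∀ x : Space N, ∃ k, dist x (TopologicalSpace.denseSeq (Space N) k) < h :=
    fun x => (TopologicalSpace.denseRange_denseSeq (Space N)).exists_dist_lt x hh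
  refine ⟨fun x => Nat.find (hex x), measurable_find hex fun k => ?_, fun x =>
    Nat.find_spec (hex x)⟩
  exact measurableSet_lt (by fun_prop) measurable_const

/-- The average of `u` over the ball of radius `h` around the `k`-th point of a dense sequence. -/
def ballAverage (u : Space N → ℝ) (h : ℝ) (k : ℕ) : ℝ :=
  ⨍ y in Metric.ball (TopologicalSpace.denseSeq (Space N) k) h, u y

theorem volume_real_ball_eq (hN : N ≠ 0) (x : Space N) {h : ℝ} (hh : 0 ≤ h) :
    (volume : Measure (Space N)).real (Metric.ball x h) =
      h ^ N * (volume (Metric.ball (0 : Space N) 1)).toReal := by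
  rw [measureReal_def, volume_ball_eq hN x hh, ENNReal.toReal_ofReal (by positivity)]

theorem abs_ballAverage_le (hp : 1 < p) {u : Space N → ℝ}
    (hu : MemLp u (ENNReal.ofReal p) volume) (hN : N ≠ 0) {h M : ℝ} (hh : 0 < h)
    (hM : ∫ x, |u x| ^ p ≤ M) (k : ℕ) : |ballAverage u h k| ≤
      1 + (h ^ N * (volume (Metric.ball (0 : Space N) 1)).toReal)⁻¹ * M := by
  have hp0 : 0 < p := by linarith
  set B := Metric.ball (TopologicalSpace.denseSeq (Space N) k) h
  have h1 := (abs_sub_average_rpow_le hp (t := B) (Metric.measure_ball_pos _ _ hh).ne'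
    measure_ball_lt_top.ne hu 0).2
  rw [volume_real_ball_eq hN _ hh.le] at h1
  simp only [zero_sub, abs_neg] at h1
  have hω := unitBall_pos N
  have h2 : ∫ y in B, |u y| ^ p ≤ M :=
    (setIntegral_le_integral (integrable_abs_rpow hp0 hu)
      (ae_of_all _ fun x => by positivity)).trans hM
  have h3 : |ballAverage u h k| ^ p ≤
      (h ^ N * (volume (Metric.ball (0 : Space N) 1)).toReal)⁻¹ * M :=
    h1.trans (mul_le_mul_of_nonneg_left h2 (by positivity))
  rcases le_total |ballAverage u h k| 1 with h4 | h4
  · have : 0 ≤ |ballAverage u h k| ^ p := by positivity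
    linarith
  · have := Real.self_le_rpow_of_one_le h4 hp.le
    linarith

/-- Replacing `u` by its averages over balls of radius `h` with centres at distance less than `h`
costs at most `C h^{sp} [u]^p` in the `p`-th power of the `L^p` norm. -/
theorem integral_sub_ballAverage_le (hs : 0 < s) (hp : 1 < p) (hN : N ≠ 0) {u : Space N → ℝ}
    (hu : MemSobolev N s p u) {h : ℝ} (hh : 0 < h) {i : Space N → ℕ} (him : Measurable i)
    (hi : ∀ x, dist x (TopologicalSpace.denseSeq (Space N) (i x)) < h) :
    Integrable (fun x => |u x - ballAverage u h (i x)| ^ p) ∧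
    ∫ x, |u x - ballAverage u h (i x)| ^ p ≤
      2 ^ ((N : ℝ) + s * p) / (volume (Metric.ball (0 : Space N) 1)).toReal * h ^ (s * p) *
        ∫ z, gagliardoIntegrand N s p u z := by
  have hp0 : 0 < p := by linarith
  have hω := unitBall_pos N
  set ω := (volume (Metric.ball (0 : Space N) 1)).toReal
  set C := 2 ^ ((N : ℝ) + s * p) / ω * h ^ (s * p) with hC
  have hC0 : 0 ≤ C := by positivity
  have hg2 : Integrable (gagliardoIntegrand N s p u)
    ((volume : Measure (Space N)).prod volume) := hu.2
  have hpt : ∀ᵐ x, |u x - ballAverage u h (i x)| ^ p ≤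
      C * ∫ y, gagliardoIntegrand N s p u (x, y) := by
    filter_upwards [hg2.prod_right_ae] with x hx
    set c := TopologicalSpace.denseSeq (Space N) (i x)
    obtain ⟨hI, h1⟩ := abs_sub_average_rpow_le hp (t := Metric.ball c h)
      (Metric.measure_ball_pos _ _ hh).ne' measure_ball_lt_top.ne hu.1 (u x)
    refine h1.trans ?_
    rw [volume_real_ball_eq hN _ hh.le]
    have h2 : ∫ y in Metric.ball c h, |u x - u y| ^ p ≤
        ∫ y in Metric.ball c h, (2 * h) ^ ((N : ℝ) + s * p) * gagliardoIntegrand N s p u (x, y) := by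
      refine setIntegral_mono_on hI (hx.const_mul _).integrableOn measurableSet_ball ?_
      intro y hy
      rcases eq_or_ne x y with rfl | hxy
      · rw [sub_self, abs_zero, Real.zero_rpow hp0.ne']
        exact mul_nonneg (by positivity) (gagliardoIntegrand_nonneg _ _)
      have hxy0 : 0 < ‖x - y‖ := norm_pos_iff.2 (sub_ne_zero.2 hxy)
      have hd : ‖x - y‖ ≤ 2 * h := by
        rw [← dist_eq_norm]
        have h3 := dist_triangle x c y
        have h4 := hi x
        rw [Metric.mem_ball, dist_comm] at hy
        linarith
      unfold gagliardoIntegrand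
      rw [mul_div_assoc', le_div_iff₀ (by positivity), mul_comm]
      exact mul_le_mul_of_nonneg_right
        (Real.rpow_le_rpow hxy0.le hd (by positivity)) (by positivity)
    have h3 : ∫ y in Metric.ball c h, (2 * h) ^ ((N : ℝ) + s * p) *
        gagliardoIntegrand N s p u (x, y) ≤
        (2 * h) ^ ((N : ℝ) + s * p) * ∫ y, gagliardoIntegrand N s p u (x, y) := by
      rw [← integral_const_mul]
      exact setIntegral_le_integral (hx.const_mul _)
        (ae_of_all _ fun y => mul_nonneg (by positivity) (gagliardoIntegrand_nonneg _ _))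
    refine (mul_le_mul_of_nonneg_left (h2.trans h3) (by positivity)).trans_eq ?_
    rw [show (volume (Metric.ball (0 : Space N) 1)).toReal = ω from rfl,
      Real.mul_rpow (by norm_num) hh.le, Real.rpow_add hh, Real.rpow_natCast, hC]
    field_simp
  have hRint : Integrable fun x => C * ∫ y, gagliardoIntegrand N s p u (x, y) :=
    hg2.integral_prod_left.const_mul C
  have hmeas : Measurable fun x => ballAverage u h (i x) :=
    (measurable_from_nat (f := ballAverage u h)).comp him
  have hint : Integrable (fun x => |u x - ballAverage u h (i x)| ^ p) := by
    refine hRint.mono' ((hu.1.1.aemeasurable.sub hmeas.aemeasurable).abs.pow_const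
      _).aestronglyMeasurable ?_
    filter_upwards [hpt] with x hx
    rwa [Real.norm_eq_abs, abs_of_nonneg (by positivity)]
  refine ⟨hint, (integral_mono_ae hint hRint hpt).trans_eq ?_⟩
  rw [integral_const_mul]
  congr 1
  exact (integral_prod _ hg2).symm

/-- A finite measure with a density which is bounded by one and locally bounded below. -/
def finiteWeight (N : ℕ) : Measure (Space N) :=
  volume.withDensity fun x => ENNReal.ofReal ((1 + ‖x‖) ^ (-((N : ℝ) + 1)))

instance (N : ℕ) : IsFiniteMeasure (finiteWeight N) :=
  isFiniteMeasure_withDensity_ofReal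
    (integrable_one_add_norm (by simp)).hasFiniteIntegral

theorem finiteWeight_le (N : ℕ) : finiteWeight N ≤ volume := by
  have : finiteWeight N ≤ volume.withDensity 1 := by
    refine withDensity_mono (ae_of_all _ fun x => ?_)
    rw [Pi.one_apply, ENNReal.ofReal_le_one]
    exact Real.rpow_le_one_of_one_le_of_nonpos (by linarith [norm_nonneg x])
      (by have : (0 : ℝ) ≤ N := Nat.cast_nonneg N
          linarith)
  rwa [withDensity_one] at this

theorem absolutelyContinuous_finiteWeight (N : ℕ) :
    (volume : Measure (Space N)) ≪ finiteWeight N := by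
  refine withDensity_absolutelyContinuous' (by fun_prop) (ae_of_all _ fun x => ?_)
  have : 0 < (1 + ‖x‖) ^ (-((N : ℝ) + 1)) :=
    Real.rpow_pos_of_pos (by linarith [norm_nonneg x]) _
  simpa using this

theorem restrict_ball_le_finiteWeight (N : ℕ) {R : ℝ} :
    (volume : Measure (Space N)).restrict (Metric.ball 0 R) ≤
      ENNReal.ofReal ((1 + R) ^ ((N : ℝ) + 1)) • finiteWeight N := by
  refine Measure.le_iff.2 fun t ht => ?_
  rw [Measure.restrict_apply ht, Measure.smul_apply, smul_eq_mul]
  have hm := ht.inter (measurableSet_ball (x := (0 : Space N)) (ε := R))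
  calc volume (t ∩ Metric.ball 0 R) = ∫⁻ _ in t ∩ Metric.ball (0 : Space N) R, 1 := by simp
    _ ≤ ∫⁻ x in t ∩ Metric.ball (0 : Space N) R, ENNReal.ofReal ((1 + R) ^ ((N : ℝ) + 1)) *
          ENNReal.ofReal ((1 + ‖x‖) ^ (-((N : ℝ) + 1))) := by
        refine setLIntegral_mono' hm fun x hx => ?_
        have hx2 : ‖x‖ < R := by simpa using hx.2
        have h0 : 0 < 1 + ‖x‖ := by positivity
        have h0' : 0 < 1 + R := by linarith
        rw [← ENNReal.ofReal_mul (by positivity), ENNReal.one_le_ofReal, Real.rpow_neg h0.le,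
          ← div_eq_mul_inv, one_le_div (by positivity)]
        exact Real.rpow_le_rpow h0.le (by linarith) (by positivity)
    _ = ENNReal.ofReal ((1 + R) ^ ((N : ℝ) + 1)) * finiteWeight N (t ∩ Metric.ball 0 R) := by
        rw [lintegral_const_mul' _ _ ENNReal.ofReal_ne_top, finiteWeight, withDensity_apply _ hm]
    _ ≤ _ := by gcongr; exact Set.inter_subset_left

/-- Rellich–Kondrachov compactness: a bounded sequence in `W^{s,p}` has a subsequence converging
almost everywhere and in `L^p` of every ball. -/
theorem exists_subseq_tendsto (hs : 0 < s) (hp : 1 < p) (hN : N ≠ 0) {u : ℕ → Space N → ℝ}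
    (hu : ∀ n, MemSobolev N s p (u n)) {M : ℝ}
    (hM1 : ∀ n, ∫ z, gagliardoIntegrand N s p (u n) z ≤ M) (hM2 : ∀ n, ∫ x, |u n x| ^ p ≤ M) :
    ∃ (φ : ℕ → ℕ) (u₀ : Space N → ℝ), StrictMono φ ∧
      (∀ᵐ x, Tendsto (fun n => u (φ n) x) atTop (𝓝 (u₀ x))) ∧
      ∀ R, Tendsto (fun n => ∫ x in Metric.ball 0 R, |u (φ n) x - u₀ x| ^ p) atTop (𝓝 0) := by
  have hp0 : 0 < p := by linarith
  have hω := unitBall_pos N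
  have hM0 : 0 ≤ M := (integral_nonneg fun x => by positivity).trans (hM2 0)
  set ω := (volume (Metric.ball (0 : Space N) 1)).toReal
  -- the radii `1 / (k + 1)`, and a subsequence along which all averages converge
  set h : ℕ → ℝ := fun k => 1 / ((k : ℝ) + 1) with hh
  have hh0 : ∀ k, 0 < h k := fun k => by positivity
  set b : ℕ → ℝ := fun k => 1 + (h k ^ N * ω)⁻¹ * M
  have hK : IsCompact (Set.univ.pi fun k : ℕ × ℕ => Set.Icc (-b k.1) (b k.1)) :=
    isCompact_univ_pi fun k => isCompact_Icc
  set A : ℕ → ℕ × ℕ → ℝ := fun n k => ballAverage (u n) (h k.1) k.2 with hA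
  have hAK : ∀ n, A n ∈ Set.univ.pi fun k : ℕ × ℕ => Set.Icc (-b k.1) (b k.1) := fun n k _ =>
    abs_le.1 (abs_ballAverage_le hp (hu n).1 hN (hh0 k.1) (hM2 n) k.2)
  obtain ⟨Q, -, φ, hφ, hQ⟩ := hK.tendsto_subseq hAK
  have hQ' : ∀ k j, Tendsto (fun n => ballAverage (u (φ n)) (h k) j) atTop (𝓝 (Q (k, j))) :=
    fun k j => (tendsto_pi_nhds.1 hQ) (k, j)
  set ν := finiteWeight N
  have hν : ν ≤ volume := finiteWeight_le N
  have huν : ∀ n, MemLp (u n) (ENNReal.ofReal p) ν := fun n => (hu n).1.mono_measure hν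
  have hcauchy : ∀ ε > 0, ∃ n₀, ∀ n ≥ n₀, ∀ m ≥ n₀,
      ∫ x, |u (φ n) x - u (φ m) x| ^ p ∂ν ≤ ε := by
    intro ε hε
    set K : ℝ := 2 ^ p * (2 ^ p * 2) with hK
    have hK0 : 0 < K := by positivity
    set C : ℝ := 2 ^ ((N : ℝ) + s * p) / ω with hC
    have hlim : Tendsto (fun k => C * h k ^ (s * p) * M) atTop (𝓝 (C * 0 ^ (s * p) * M)) :=
      (((tendsto_one_div_add_atTop_nhds_zero_nat (𝕜 := ℝ)).rpow_const
        (Or.inr (by positivity))).const_mul C).mul_const M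
    rw [Real.zero_rpow (by positivity), mul_zero, zero_mul] at hlim
    obtain ⟨k, hk⟩ := (hlim.eventually (gt_mem_nhds (show 0 < ε / (2 * K) by positivity))).exists
    obtain ⟨i, him, hi⟩ := exists_measurable_index N (hh0 k)
    set P : ℕ → Space N → ℝ := fun n x => ballAverage (u (φ n)) (h k) (i x) with hP
    have hPm : ∀ n, Measurable (P n) := fun n =>
      (measurable_from_nat (f := ballAverage (u (φ n)) (h k))).comp him
    have hQm : Measurable fun x => Q (k, i x) :=
      (measurable_from_nat (f := fun j => Q (k, j))).comp him
    have hPb : ∀ n x, |P n x| ≤ b k := fun n x =>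
      abs_ballAverage_le hp (hu _).1 hN (hh0 _) (hM2 _) _
    have hQb : ∀ x, |Q (k, i x)| ≤ b k := fun x =>
      le_of_tendsto (hQ' k (i x)).abs (Eventually.of_forall fun n => hPb n x)
    have hd0 : ∀ n x, |P n x - Q (k, i x)| ≤ 2 * b k := fun n x =>
      (abs_sub _ _).trans (by linarith [hPb n x, hQb x])
    have hdint : ∀ n, Integrable (fun x => |P n x - Q (k, i x)| ^ p) ν := fun n => by
      refine (integrable_const ((2 * b k) ^ p)).mono'
        (((hPm n).sub hQm).abs.pow_const p).aestronglyMeasurable (ae_of_all _ fun x => ?_)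
      rw [Real.norm_eq_abs, abs_of_nonneg (by positivity)]
      exact Real.rpow_le_rpow (abs_nonneg _) (hd0 n x) hp0.le
    have hdlim : Tendsto (fun n => ∫ x, |P n x - Q (k, i x)| ^ p ∂ν) atTop
        (𝓝 (∫ _, (0 : ℝ) ∂ν)) := by
      refine tendsto_integral_of_dominated_convergence (fun _ => (2 * b k) ^ p)
        (fun n => (hdint n).aestronglyMeasurable) (integrable_const _)
        (fun n => ae_of_all _ fun x => ?_) (ae_of_all _ fun x => ?_)
      · rw [Real.norm_eq_abs, abs_of_nonneg (by positivity)]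
        exact Real.rpow_le_rpow (abs_nonneg _) (hd0 n x) hp0.le
      · have h1 := ((hQ' k (i x)).sub_const (Q (k, i x))).abs.rpow_const (p := p) (Or.inr hp0.le)
        simpa [hp0.ne'] using h1
    rw [integral_zero] at hdlim
    have hev := hdlim.eventually (gt_mem_nhds (show 0 < ε / (2 * K) by positivity))
    obtain ⟨n₀, hn₀⟩ := eventually_atTop.1 hev
    have hdev : ∀ n, Integrable (fun x => |u (φ n) x - P n x| ^ p) ν ∧
        ∫ x, |u (φ n) x - P n x| ^ p ∂ν ≤ ε / (2 * K) := by
      intro n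
      obtain ⟨i1, i2⟩ := integral_sub_ballAverage_le hs hp hN (hu (φ n)) (hh0 k) him hi
      refine ⟨i1.mono_measure hν, (integral_mono_measure hν
        (ae_of_all _ fun x => by positivity) i1).trans (i2.trans (le_trans ?_ hk.le))⟩
      exact mul_le_mul_of_nonneg_left (hM1 _) (by have := hh0 k; positivity)
    have hQdev : ∀ n ≥ n₀, Integrable (fun x => |u (φ n) x - Q (k, i x)| ^ p) ν ∧
        ∫ x, |u (φ n) x - Q (k, i x)| ^ p ∂ν ≤ 2 ^ p * (ε / (2 * K) + ε / (2 * K)) := by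
      intro n hn
      have hb := ((hdev n).1.add (hdint n)).const_mul (2 ^ p)
      have hpt : ∀ x, |u (φ n) x - Q (k, i x)| ^ p ≤
          2 ^ p * (|u (φ n) x - P n x| ^ p + |P n x - Q (k, i x)| ^ p) := fun x => by
        have := abs_add_rpow_le hp0.le (u (φ n) x - P n x) (P n x - Q (k, i x))
        rwa [sub_add_sub_cancel] at this
      have hI : Integrable (fun x => |u (φ n) x - Q (k, i x)| ^ p) ν := by
        refine hb.mono' (((huν _).1.aemeasurable.sub hQm.aemeasurable).abs.pow_const
          p).aestronglyMeasurable (ae_of_all _ fun x => ?_)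
        rw [Real.norm_eq_abs, abs_of_nonneg (by positivity)]
        exact hpt x
      refine ⟨hI, (integral_mono hI hb hpt).trans ?_⟩
      rw [integral_const_mul, integral_add' (hdev n).1 (hdint n)]
      exact mul_le_mul_of_nonneg_left (add_le_add (hdev n).2 (hn₀ n hn).le) (by positivity)
    refine ⟨n₀, fun n hn m hm => ?_⟩
    have hb := ((hQdev n hn).1.add (hQdev m hm).1).const_mul (2 ^ p)
    have hpt : ∀ x, |u (φ n) x - u (φ m) x| ^ p ≤
        2 ^ p * (|u (φ n) x - Q (k, i x)| ^ p + |u (φ m) x - Q (k, i x)| ^ p) := fun x => by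
      have := abs_add_rpow_le hp0.le (u (φ n) x - Q (k, i x)) (Q (k, i x) - u (φ m) x)
      rwa [sub_add_sub_cancel, abs_sub_comm (Q (k, i x))] at this
    refine (integral_mono (integrable_abs_rpow hp0 ((huν _).sub (huν _))) hb hpt).trans ?_
    rw [integral_const_mul, integral_add' (hQdev n hn).1 (hQdev m hm).1]
    refine (mul_le_mul_of_nonneg_left (add_le_add (hQdev n hn).2 (hQdev m hm).2)
      (by positivity)).trans_eq ?_
    rw [hK]
    field_simp
    norm_num
  obtain ⟨u₀, hu₀, hlim, ψ, hψ, hae⟩ := exists_tendsto_integral_of_cauchy hp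
    (fun n => huν (φ n)) hcauchy
  refine ⟨φ ∘ ψ, u₀, hφ.comp hψ, (absolutelyContinuous_finiteWeight N).ae_le hae, fun R => ?_⟩
  set c : ENNReal := ENNReal.ofReal ((1 + R) ^ ((N : ℝ) + 1))
  have hup : Tendsto (fun n => c.toReal * ∫ x, |u (φ (ψ n)) x - u₀ x| ^ p ∂ν) atTop (𝓝 0) := by
    simpa using (hlim.comp hψ.tendsto_atTop).const_mul c.toReal
  refine squeeze_zero (fun n => integral_nonneg fun x => by positivity) (fun n => ?_) hup
  rw [← smul_eq_mul, ← integral_smul_measure]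
  exact integral_mono_measure (restrict_ball_le_finiteWeight N)
    (ae_of_all _ fun x => by positivity)
    ((integrable_abs_rpow hp0 ((huν _).sub hu₀)).smul_measure ENNReal.ofReal_ne_top)

end

/-! ### Cutoff functions -/

section

variable {N : ℕ} {s p : ℝ}

/-- An upper bound for the difference quotients of a `1`-Lipschitz function with values in `[0, 1]`. -/
def lipQuotient (N : ℕ) (s p : ℝ) (z : Space N) : ℝ :=
  min 1 ‖z‖ / ‖z‖ ^ (((N : ℝ) + s * p) / p)

theorem lipQuotient_nonneg (z : Space N) : 0 ≤ lipQuotient N s p z := by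
  unfold lipQuotient; positivity

theorem lipQuotient_neg (z : Space N) : lipQuotient N s p (-z) = lipQuotient N s p z := by
  unfold lipQuotient; rw [norm_neg]

theorem measurable_lipQuotient : Measurable (lipQuotient N s p) := by
  unfold lipQuotient; fun_prop

/-- Integrability at the origin uses `s < 1`, integrability at infinity `s > 0`. -/
theorem integrable_lipQuotient_rpow (hs0 : 0 < s) (hs1 : s < 1) (hp : 1 < p) (hN : N ≠ 0) :
    Integrable (fun z => lipQuotient N s p z ^ p) := by
  have hp0 : 0 < p := by linarith
  have : NeZero N := ⟨hN⟩
  have hsp : 0 < s * p := by positivity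
  have hN1 : 1 ≤ N := Nat.one_le_iff_ne_zero.2 hN
  have e : (fun z : Space N => lipQuotient N s p z ^ p) =
      fun z => (fun r : ℝ => min 1 r ^ p / r ^ ((N : ℝ) + s * p)) ‖z‖ := by
    funext z
    unfold lipQuotient
    rw [Real.div_rpow (by positivity) (by positivity), ← Real.rpow_mul (norm_nonneg _),
      div_mul_cancel₀ _ hp0.ne']
  rw [e]
  refine (integrable_fun_norm_addHaar volume
    (f := fun r : ℝ => min 1 r ^ p / r ^ ((N : ℝ) + s * p))).2 ?_
  simp only [finrank_euclideanSpace, Fintype.card_fin, smul_eq_mul]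
  have hpow : ∀ r : ℝ, 0 < r → r ^ (N - 1) = r ^ ((N : ℝ) - 1) := fun r hr => by
    rw [← Real.rpow_natCast, Nat.cast_sub hN1, Nat.cast_one]
  rw [← Set.Ioc_union_Ioi_eq_Ioi (zero_le_one' ℝ), integrableOn_union]
  constructor
  · rw [integrableOn_Ioc_iff_integrableOn_Ioo]
    refine ((intervalIntegral.integrableOn_Ioo_rpow_iff (s := p * (1 - s) - 1) one_pos).2
      (by nlinarith)).congr_fun (fun r hr => ?_) measurableSet_Ioo
    simp only
    rw [min_eq_right hr.2.le, hpow r hr.1, ← Real.rpow_sub hr.1, ← Real.rpow_add hr.1]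
    congr 1; ring
  · refine (integrableOn_Ioi_rpow_of_lt (a := -1 - s * p) (by linarith) one_pos).congr_fun
      (fun r hr => ?_) measurableSet_Ioi
    have hr1 : 1 < r := hr
    have hr0 : 0 < r := by linarith
    simp only
    rw [min_eq_left hr1.le, hpow r hr0, Real.one_rpow, one_div, ← Real.rpow_neg hr0.le,
      ← Real.rpow_add hr0]
    congr 1; ring

/-- The `p`-th power is a convolution integrand of two integrable functions. -/
theorem memLp_snd_mul_lipQuotient (hs0 : 0 < s) (hs1 : s < 1) (hp : 1 < p) (hN : N ≠ 0)
    {v : Space N → ℝ} (hv : MemLp v (ENNReal.ofReal p) volume) :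
    MemLp (fun z : Space N × Space N => |v z.2| * lipQuotient N s p (z.1 - z.2))
      (ENNReal.ofReal p) volume := by
  have hp0 : 0 < p := by linarith
  rw [memLp_iff_integrable_abs_rpow hp0]
  have hm : Measurable fun z : Space N × Space N => lipQuotient N s p (z.1 - z.2) :=
    measurable_lipQuotient.comp (measurable_fst.sub measurable_snd)
  have hv2 : AEStronglyMeasurable (fun z : Space N × Space N => v z.2) volume := hv.1.comp_snd
  refine ⟨(hv2.aemeasurable.abs.mul hm.aemeasurable).aestronglyMeasurable, ?_⟩
  have h := Integrable.convolution_integrand (𝕜 := ℝ) (ContinuousLinearMap.mul ℝ ℝ)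
    (μ := (volume : Measure (Space N))) (ν := (volume : Measure (Space N)))
    (integrable_abs_rpow hp0 hv) (integrable_lipQuotient_rpow (N := N) hs0 hs1 hp hN)
  refine h.congr (ae_of_all _ fun z => ?_)
  have h0 := lipQuotient_nonneg (s := s) (p := p) (z.1 - z.2)
  change _ = |(|v z.2| * lipQuotient N s p (z.1 - z.2))| ^ p
  rw [abs_of_nonneg (by positivity), Real.mul_rpow (abs_nonneg _) h0]
  rfl

theorem memLp_swap {w : Space N × Space N → ℝ} {r : ENNReal} (hw : MemLp w r volume) :
    MemLp (fun z : Space N × Space N => w z.swap) r volume :=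
  hw.comp_measurePreserving (Measure.measurePreserving_swap)

/-- A `1`-Lipschitz measurable function with values in `[0, 1]`. -/
structure IsCutoff (η : Space N → ℝ) : Prop where
  nonneg : ∀ x, 0 ≤ η x
  le_one : ∀ x, η x ≤ 1
  lip : ∀ x y, |η x - η y| ≤ ‖x - y‖
  continuous : Continuous η

namespace IsCutoff

variable {η : Space N → ℝ}

theorem abs_sub_le (h : IsCutoff η) (x y : Space N) : |η x - η y| ≤ min 1 ‖x - y‖ := by
  refine le_min ?_ (h.lip x y)
  rw [abs_le]
  constructor <;> linarith [h.nonneg x, h.nonneg y, h.le_one x, h.le_one y]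

theorem abs_diffQuotient_le (h : IsCutoff η) (z : Space N × Space N) :
    |diffQuotient N s p η z| ≤ lipQuotient N s p (z.1 - z.2) := by
  unfold diffQuotient lipQuotient
  rw [abs_div, abs_of_nonneg (show 0 ≤ ‖z.1 - z.2‖ ^ (((N : ℝ) + s * p) / p) by positivity)]
  exact div_le_div_of_nonneg_right (h.abs_sub_le _ _) (by positivity)

theorem diffQuotient_mul (η v : Space N → ℝ) (z : Space N × Space N) :
    diffQuotient N s p (fun x => η x * v x) z =
      η z.1 * diffQuotient N s p v z + v z.2 * diffQuotient N s p η z := by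
  unfold diffQuotient; ring

theorem abs_diffQuotient_mul_le (h : IsCutoff η) (v : Space N → ℝ) (z : Space N × Space N) :
    |diffQuotient N s p (fun x => η x * v x) z| ≤
      |diffQuotient N s p v z| + |v z.2| * lipQuotient N s p (z.1 - z.2) := by
  rw [diffQuotient_mul]
  refine (abs_add_le _ _).trans (add_le_add ?_ ?_)
  · rw [abs_mul, abs_of_nonneg (h.nonneg _)]
    exact mul_le_of_le_one_left (abs_nonneg _) (h.le_one _)
  · rw [abs_mul]
    exact mul_le_mul_of_nonneg_left (h.abs_diffQuotient_le z) (abs_nonneg _)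

theorem memLp_mul (h : IsCutoff η) {v : Space N → ℝ} {r : ENNReal} (hv : MemLp v r volume) :
    MemLp (fun x => η x * v x) r volume := by
  refine hv.mono (h.continuous.aestronglyMeasurable.mul hv.1) (ae_of_all _ fun x => ?_)
  rw [norm_mul, Real.norm_eq_abs, abs_of_nonneg (h.nonneg _)]
  exact mul_le_of_le_one_left (norm_nonneg _) (h.le_one _)

theorem memSobolev_mul (hs0 : 0 < s) (hs1 : s < 1) (hp : 1 < p) (hN : N ≠ 0)
    (h : IsCutoff η) {v : Space N → ℝ} (hv : MemSobolev N s p v) :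
    MemSobolev N s p (fun x => η x * v x) := by
  have hv' := (memSobolev_iff hp).1 hv
  rw [memSobolev_iff hp]
  have h1 := h.memLp_mul hv.1
  refine ⟨h1, MemLp.mono' (hv'.2.abs.add (memLp_snd_mul_lipQuotient hs0 hs1 hp hN hv.1))
    (aestronglyMeasurable_diffQuotient h1.1) (ae_of_all _ fun z => ?_)⟩
  exact h.abs_diffQuotient_mul_le v z

/-- A compactly supported cutoff belongs to `W^{s,p}`. -/
theorem memSobolev (hs0 : 0 < s) (hs1 : s < 1) (hp : 1 < p) (hN : N ≠ 0) (h : IsCutoff η)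
    {R : ℝ} (hR : ∀ x, R ≤ ‖x‖ → η x = 0) : MemSobolev N s p η := by
  set χ : Space N → ℝ := (Metric.ball (0 : Space N) R).indicator fun _ => 1 with hχ
  have hχm : MemLp χ (ENNReal.ofReal p) volume :=
    memLp_indicator_const _ measurableSet_ball _ (Or.inr measure_ball_lt_top.ne)
  have hηχ : ∀ x, |η x| ≤ χ x := by
    intro x
    by_cases hx : x ∈ Metric.ball (0 : Space N) R
    · rw [hχ, Set.indicator_of_mem hx, abs_of_nonneg (h.nonneg x)]; exact h.le_one x
    · rw [hχ, Set.indicator_of_notMem hx, hR x (by simpa using hx), abs_zero]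
  have hη : MemLp η (ENNReal.ofReal p) volume :=
    MemLp.mono' hχm h.continuous.aestronglyMeasurable (ae_of_all _ hηχ)
  rw [memSobolev_iff hp]
  have h2 := memLp_snd_mul_lipQuotient hs0 hs1 hp hN hχm
  refine ⟨hη, MemLp.mono' (h2.add (memLp_swap h2)) (aestronglyMeasurable_diffQuotient hη.1)
    (ae_of_all _ fun z => ?_)⟩
  have hD := h.abs_diffQuotient_le (s := s) (p := p) z
  have hl := lipQuotient_nonneg (s := s) (p := p) (z.1 - z.2)
  have e : lipQuotient N s p (z.2 - z.1) = lipQuotient N s p (z.1 - z.2) := by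
    rw [← neg_sub, lipQuotient_neg]
  simp only [Pi.add_apply, Prod.fst_swap, Prod.snd_swap, e, Real.norm_eq_abs]
  by_cases h1 : z.1 ∈ Metric.ball (0 : Space N) R
  · have : χ z.1 = 1 := by rw [hχ, Set.indicator_of_mem h1]
    rw [this, abs_one, one_mul]
    have : 0 ≤ |χ z.2| * lipQuotient N s p (z.1 - z.2) := by positivity
    linarith
  by_cases h2 : z.2 ∈ Metric.ball (0 : Space N) R
  · have : χ z.2 = 1 := by rw [hχ, Set.indicator_of_mem h2]
    rw [this, abs_one, one_mul]
    have : 0 ≤ |χ z.1| * lipQuotient N s p (z.1 - z.2) := by positivity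
    linarith
  · have : diffQuotient N s p η z = 0 := by
      unfold diffQuotient
      rw [hR z.1 (by simpa using h1), hR z.2 (by simpa using h2), sub_self, zero_div]
    rw [this, abs_zero]
    positivity

end IsCutoff

/-- The tent function `max(0, 1 - |x| / (n + 1))`. -/
def tent (N : ℕ) (n : ℕ) (x : Space N) : ℝ := max 0 (1 - ‖x‖ / (n + 1))

theorem isCutoff_tent (n : ℕ) : IsCutoff (tent N n) where
  nonneg x := le_max_left _ _
  le_one x := max_le zero_le_one (sub_le_self _ (by positivity))
  lip x y := by
    have h1 : |tent N n x - tent N n y| ≤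
        |(1 - ‖x‖ / ((n : ℝ) + 1)) - (1 - ‖y‖ / ((n : ℝ) + 1))| := by
      refine (abs_max_sub_max_le_max _ _ _ _).trans ?_
      simp
    refine h1.trans ?_
    rw [sub_sub_sub_cancel_left, ← sub_div, abs_div, abs_of_pos (show (0 : ℝ) < n + 1 by positivity)]
    refine (div_le_self (abs_nonneg _) (by linarith [(Nat.cast_nonneg n : (0 : ℝ) ≤ n)])).trans ?_
    rw [abs_sub_comm]
    exact abs_norm_sub_norm_le _ _
  continuous := by unfold tent; fun_prop

theorem tent_eq_zero (n : ℕ) {x : Space N} (hx : (n : ℝ) + 1 ≤ ‖x‖) : tent N n x = 0 := by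
  unfold tent
  refine max_eq_left (sub_nonpos.2 ?_)
  rwa [one_le_div (by positivity)]

theorem tent_pos (n : ℕ) {x : Space N} (hx : ‖x‖ < (n : ℝ) + 1) : 0 < tent N n x := by
  unfold tent
  refine lt_max_of_lt_right (sub_pos.2 ?_)
  rwa [div_lt_one (by positivity)]

theorem tendsto_tent (x : Space N) : Tendsto (fun n => tent N n x) atTop (𝓝 1) := by
  have h1 : Tendsto (fun n : ℕ => ‖x‖ / ((n : ℝ) + 1)) atTop (𝓝 0) := by
    have := (tendsto_one_div_add_atTop_nhds_zero_nat (𝕜 := ℝ)).const_mul ‖x‖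
    simpa [div_eq_mul_inv] using this
  have h2 := (tendsto_const_nhds (x := (0 : ℝ))).max (h1.const_sub 1)
  simpa [tent] using h2

/-- Truncation by tents converges in the Gagliardo seminorm. -/
theorem tendsto_gagliardo_tent_mul (hs0 : 0 < s) (hs1 : s < 1) (hp : 1 < p) (hN : N ≠ 0)
    {v : Space N → ℝ} (hv : MemSobolev N s p v) :
    Tendsto (fun n => ∫ z, gagliardoIntegrand N s p (fun x => tent N n x * v x) z) atTop
      (𝓝 (∫ z, gagliardoIntegrand N s p v z)) := by
  have hp0 : 0 < p := by linarith
  have hv' := (memSobolev_iff hp).1 hv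
  have hB := hv'.2.abs.add (memLp_snd_mul_lipQuotient hs0 hs1 hp hN hv.1)
  refine tendsto_integral_of_dominated_convergence _
    (fun n => ((isCutoff_tent n).memSobolev_mul hs0 hs1 hp hN hv).2.1)
    (integrable_abs_rpow hp0 hB) (fun n => ae_of_all _ fun z => ?_) (ae_of_all _ fun z => ?_)
  · rw [Real.norm_eq_abs, abs_of_nonneg (gagliardoIntegrand_nonneg _ _), gagliardoIntegrand_eq hp]
    exact Real.rpow_le_rpow (abs_nonneg _) (((isCutoff_tent n).abs_diffQuotient_mul_le v z).trans
      (le_abs_self _)) hp0.le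
  · simp only [gagliardoIntegrand_eq hp]
    have h1 : Tendsto (fun n => diffQuotient N s p (fun x => tent N n x * v x) z) atTop
        (𝓝 (diffQuotient N s p v z)) := by
      unfold diffQuotient
      have := (((tendsto_tent z.1).mul_const (v z.1)).sub
        ((tendsto_tent z.2).mul_const (v z.2))).div_const (‖z.1 - z.2‖ ^ (((N : ℝ) + s * p) / p))
      simpa using this
    exact h1.abs.rpow_const (Or.inr hp0.le)

end

/-! ### Standing assumptions -/

section

variable {N : ℕ} {s p q : ℝ} {f : ℝ → ℝ}

/-- The standing assumptions on the parameters and the nonlinearity, with the subcritical growth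
exponent `q` fixed. -/
structure IsSetting (N : ℕ) (s p q : ℝ) (f : ℝ → ℝ) : Prop where
  s_pos : 0 < s
  s_lt_one : s < 1
  one_lt : 1 < p
  lt_dim : s * p < N
  nonlin : IsSubcriticalNonlinearity N s p f
  p_lt : p < q
  q_lt : q < N * p / (N - s * p)
  subcritical : SubcriticalAt f q

/-- A continuous potential bounded below by the positive constant `w₀`. -/
structure IsPotential {N : ℕ} (W : Space N → ℝ) (w₀ : ℝ) : Prop where
  continuous : Continuous W
  pos : 0 < w₀
  le : ∀ x, w₀ ≤ W x

theorem IsSetting.p_pos (h : IsSetting N s p q f) : 0 < p := by linarith [h.one_lt]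

theorem IsSetting.q_pos (h : IsSetting N s p q f) : 0 < q := by linarith [h.p_pos, h.p_lt]

theorem IsSetting.dim_ne_zero (h : IsSetting N s p q f) : N ≠ 0 := by
  rintro rfl
  have h1 := h.lt_dim
  have h2 := mul_pos h.s_pos h.p_pos
  rw [Nat.cast_zero] at h1
  linarith

theorem IsPotential.nonneg {W : Space N → ℝ} {w₀ : ℝ} (hW : IsPotential W w₀) (x : Space N) :
    0 ≤ W x := hW.pos.le.trans (hW.le x)

/-! ### The energy space -/

/-- The function `W^{1/p} u`, linear in `u`, whose `L^p` norm is the weighted norm of `u`. -/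
def weighted (p : ℝ) (W u : Space N → ℝ) (x : Space N) : ℝ := W x ^ (1 / p) * u x

theorem abs_weighted_rpow (hp : 0 < p) {W : Space N → ℝ} {w₀ : ℝ} (hW : IsPotential W w₀)
    (u : Space N → ℝ) (x : Space N) : |weighted p W u x| ^ p = W x * |u x| ^ p := by
  unfold weighted
  have h0 := hW.nonneg x
  rw [abs_mul, abs_of_nonneg (by positivity), Real.mul_rpow (by positivity) (abs_nonneg _),
    ← Real.rpow_mul h0, one_div, inv_mul_cancel₀ hp.ne', Real.rpow_one]

theorem aestronglyMeasurable_weighted (hp : 0 < p) {W : Space N → ℝ} {w₀ : ℝ}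
    (hW : IsPotential W w₀)
    {u : Space N → ℝ} (hu : AEStronglyMeasurable u volume) :
    AEStronglyMeasurable (weighted p W u) volume :=
  (hW.continuous.rpow_const fun _ => Or.inr (by positivity)).aestronglyMeasurable.mul hu

theorem memEnergySpace_iff (hp : 1 < p) {W : Space N → ℝ} {w₀ : ℝ} (hW : IsPotential W w₀)
    {u : Space N → ℝ} : MemEnergySpace N s p W u ↔ MemLp u (ENNReal.ofReal p) volume ∧
      MemLp (diffQuotient N s p u) (ENNReal.ofReal p) volume ∧
      MemLp (weighted p W u) (ENNReal.ofReal p) volume := by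
  have hp0 : 0 < p := by linarith
  unfold MemEnergySpace
  rw [memSobolev_iff hp, and_assoc]
  refine and_congr_right fun h => and_congr_right fun _ => ?_
  rw [memLp_iff_integrable_abs_rpow hp0]
  simp only [abs_weighted_rpow hp0 hW]
  exact (and_iff_right (aestronglyMeasurable_weighted hp0 hW h.1)).symm

theorem normPow_eq (hp : 1 < p) {W : Space N → ℝ} {w₀ : ℝ} (hW : IsPotential W w₀)
    (u : Space N → ℝ) : normPow N s p W u =
      (∫ z, |diffQuotient N s p u z| ^ p) + ∫ x, |weighted p W u x| ^ p := by
  unfold normPow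
  simp only [gagliardoIntegrand_eq hp, abs_weighted_rpow (by linarith : 0 < p) hW]

theorem integral_gagliardo_nonneg (u : Space N → ℝ) :
    0 ≤ ∫ z, gagliardoIntegrand N s p u z :=
  integral_nonneg fun z => gagliardoIntegrand_nonneg u z

theorem integral_abs_rpow_nonneg {α : Type*} [MeasurableSpace α] {μ : Measure α} (u : α → ℝ) :
    0 ≤ ∫ x, |u x| ^ p ∂μ := integral_nonneg fun x => by positivity

theorem weighted_const_mul (W : Space N → ℝ) (c : ℝ) (u : Space N → ℝ) (x : Space N) :
    weighted p W (fun x => c * u x) x = c * weighted p W u x := by unfold weighted; ring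

theorem weighted_add (W u v : Space N → ℝ) (x : Space N) :
    weighted p W (fun x => u x + v x) x = weighted p W u x + weighted p W v x := by
  unfold weighted; ring

theorem weighted_sub (W u v : Space N → ℝ) (x : Space N) :
    weighted p W (fun x => u x - v x) x = weighted p W u x - weighted p W v x := by
  unfold weighted; ring

section EnergySpace

variable {W : Space N → ℝ} {w₀ : ℝ} {u v : Space N → ℝ}

theorem MemEnergySpace.add (hp : 1 < p) (hW : IsPotential W w₀)
    (hu : MemEnergySpace N s p W u) (hv : MemEnergySpace N s p W v) :
    MemEnergySpace N s p W (fun x => u x + v x) := by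
  rw [memEnergySpace_iff hp hW] at *
  refine ⟨hu.1.add hv.1, ?_, ?_⟩
  · simp only [funext (diffQuotient_add u v)]; exact hu.2.1.add hv.2.1
  · simp only [funext (weighted_add W u v)]; exact hu.2.2.add hv.2.2

theorem MemEnergySpace.sub (hp : 1 < p) (hW : IsPotential W w₀)
    (hu : MemEnergySpace N s p W u) (hv : MemEnergySpace N s p W v) :
    MemEnergySpace N s p W (fun x => u x - v x) := by
  rw [memEnergySpace_iff hp hW] at *
  refine ⟨hu.1.sub hv.1, ?_, ?_⟩
  · simp only [funext (diffQuotient_sub u v)]; exact hu.2.1.sub hv.2.1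
  · simp only [funext (weighted_sub W u v)]; exact hu.2.2.sub hv.2.2

theorem MemEnergySpace.const_mul (hp : 1 < p) (hW : IsPotential W w₀)
    (hu : MemEnergySpace N s p W u) (c : ℝ) :
    MemEnergySpace N s p W (fun x => c * u x) := by
  rw [memEnergySpace_iff hp hW] at *
  refine ⟨hu.1.const_mul c, ?_, ?_⟩
  · simp only [funext (diffQuotient_const_mul c u)]; exact hu.2.1.const_mul c
  · simp only [funext (weighted_const_mul W c u)]; exact hu.2.2.const_mul c

theorem MemSobolev.memEnergySpace_const (hu : MemSobolev N s p u) (hp : 1 < p) (c : ℝ) :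
    MemEnergySpace N s p (fun _ => c) u :=
  ⟨hu, (integrable_abs_rpow (by linarith) hu.1).const_mul c⟩

theorem isPotential_const {c : ℝ} (hc : 0 < c) : IsPotential (fun _ : Space N => c) c :=
  ⟨continuous_const, hc, fun _ => le_rfl⟩

theorem normPow_nonneg (hp : 1 < p) (hW : IsPotential W w₀) : 0 ≤ normPow N s p W u := by
  rw [normPow_eq hp hW]
  exact add_nonneg (integral_abs_rpow_nonneg _) (integral_abs_rpow_nonneg _)

theorem normPow_const_mul (hp : 1 < p) (hW : IsPotential W w₀) (c : ℝ) (u : Space N → ℝ) :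
    normPow N s p W (fun x => c * u x) = |c| ^ p * normPow N s p W u := by
  rw [normPow_eq hp hW, normPow_eq hp hW]
  simp only [diffQuotient_const_mul, weighted_const_mul, abs_mul,
    Real.mul_rpow (abs_nonneg _) (abs_nonneg _), integral_const_mul]
  ring

theorem le_normPow (hp : 1 < p) (hW : IsPotential W w₀) (hu : MemEnergySpace N s p W u) :
    (∫ z, gagliardoIntegrand N s p u z) + w₀ * ∫ x, |u x| ^ p ≤ normPow N s p W u := by
  unfold normPow
  rw [← integral_const_mul]
  refine add_le_add_right (integral_mono ((integrable_abs_rpow (by linarith) hu.1.1).const_mul _)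
    hu.2 fun x => ?_) _
  exact mul_le_mul_of_nonneg_right (hW.le x) (by positivity)

theorem min_mul_le_normPow (hp : 1 < p) (hW : IsPotential W w₀) (hu : MemEnergySpace N s p W u) :
    min 1 w₀ * ((∫ z, gagliardoIntegrand N s p u z) + ∫ x, |u x| ^ p) ≤ normPow N s p W u := by
  refine le_trans ?_ (le_normPow hp hW hu)
  have h1 := mul_le_mul_of_nonneg_right (min_le_left 1 w₀)
    (integral_gagliardo_nonneg (s := s) (p := p) u)
  have h2 := mul_le_mul_of_nonneg_right (min_le_right 1 w₀)
    (integral_abs_rpow_nonneg (p := p) (μ := volume) u)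
  rw [mul_add]
  linarith

theorem ae_eq_zero_of_integral (hp : 0 < p) (hu : MemLp u (ENNReal.ofReal p) volume)
    (h : ∫ x, |u x| ^ p ≤ 0) : u =ᵐ[volume] 0 := by
  have h0 : ∫ x, |u x| ^ p = 0 := le_antisymm h (integral_abs_rpow_nonneg _)
  rw [integral_eq_zero_iff_of_nonneg (fun x => by positivity) (integrable_abs_rpow hp hu)] at h0
  filter_upwards [h0] with x hx
  have hx' : |u x| ^ p = 0 := hx
  exact abs_eq_zero.1 ((Real.rpow_eq_zero (abs_nonneg _) hp.ne').1 hx')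

theorem integral_pos_of_ne (hp : 0 < p) (hu : MemLp u (ENNReal.ofReal p) volume)
    (h : ¬ u =ᵐ[volume] 0) : 0 < ∫ x, |u x| ^ p := by
  by_contra h1
  exact h (ae_eq_zero_of_integral hp hu (not_lt.1 h1))

theorem normPow_pos (hp : 1 < p) (hW : IsPotential W w₀) (hu : MemEnergySpace N s p W u)
    (h : ¬ u =ᵐ[volume] 0) : 0 < normPow N s p W u := by
  have h1 := le_normPow hp hW hu
  have h2 := mul_pos hW.pos (integral_pos_of_ne (by linarith) hu.1.1 h)
  have h3 := integral_gagliardo_nonneg (s := s) (p := p) u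
  linarith

/-- The positive part belongs to the energy space and does not have a larger norm. -/
theorem MemEnergySpace.pos_part (hp : 1 < p) (hW : IsPotential W w₀)
    (hu : MemEnergySpace N s p W u) :
    MemEnergySpace N s p W (fun x => max (u x) 0) ∧
      normPow N s p W (fun x => max (u x) 0) ≤ normPow N s p W u := by
  have hp0 : 0 < p := by linarith
  have hu' := (memEnergySpace_iff hp hW).1 hu
  have hm : AEStronglyMeasurable (fun x => max (u x) 0) volume :=
    (hu.1.1.1.aemeasurable.max aemeasurable_const).aestronglyMeasurable
  have h0 : ∀ x, |max (u x) 0| ≤ |u x| := fun x => by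
    rw [abs_of_nonneg (le_max_right _ _)]
    exact max_le (le_abs_self _) (abs_nonneg _)
  have h1 : ∀ z, |diffQuotient N s p (fun x => max (u x) 0) z| ≤ |diffQuotient N s p u z| := by
    intro z
    unfold diffQuotient
    rw [abs_div, abs_div]
    exact div_le_div_of_nonneg_right (abs_max_sub_max_le_abs _ _ _) (abs_nonneg _)
  have h2 : ∀ x, |weighted p W (fun x => max (u x) 0) x| ≤ |weighted p W u x| := by
    intro x
    unfold weighted
    rw [abs_mul, abs_mul]
    exact mul_le_mul_of_nonneg_left (h0 x) (abs_nonneg _)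
  have k0 : MemLp (fun x => max (u x) 0) (ENNReal.ofReal p) volume :=
    hu'.1.mono hm (ae_of_all _ h0)
  have k1 := hu'.2.1.mono (aestronglyMeasurable_diffQuotient (s := s) (p := p) hm) (ae_of_all _ h1)
  have k2 := hu'.2.2.mono (aestronglyMeasurable_weighted hp0 hW hm) (ae_of_all _ h2)
  refine ⟨(memEnergySpace_iff hp hW).2 ⟨k0, k1, k2⟩, ?_⟩
  rw [normPow_eq hp hW, normPow_eq hp hW]
  exact add_le_add
    (integral_mono (integrable_abs_rpow hp0 k1) (integrable_abs_rpow hp0 hu'.2.1) fun z =>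
      Real.rpow_le_rpow (abs_nonneg _) (h1 z) hp0.le)
    (integral_mono (integrable_abs_rpow hp0 k2) (integrable_abs_rpow hp0 hu'.2.2) fun z =>
      Real.rpow_le_rpow (abs_nonneg _) (h2 z) hp0.le)

end EnergySpace

/-! ### The nonlinear terms -/

theorem IsSetting.integrable_twoPower (h : IsSetting N s p q f) {u : Space N → ℝ}
    (hu : MemSobolev N s p u) : Integrable (fun x => twoPower p q (u x)) := by
  obtain ⟨C, -, hC⟩ := exists_integral_rpow_le h.s_pos h.one_lt h.lt_dim h.p_lt h.q_lt one_pos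
  exact (integrable_abs_rpow h.p_pos hu.1).add (hC u hu).1

theorem IsSetting.exists_mul_self_le_twoPower (h : IsSetting N s p q f) :
    ∃ C > 0, ∀ t, f t * t ≤ C * twoPower p q t := by
  obtain ⟨C, hC, hle⟩ := h.nonlin.growth_mul h.one_lt h.p_lt h.subcritical one_pos
  refine ⟨1 + C, by positivity, fun t => (hle t).trans ?_⟩
  have h1 : 0 ≤ |t| ^ p := by positivity
  have h2 : 0 ≤ |t| ^ q := by positivity
  unfold twoPower
  nlinarith

/-- A continuous function of `u` between `0` and `f(u) u`. -/
structure IsSubDensity (f j : ℝ → ℝ) : Prop where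
  continuous : Continuous j
  nonneg : ∀ t, 0 ≤ j t
  le : ∀ t, j t ≤ f t * t

theorem IsSetting.isSubDensity_mul_self (h : IsSetting N s p q f) :
    IsSubDensity f fun t => f t * t :=
  ⟨h.nonlin.continuous.mul continuous_id, h.nonlin.mul_self_nonneg h.one_lt, fun _ => le_rfl⟩

theorem IsSetting.isSubDensity_nehariDensity (h : IsSetting N s p q f) :
    IsSubDensity f (nehariDensity p f) :=
  ⟨h.nonlin.continuous_nehariDensity, h.nonlin.nehariDensity_nonneg h.one_lt,
    h.nonlin.nehariDensity_le h.one_lt⟩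

theorem IsSetting.isSubDensity_primitive (h : IsSetting N s p q f) :
    IsSubDensity f (primitive f) := by
  refine ⟨h.nonlin.continuous_primitive, h.nonlin.primitive_nonneg h.one_lt, fun t => ?_⟩
  have h1 := h.nonlin.nehariDensity_nonneg h.one_lt t
  have h2 : f t * t / p ≤ f t * t := div_le_self (h.nonlin.mul_self_nonneg h.one_lt t) h.one_lt.le
  unfold nehariDensity at h1
  linarith

theorem IsSetting.exists_le_twoPower (h : IsSetting N s p q f) :
    ∃ C > 0, ∀ j, IsSubDensity f j → ∀ t, |j t| ≤ C * twoPower p q t := by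
  obtain ⟨C, hC, hle⟩ := h.exists_mul_self_le_twoPower
  refine ⟨C, hC, fun j hj t => ?_⟩
  rw [abs_of_nonneg (hj.nonneg t)]
  exact (hj.le t).trans (hle t)

theorem IsSetting.integrable_comp (h : IsSetting N s p q f) {j : ℝ → ℝ} (hj : IsSubDensity f j)
    {u : Space N → ℝ} (hu : MemSobolev N s p u) : Integrable (fun x => j (u x)) := by
  obtain ⟨C, hC, hle⟩ := h.exists_le_twoPower
  exact ((h.integrable_twoPower hu).const_mul C).mono'
    (hj.continuous.comp_aestronglyMeasurable hu.1.1) (ae_of_all _ fun x => hle j hj _)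

theorem twoPower_le_of_abs_le (hp : 0 ≤ p) (hq : 0 ≤ q) {a b : ℝ} (h : |a| ≤ |b|) :
    twoPower p q a ≤ twoPower p q b :=
  add_le_add (Real.rpow_le_rpow (abs_nonneg _) h hp) (Real.rpow_le_rpow (abs_nonneg _) h hq)

/-- Dominated convergence for the nonlinear terms. -/
theorem IsSetting.tendsto_integral_comp (h : IsSetting N s p q f) {j : ℝ → ℝ}
    (hj : IsSubDensity f j) {ι : Type*} {l : Filter ι} [l.IsCountablyGenerated]
    {w : ι → Space N → ℝ} {w₀ g : Space N → ℝ} (hw : ∀ n, AEStronglyMeasurable (w n) volume)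
    (hg : Integrable fun x => twoPower p q (g x)) (hle : ∀ᶠ n in l, ∀ x, |w n x| ≤ |g x|)
    (hlim : ∀ᵐ x, Tendsto (fun n => w n x) l (𝓝 (w₀ x))) :
    Tendsto (fun n => ∫ x, j (w n x)) l (𝓝 (∫ x, j (w₀ x))) := by
  obtain ⟨C, hC, hCle⟩ := h.exists_le_twoPower
  refine tendsto_integral_filter_of_dominated_convergence (fun x => C * twoPower p q (g x))
    (Eventually.of_forall fun n => hj.continuous.comp_aestronglyMeasurable (hw n)) ?_
    (hg.const_mul C) ?_
  · filter_upwards [hle] with n hn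
    refine ae_of_all _ fun x => (hCle j hj _).trans ?_
    exact mul_le_mul_of_nonneg_left (twoPower_le_of_abs_le h.p_pos.le h.q_pos.le (hn x)) hC.le
  · filter_upwards [hlim] with x hx
    exact (hj.continuous.tendsto _).comp hx

theorem IsSetting.integrable_mul (h : IsSetting N s p q f) {u φ : Space N → ℝ}
    (hu : MemSobolev N s p u) (hφ : MemSobolev N s p φ) :
    Integrable (fun x => f (u x) * φ x) := by
  obtain ⟨C, hC, hle⟩ := h.nonlin.growth h.one_lt h.p_lt h.subcritical one_pos
  refine (((h.integrable_twoPower hu).add (h.integrable_twoPower hφ)).const_mul (1 + C)).mono'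
    ((h.nonlin.continuous.comp_aestronglyMeasurable hu.1.1).mul hφ.1.1) (ae_of_all _ fun x => ?_)
  have h0 := h.nonlin.nonneg h.one_lt (u x)
  rw [Real.norm_eq_abs, abs_mul, abs_of_nonneg h0]
  have h1 := mul_le_mul_of_nonneg_right (hle (u x)) (abs_nonneg (φ x))
  have h2 := abs_rpow_mul_abs_le h.one_lt (u x) (φ x)
  have h3 := abs_rpow_mul_abs_le (h.one_lt.trans h.p_lt) (u x) (φ x)
  have n1 : 0 ≤ |u x| ^ p + |φ x| ^ p := by positivity
  have n2 : 0 ≤ |u x| ^ q + |φ x| ^ q := by positivity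
  have h4 := mul_le_mul_of_nonneg_left h3 hC.le
  simp only [Pi.add_apply, twoPower]
  nlinarith [mul_nonneg hC.le n1]

/-! ### Energy, Nehari manifold and ground state level -/

theorem diffQuotient_pairing_eq (hp : 1 < p) (u φ : Space N → ℝ) (z : Space N × Space N) :
    |u z.1 - u z.2| ^ (p - 2) * (u z.1 - u z.2) / ‖z.1 - z.2‖ ^ ((N : ℝ) + s * p)
        * (φ z.1 - φ z.2) =
      |diffQuotient N s p u z| ^ (p - 2) * diffQuotient N s p u z * diffQuotient N s p φ z := by
  unfold diffQuotient
  rcases eq_or_ne z.1 z.2 with h | h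
  · simp [h]
  have hk : 0 < ‖z.1 - z.2‖ := norm_pos_iff.2 (sub_ne_zero.2 h)
  set k := ‖z.1 - z.2‖ with hkd
  set e := ((N : ℝ) + s * p) / p with he
  have hp0 : p ≠ 0 := by linarith
  have hk' : k ^ ((N : ℝ) + s * p) = (k ^ e) ^ (p - 2) * k ^ e * k ^ e := by
    rw [← Real.rpow_mul hk.le, ← Real.rpow_add hk, ← Real.rpow_add hk]
    congr 1
    rw [he]; field_simp; ring
  have hke : 0 < k ^ e := by positivity
  have hke2 : 0 < (k ^ e) ^ (p - 2) := by positivity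
  rw [hk', abs_div, abs_of_pos hke, Real.div_rpow (abs_nonneg _) hke.le]
  field_simp

theorem weighted_pairing_eq (hp : 1 < p) {W : Space N → ℝ} {w₀ : ℝ} (hW : IsPotential W w₀)
    (u φ : Space N → ℝ) (x : Space N) :
    W x * (|u x| ^ (p - 2) * u x) * φ x =
      |weighted p W u x| ^ (p - 2) * weighted p W u x * weighted p W φ x := by
  unfold weighted
  have hp0 : p ≠ 0 := by linarith
  have hw : 0 < W x := hW.pos.trans_le (hW.le x)
  have hk : W x = (W x ^ (1 / p)) ^ (p - 2) * W x ^ (1 / p) * W x ^ (1 / p) := by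
    rw [← Real.rpow_mul hw.le, ← Real.rpow_add hw, ← Real.rpow_add hw]
    conv_lhs => rw [← Real.rpow_one (W x)]
    congr 1
    field_simp; ring
  rw [abs_mul, abs_of_pos (show 0 < W x ^ (1 / p) by positivity),
    Real.mul_rpow (by positivity) (abs_nonneg _)]
  conv_lhs => rw [hk]
  ring

theorem energyDeriv_eq (hp : 1 < p) {W : Space N → ℝ} {w₀ : ℝ} (hW : IsPotential W w₀)
    (u φ : Space N → ℝ) : energyDeriv N s p W f u φ =
      (∫ z, |diffQuotient N s p u z| ^ (p - 2) * diffQuotient N s p u z *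
          diffQuotient N s p φ z) +
        (∫ x, |weighted p W u x| ^ (p - 2) * weighted p W u x * weighted p W φ x) -
        ∫ x, f (u x) * φ x := by
  unfold energyDeriv
  simp only [diffQuotient_pairing_eq hp, weighted_pairing_eq hp hW]

theorem energyDeriv_self (hp : 1 < p) {W : Space N → ℝ} {w₀ : ℝ} (hW : IsPotential W w₀)
    (u : Space N → ℝ) :
    energyDeriv N s p W f u u = normPow N s p W u - ∫ x, f (u x) * u x := by
  rw [energyDeriv_eq hp hW, normPow_eq hp hW]
  simp only [abs_rpow_sub_two_mul_mul (show p ≠ 0 by linarith)]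

section Nehari

variable {W : Space N → ℝ} {w₀ : ℝ} {u : Space N → ℝ}

theorem IsSetting.integral_nehariDensity (h : IsSetting N s p q f) (hu : MemSobolev N s p u) :
    ∫ x, nehariDensity p f (u x) = 1 / p * (∫ x, f (u x) * u x) - ∫ x, primitive f (u x) := by
  have h1 := (h.integrable_comp h.isSubDensity_mul_self hu).div_const p
  have h2 := h.integrable_comp h.isSubDensity_primitive hu
  unfold nehariDensity
  rw [integral_sub h1 h2, integral_div]
  ring

/-- The energy minus `⟨I'(u), u⟩ / p` does not involve the potential. -/
theorem IsSetting.energy_eq (h : IsSetting N s p q f) (hW : IsPotential W w₀)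
    (hu : MemSobolev N s p u) :
    energy N s p W f u =
      1 / p * energyDeriv N s p W f u u + ∫ x, nehariDensity p f (u x) := by
  rw [energyDeriv_self h.one_lt hW, h.integral_nehariDensity hu]
  unfold energy
  ring

theorem IsSetting.energy_eq_of_mem_nehari (h : IsSetting N s p q f) (hW : IsPotential W w₀)
    (hu : u ∈ nehari N s p W f) :
    energy N s p W f u = ∫ x, nehariDensity p f (u x) := by
  rw [h.energy_eq hW hu.1.1, hu.2.2, mul_zero, zero_add]

theorem IsSetting.integral_nehariDensity_nonneg (h : IsSetting N s p q f) :
    0 ≤ ∫ x, nehariDensity p f (u x) :=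
  integral_nonneg fun _ => h.nonlin.nehariDensity_nonneg h.one_lt _

theorem IsSetting.bddBelow (h : IsSetting N s p q f) (hW : IsPotential W w₀) :
    BddBelow (energy N s p W f '' nehari N s p W f) := by
  refine ⟨0, ?_⟩
  rintro _ ⟨u, hu, rfl⟩
  rw [h.energy_eq_of_mem_nehari hW hu]
  exact h.integral_nehariDensity_nonneg

theorem IsSetting.groundLevel_le (h : IsSetting N s p q f) (hW : IsPotential W w₀)
    (hu : u ∈ nehari N s p W f) : groundLevel N s p W f ≤ energy N s p W f u :=
  csInf_le (h.bddBelow hW) ⟨u, hu, rfl⟩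

theorem ae_eq_zero_of_const_mul {t : ℝ} (ht : t ≠ 0) (h : (fun x => t * u x) =ᵐ[volume] 0) :
    u =ᵐ[volume] 0 := by
  filter_upwards [h] with x hx
  exact (mul_eq_zero.1 hx).resolve_left ht

theorem IsSetting.energyDeriv_const_mul (h : IsSetting N s p q f) (hW : IsPotential W w₀)
    {t : ℝ} (ht : 0 ≤ t) (u : Space N → ℝ) :
    energyDeriv N s p W f (fun x => t * u x) (fun x => t * u x) =
      t ^ p * normPow N s p W u - ∫ x, f (t * u x) * (t * u x) := by
  rw [energyDeriv_self h.one_lt hW, normPow_const_mul h.one_lt hW, abs_of_nonneg ht]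

theorem IsSetting.continuousOn_energyDeriv_const_mul (h : IsSetting N s p q f)
    (hW : IsPotential W w₀) (hu : MemSobolev N s p u) (b : ℝ) :
    ContinuousOn (fun t => energyDeriv N s p W f (fun x => t * u x) (fun x => t * u x))
      (Set.Icc 0 b) := by
  have hcont : ContinuousOn (fun t : ℝ => t ^ p * normPow N s p W u -
      ∫ x, f (t * u x) * (t * u x)) (Set.Icc 0 b) := by
    refine ((Real.continuous_rpow_const h.p_pos.le).mul continuous_const).continuousOn.sub ?_
    intro t ht
    refine h.tendsto_integral_comp h.isSubDensity_mul_self (w := fun t x => t * u x)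
      (g := fun x => b * u x) (fun t => hu.1.1.const_mul t)
      (h.integrable_twoPower (hu.const_mul h.one_lt b)) ?_ (ae_of_all _ fun x => ?_)
    · filter_upwards [self_mem_nhdsWithin] with r hr x
      rw [abs_mul, abs_mul, abs_of_nonneg hr.1, abs_of_nonneg (hr.1.trans hr.2)]
      exact mul_le_mul_of_nonneg_right hr.2 (abs_nonneg _)
    · have : Continuous fun t : ℝ => t * u x := by fun_prop
      exact this.continuousWithinAt
  exact hcont.congr fun t ht => h.energyDeriv_const_mul hW ht.1 u

/-- Near the origin of a ray, `⟨I'(tu), tu⟩ > 0`. -/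
theorem IsSetting.exists_energyDeriv_pos (h : IsSetting N s p q f) (hW : IsPotential W w₀)
    (hu : MemEnergySpace N s p W u) (hne : ¬ u =ᵐ[volume] 0) {b : ℝ} (hb : 0 < b) :
    ∃ t, 0 < t ∧ t < b ∧
      0 < energyDeriv N s p W f (fun x => t * u x) (fun x => t * u x) := by
  obtain ⟨C, hC, hle⟩ := h.nonlin.growth_mul h.one_lt h.p_lt h.subcritical
    (show 0 < w₀ / 2 by linarith [hW.pos])
  have hp := integrable_abs_rpow h.p_pos hu.1.1
  have hq : Integrable fun x => |u x| ^ q := by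
    obtain ⟨D, -, hD⟩ := exists_integral_rpow_le h.s_pos h.one_lt h.lt_dim h.p_lt h.q_lt one_pos
    exact (hD u hu.1).1
  set A := ∫ x, |u x| ^ p
  set B := ∫ x, |u x| ^ q
  have hA : 0 < A := integral_pos_of_ne h.p_pos hu.1.1 hne
  have hlow : w₀ * A ≤ normPow N s p W u := by
    linarith [le_normPow h.one_lt hW hu, integral_gagliardo_nonneg (s := s) (p := p) u]
  have hlim : Tendsto (fun t : ℝ => C * t ^ (q - p) * B) (𝓝[>] 0) (𝓝 0) := by
    have h1 : Continuous fun t : ℝ => C * t ^ (q - p) * B :=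
      (continuous_const.mul (Real.continuous_rpow_const (by linarith [h.p_lt]))).mul
        continuous_const
    have h2 := (h1.tendsto 0).mono_left (nhdsWithin_le_nhds (s := Set.Ioi (0 : ℝ)))
    rwa [Real.zero_rpow (by linarith [h.p_lt]), mul_zero, zero_mul] at h2
  have hwA : 0 < w₀ / 2 * A := mul_pos (by linarith [hW.pos]) hA
  obtain ⟨t, htB, ht0, htb⟩ :=
    ((hlim.eventually (gt_mem_nhds hwA)).and (Ioo_mem_nhdsGT hb)).exists
  refine ⟨t, ht0, htb, ?_⟩
  rw [h.energyDeriv_const_mul hW ht0.le, sub_pos]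
  have htp : 0 < t ^ p := by positivity
  have e : t ^ q = t ^ (q - p) * t ^ p := by rw [← Real.rpow_add ht0]; ring_nf
  have hI : ∫ x, f (t * u x) * (t * u x) ≤ w₀ / 2 * (t ^ p * A) + C * (t ^ q * B) := by
    have i1 := (hp.const_mul (t ^ p)).const_mul (w₀ / 2)
    have i2 := (hq.const_mul (t ^ q)).const_mul C
    calc ∫ x, f (t * u x) * (t * u x)
        ≤ ∫ x, (w₀ / 2 * (t ^ p * |u x| ^ p) + C * (t ^ q * |u x| ^ q)) := by
          refine integral_mono (h.integrable_comp h.isSubDensity_mul_self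
            (hu.1.const_mul h.one_lt t)) (i1.add i2) fun x => ?_
          have := hle (t * u x)
          rwa [abs_mul, abs_of_pos ht0, Real.mul_rpow ht0.le (abs_nonneg _),
            Real.mul_rpow ht0.le (abs_nonneg _)] at this
      _ = _ := by
          rw [integral_add i1 i2, integral_const_mul, integral_const_mul, integral_const_mul,
            integral_const_mul]
  have h3 := mul_lt_mul_of_pos_left htB htp
  have h4 := mul_le_mul_of_nonneg_left hlow htp.le
  rw [e] at hI
  linarith

/-- If `⟨I'(u), u⟩ ≤ 0` for a nonzero `u`, the ray through `u` meets the Nehari manifold at a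
parameter in `(0, 1]`. -/
theorem IsSetting.exists_mul_mem_nehari (h : IsSetting N s p q f) (hW : IsPotential W w₀)
    (hu : MemEnergySpace N s p W u) (hne : ¬ u =ᵐ[volume] 0)
    (hle : energyDeriv N s p W f u u ≤ 0) :
    ∃ t, 0 < t ∧ t ≤ 1 ∧ (fun x => t * u x) ∈ nehari N s p W f := by
  obtain ⟨a, ha0, ha1, ha⟩ := h.exists_energyDeriv_pos hW hu hne one_pos
  have hc := (h.continuousOn_energyDeriv_const_mul hW hu.1 1).mono
    (Set.Icc_subset_Icc_left ha0.le)
  have h1 : energyDeriv N s p W f (fun x => 1 * u x) (fun x => 1 * u x) ≤ 0 := by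
    simpa using hle
  obtain ⟨t, ht, ht0⟩ := intermediate_value_Icc' ha1.le hc ⟨h1, ha.le⟩
  have htpos : 0 < t := ha0.trans_le ht.1
  exact ⟨t, htpos, ht.2, hu.const_mul h.one_lt hW t,
    fun h0 => hne (ae_eq_zero_of_const_mul htpos.ne' h0), ht0⟩

theorem IsSetting.integral_nehariDensity_mono (h : IsSetting N s p q f) {v : Space N → ℝ}
    (hu : MemSobolev N s p u) (hv : MemSobolev N s p v)
    (hle : ∀ x, nehariDensity p f (u x) ≤ nehariDensity p f (v x)) :
    ∫ x, nehariDensity p f (u x) ≤ ∫ x, nehariDensity p f (v x) :=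
  integral_mono (h.integrable_comp h.isSubDensity_nehariDensity hu)
    (h.integrable_comp h.isSubDensity_nehariDensity hv) hle

theorem IsSubcriticalNonlinearity.nehariDensity_mul_le (hf : IsSubcriticalNonlinearity N s p f)
    (hp : 1 < p) {t : ℝ} (h0 : 0 ≤ t) (h1 : t ≤ 1) (r : ℝ) :
    nehariDensity p f (t * r) ≤ nehariDensity p f r := by
  rcases le_total r 0 with hr | hr
  · rw [hf.nehariDensity_of_nonpos hr,
      hf.nehariDensity_of_nonpos (mul_nonpos_of_nonneg_of_nonpos h0 hr)]
  · exact hf.nehariDensity_mono hp (mul_le_of_le_one_left hr h1)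

/-- The ground state level is bounded by `∫ (f(u) u / p - F(u))` for every nonzero `u` with
`⟨I'(u), u⟩ ≤ 0`; the bound is realised by the point of the Nehari manifold on the ray of `u`. -/
theorem IsSetting.exists_mem_nehari_energy_le (h : IsSetting N s p q f) (hW : IsPotential W w₀)
    (hu : MemEnergySpace N s p W u) (hne : ¬ u =ᵐ[volume] 0)
    (hle : energyDeriv N s p W f u u ≤ 0) :
    ∃ t, 0 < t ∧ t ≤ 1 ∧ (fun x => t * u x) ∈ nehari N s p W f ∧
      energy N s p W f (fun x => t * u x) ≤ ∫ x, nehariDensity p f (u x) := by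
  obtain ⟨t, h0, h1, hm⟩ := h.exists_mul_mem_nehari hW hu hne hle
  refine ⟨t, h0, h1, hm, ?_⟩
  rw [h.energy_eq_of_mem_nehari hW hm]
  exact h.integral_nehariDensity_mono (hu.1.const_mul h.one_lt t) hu.1 fun x =>
    h.nonlin.nehariDensity_mul_le h.one_lt h0.le h1 _

theorem IsSetting.groundLevel_le_integral (h : IsSetting N s p q f) (hW : IsPotential W w₀)
    (hu : MemEnergySpace N s p W u) (hne : ¬ u =ᵐ[volume] 0)
    (hle : energyDeriv N s p W f u u ≤ 0) :
    groundLevel N s p W f ≤ ∫ x, nehariDensity p f (u x) := by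
  obtain ⟨t, -, -, hm, he⟩ := h.exists_mem_nehari_energy_le hW hu hne hle
  exact (h.groundLevel_le hW hm).trans he

theorem ae_nonpos_of_integral_comp_le (h : IsSetting N s p q f) {j : ℝ → ℝ}
    (hj : IsSubDensity f j) (hpos : ∀ t, 0 < t → 0 < j t) (hu : MemSobolev N s p u)
    (h0 : ∫ x, j (u x) ≤ 0) : ∀ᵐ x, u x ≤ 0 := by
  have h1 : ∫ x, j (u x) = 0 := le_antisymm h0 (integral_nonneg fun x => hj.nonneg _)
  rw [integral_eq_zero_iff_of_nonneg (fun x => hj.nonneg _) (h.integrable_comp hj hu)] at h1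
  filter_upwards [h1] with x hx
  by_contra hc
  exact (hpos _ (not_le.1 hc)).ne' hx

/-- For functions with `∫ F(u) > 0` the ray eventually enters `{⟨I'(u), u⟩ < 0}`. -/
theorem IsSetting.exists_energyDeriv_neg (h : IsSetting N s p q f) (hW : IsPotential W w₀)
    (hu : MemEnergySpace N s p W u) (hpos : ¬ ∀ᵐ x, u x ≤ 0) :
    ∃ b, 1 < b ∧ energyDeriv N s p W f (fun x => b * u x) (fun x => b * u x) < 0 := by
  obtain ⟨θ, hθ, hF⟩ := h.nonlin.exists_primitive_mul_ge h.one_lt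
  have hFpos : 0 < ∫ x, primitive f (u x) := by
    by_contra hc
    exact hpos (ae_nonpos_of_integral_comp_le h h.isSubDensity_primitive
      (fun t ht => h.nonlin.primitive_pos h.one_lt ht) hu.1 (not_lt.1 hc))
  set A := ∫ x, primitive f (u x)
  have hlim : Tendsto (fun t : ℝ => t ^ (θ - p) * A) atTop atTop :=
    (tendsto_rpow_atTop (by linarith)).atTop_mul_const hFpos
  obtain ⟨b, hb, hb1⟩ := ((hlim.eventually_gt_atTop (normPow N s p W u)).and
    (eventually_gt_atTop 1)).exists
  have hb0 : 0 < b := by linarith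
  refine ⟨b, hb1, ?_⟩
  rw [h.energyDeriv_const_mul hW hb0.le, sub_neg]
  have e : b ^ θ = b ^ p * b ^ (θ - p) := by rw [← Real.rpow_add hb0]; ring_nf
  have hbu := hu.1.const_mul h.one_lt b
  calc b ^ p * normPow N s p W u < b ^ p * (b ^ (θ - p) * A) :=
        mul_lt_mul_of_pos_left hb (by positivity)
    _ = ∫ x, b ^ θ * primitive f (u x) := by rw [integral_const_mul, e, mul_assoc]
    _ ≤ ∫ x, primitive f (b * u x) :=
        integral_mono ((h.integrable_comp h.isSubDensity_primitive hu.1).const_mul _)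
          (h.integrable_comp h.isSubDensity_primitive hbu) fun x => hF b _ hb1.le
    _ ≤ ∫ x, f (b * u x) * (b * u x) :=
        integral_mono (h.integrable_comp h.isSubDensity_primitive hbu)
          (h.integrable_comp h.isSubDensity_mul_self hbu) fun x => h.isSubDensity_primitive.le _

theorem IsSetting.memEnergySpace_tent (h : IsSetting N s p q f) (hW : IsPotential W w₀) (n : ℕ) :
    MemEnergySpace N s p W (tent N n) := by
  refine ⟨(isCutoff_tent n).memSobolev h.s_pos h.s_lt_one h.one_lt h.dim_ne_zero
    fun x hx => tent_eq_zero n hx, Continuous.integrable_of_hasCompactSupport ?_ ?_⟩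
  · exact hW.continuous.mul ((continuous_abs_rpow h.p_pos).comp (isCutoff_tent n).continuous)
  · refine HasCompactSupport.intro (isCompact_closedBall (0 : Space N) (n + 1)) fun x hx => ?_
    have hx' : (n : ℝ) + 1 < ‖x‖ := by simpa using hx
    rw [tent_eq_zero n hx'.le, abs_zero, Real.zero_rpow h.p_pos.ne', mul_zero]

/-- The Nehari manifold is nonempty: rays through tents meet it. -/
theorem IsSetting.nehari_nonempty (h : IsSetting N s p q f) (hW : IsPotential W w₀) :
    (nehari N s p W f).Nonempty := by
  have hE := h.memEnergySpace_tent hW 0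
  have hpos : ¬ ∀ᵐ x, tent N 0 x ≤ 0 := by
    intro hae
    have h1 : volume (Metric.ball (0 : Space N) 1) ≤ volume {x | ¬ tent N 0 x ≤ 0} :=
      measure_mono fun x hx => not_le.2 (tent_pos 0 (by simpa using hx))
    rw [show volume {x | ¬ tent N 0 x ≤ 0} = 0 from hae] at h1
    exact (Metric.measure_ball_pos volume (0 : Space N) one_pos).not_ge h1
  obtain ⟨b, hb, hneg⟩ := h.exists_energyDeriv_neg hW hE hpos
  have hb0 : b ≠ 0 := by linarith
  obtain ⟨t, -, -, ht⟩ := h.exists_mul_mem_nehari hW (hE.const_mul h.one_lt hW b)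
    (fun h0 => hpos (by
      filter_upwards [ae_eq_zero_of_const_mul hb0 h0] with x hx
      exact hx.le)) hneg.le
  exact ⟨_, ht⟩

/-- Functions with `⟨I'(u), u⟩ ≤ 0` and bounded level stay away from zero in `L^p`, uniformly in
potentials bounded below by `w₀`, and are bounded in the energy norm. -/
theorem IsSetting.exists_lower_bound (h : IsSetting N s p q f) (hw₀ : 0 < w₀) (M : ℝ) :
    ∃ δ > 0, ∃ K, ∀ (W u : Space N → ℝ), IsPotential W w₀ → MemEnergySpace N s p W u →
      ¬ u =ᵐ[volume] 0 → energyDeriv N s p W f u u ≤ 0 →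
      ∫ x, nehariDensity p f (u x) ≤ M → δ ≤ ∫ x, |u x| ^ p ∧ normPow N s p W u ≤ K := by
  obtain ⟨κ, hκ, hκle⟩ := h.nonlin.exists_nehariDensity_ge h.one_lt
  -- the Gagliardo–Nirenberg inequality gives `S = [u]^p + ‖u‖_p^p ≥ ρ`; with a small factor in
  -- front of `S` it then bounds `S` by `‖u‖_p^p`
  set m := min 1 w₀ with hm
  have hm0 : 0 < m := lt_min one_pos hw₀
  set M2 := |M| / κ / m + 1 with hM2
  have hM2pos : 0 < M2 := by positivity
  set e := (q - p) / p with he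
  have he0 : 0 < e := div_pos (by linarith [h.p_lt]) h.p_pos
  obtain ⟨C, hC, hgr⟩ := h.nonlin.growth_mul h.one_lt h.p_lt h.subcritical
    (show 0 < m / 2 by linarith)
  obtain ⟨C1, hC1, hGN1⟩ := exists_integral_rpow_le h.s_pos h.one_lt h.lt_dim h.p_lt h.q_lt
    one_pos
  obtain ⟨C2, hC2, hGN2⟩ := exists_integral_rpow_le h.s_pos h.one_lt h.lt_dim h.p_lt h.q_lt
    (show 0 < m / (4 * C * M2 ^ e) by positivity)
  set ρ := (m / (2 * C * (1 + C1))) ^ e⁻¹ with hρ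
  refine ⟨m / 4 * ρ / (C * M2 ^ e * C2), by positivity, |M| / κ,
    fun W u hW hu hne hle hH => ?_⟩
  set A := ∫ x, |u x| ^ p with hA
  set g := ∫ z, gagliardoIntegrand N s p u z with hg
  set S := g + A with hS
  have hg0 : 0 ≤ g := integral_gagliardo_nonneg u
  have hA0 : 0 < A := integral_pos_of_ne h.p_pos hu.1.1 hne
  have hS0 : 0 < S := by positivity
  have hGi := h.integrable_comp h.isSubDensity_mul_self hu.1
  have hHi := h.integrable_comp h.isSubDensity_nehariDensity hu.1
  rw [energyDeriv_self h.one_lt hW, sub_nonpos] at hle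
  have hG : ∫ x, f (u x) * u x ≤ |M| / κ := by
    rw [le_div_iff₀ hκ, mul_comm, ← integral_const_mul]
    exact (integral_mono (hGi.const_mul κ) hHi fun x => hκle _).trans (hH.trans (le_abs_self M))
  have hnS : m * S ≤ normPow N s p W u := min_mul_le_normPow h.one_lt hW hu
  refine ⟨?_, hle.trans hG⟩
  have hSM : S ≤ M2 := by
    have : S ≤ |M| / κ / m := by
      rw [le_div_iff₀ hm0, mul_comm]; linarith
    linarith
  obtain ⟨hqi, hq1⟩ := hGN1 u hu.1
  have hq2 := (hGN2 u hu.1).2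
  have hGle : ∫ x, f (u x) * u x ≤ m / 2 * A + C * ∫ x, |u x| ^ q := by
    have i1 := (integrable_abs_rpow h.p_pos hu.1.1).const_mul (m / 2)
    have i2 := hqi.const_mul C
    rw [hA, ← integral_const_mul, ← integral_const_mul, ← integral_add i1 i2]
    exact integral_mono hGi (i1.add i2) fun x => hgr _
  have hAS : A ≤ S := by linarith
  have hmain : m / 2 * S ≤ C * ∫ x, |u x| ^ q := by nlinarith
  have hSe0 : 0 < S ^ e := by positivity
  -- lower bound for `S`
  have hSρ : ρ ≤ S := by
    have h1 : C * ∫ x, |u x| ^ q ≤ C * (S ^ e * (1 * S + C1 * S)) := by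
      refine mul_le_mul_of_nonneg_left (hq1.trans ?_) hC.le
      refine mul_le_mul_of_nonneg_left ?_ hSe0.le
      nlinarith
    have h2 : m / (2 * C * (1 + C1)) ≤ S ^ e := by
      rw [div_le_iff₀ (by positivity)]
      have h3 : m / 2 * S ≤ (C * S ^ e * (1 + C1)) * S := by linarith
      have := le_of_mul_le_mul_right h3 hS0
      linarith
    rw [hρ]
    have h4 := Real.rpow_le_rpow (by positivity) h2 (show 0 ≤ e⁻¹ by positivity)
    rwa [Real.rpow_rpow_inv hS0.le he0.ne'] at h4
  have hSeM : S ^ e ≤ M2 ^ e := Real.rpow_le_rpow hS0.le hSM he0.le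
  have hM2e : 0 < M2 ^ e := by positivity
  have h5 : C * ∫ x, |u x| ^ q ≤ C * (M2 ^ e * (m / (4 * C * M2 ^ e) * S + C2 * A)) := by
    refine mul_le_mul_of_nonneg_left (hq2.trans ?_) hC.le
    exact mul_le_mul_of_nonneg_right hSeM (by positivity)
  have h6 : C * (M2 ^ e * (m / (4 * C * M2 ^ e) * S + C2 * A)) =
      m / 4 * S + C * M2 ^ e * C2 * A := by
    field_simp
  rw [div_le_iff₀ (by positivity)]
  nlinarith

end Nehari

end

/-! ### Minimisers on the Nehari manifold are weak solutions -/

section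

variable {N : ℕ} {s p q : ℝ} {f : ℝ → ℝ}

/-- Mean value theorem for `F`, without an order between the end points. -/
theorem IsSubcriticalNonlinearity.exists_primitive_sub_eq (hf : IsSubcriticalNonlinearity N s p f)
    (x y : ℝ) : ∃ ξ ∈ Set.uIcc x y, primitive f y - primitive f x = f ξ * (y - x) := by
  have key : ∀ x y, x < y → ∃ ξ ∈ Set.Icc x y,
      primitive f y - primitive f x = f ξ * (y - x) := by
    intro x y hxy
    obtain ⟨ξ, hξ, he⟩ := exists_hasDerivAt_eq_slope (primitive f) f hxy
      hf.continuous_primitive.continuousOn fun t _ => hf.hasDerivAt_primitive t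
    refine ⟨ξ, Set.Ioo_subset_Icc_self hξ, ?_⟩
    rw [he, div_mul_cancel₀ _ (sub_pos.2 hxy).ne']
  rcases lt_trichotomy x y with h | h | h
  · rw [Set.uIcc_of_le h.le]; exact key x y h
  · exact ⟨x, Set.left_mem_uIcc, by simp [h]⟩
  · obtain ⟨ξ, hξ, he⟩ := key y x h
    rw [Set.uIcc_of_ge h.le]
    exact ⟨ξ, hξ, by linarith⟩

theorem abs_le_of_mem_uIcc {x y ξ g : ℝ} (hξ : ξ ∈ Set.uIcc x y) (hx : |x| ≤ g) (hy : |y| ≤ g) :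
    |ξ| ≤ g := by
  rw [abs_le] at *
  rw [Set.mem_uIcc] at hξ
  rcases hξ with h | h <;> constructor <;> linarith [h.1, h.2]

section

variable {W : Space N → ℝ} {w₀ : ℝ} {v φ : Space N → ℝ}

theorem IsSetting.integrable_twoPower_add (h : IsSetting N s p q f) {u : Space N → ℝ}
    (hv : MemSobolev N s p v) (hu : MemSobolev N s p u) (b : ℝ) :
    Integrable fun x => twoPower p q (b * (|v x| + |u x|)) := by
  have hb1 := h.integrable_twoPower (hv.const_mul h.one_lt b)
  have hb2 := h.integrable_twoPower (hu.const_mul h.one_lt b)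
  refine ((hb1.add hb2).const_mul (2 ^ q)).mono' ?_ (ae_of_all _ fun x => ?_)
  · have hm : AEMeasurable (fun x => b * (|v x| + |u x|)) volume :=
      (hv.1.1.aemeasurable.abs.add hu.1.1.aemeasurable.abs).const_mul b
    exact (continuous_twoPower h.p_pos h.q_pos).comp_aestronglyMeasurable hm.aestronglyMeasurable
  · rw [Real.norm_eq_abs, abs_of_nonneg (twoPower_nonneg _ _ _), mul_add]
    have e : ∀ a : ℝ, twoPower p q (b * |a|) = twoPower p q (b * a) := fun a => by
      unfold twoPower; rw [abs_mul, abs_mul, abs_abs]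
    have := twoPower_add_le h.p_pos h.p_lt (b * |v x|) (b * |u x|)
    rwa [e, e] at this

/-- Derivative of the `p`-th power of the norm, along sequences. -/
theorem tendsto_slope_normPow (hp : 1 < p) (hW : IsPotential W w₀)
    (hv : MemEnergySpace N s p W v) (hφ : MemEnergySpace N s p W φ) {σ : ℕ → ℝ}
    (hσ0 : ∀ n, 0 < σ n) (hσ1 : ∀ n, σ n ≤ 1) (hσ : Tendsto σ atTop (𝓝 0)) :
    Tendsto (fun n => (normPow N s p W (fun x => v x + σ n * φ x) - normPow N s p W v) / σ n)
      atTop (𝓝 (p * (energyDeriv N s p W f v φ + ∫ x, f (v x) * φ x))) := by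
  have hv' := (memEnergySpace_iff hp hW).1 hv
  have hφ' := (memEnergySpace_iff hp hW).1 hφ
  have t1 := tendsto_slope_integral_abs_rpow hp hv'.2.1 hφ'.2.1 hσ0 hσ1 hσ
  have t2 := tendsto_slope_integral_abs_rpow hp hv'.2.2 hφ'.2.2 hσ0 hσ1 hσ
  rw [energyDeriv_eq hp hW, sub_add_cancel, mul_add]
  refine (t1.add t2).congr fun n => ?_
  rw [normPow_eq hp hW, normPow_eq hp hW]
  simp only [diffQuotient_add, diffQuotient_const_mul, weighted_add, weighted_const_mul]
  ring

theorem tendsto_normPow_add (hp : 1 < p) (hW : IsPotential W w₀)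
    (hv : MemEnergySpace N s p W v) (hφ : MemEnergySpace N s p W φ) {σ : ℕ → ℝ}
    (hσ0 : ∀ n, 0 < σ n) (hσ1 : ∀ n, σ n ≤ 1) (hσ : Tendsto σ atTop (𝓝 0)) :
    Tendsto (fun n => normPow N s p W (fun x => v x + σ n * φ x)) atTop
      (𝓝 (normPow N s p W v)) := by
  have h1 := ((tendsto_slope_normPow (f := fun _ => 0) hp hW hv hφ hσ0 hσ1 hσ).mul hσ).add_const
    (normPow N s p W v)
  rw [mul_zero, zero_add] at h1
  refine h1.congr fun n => ?_
  rw [div_mul_cancel₀ _ (hσ0 n).ne', sub_add_cancel]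

/-- Joint continuity of `(t, σ) ↦ ⟨I'(t(v + σφ)), t(v + σφ)⟩` along sequences with `σ → 0`. -/
theorem IsSetting.tendsto_energyDeriv (h : IsSetting N s p q f) (hW : IsPotential W w₀)
    (hv : MemEnergySpace N s p W v) (hφ : MemEnergySpace N s p W φ) {σ t : ℕ → ℝ} {b t₀ : ℝ}
    (hσ0 : ∀ n, 0 < σ n) (hσ1 : ∀ n, σ n ≤ 1) (hσ : Tendsto σ atTop (𝓝 0))
    (ht : ∀ n, t n ∈ Set.Icc 0 b) (ht₀ : Tendsto t atTop (𝓝 t₀)) :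
    Tendsto (fun n => energyDeriv N s p W f (fun x => t n * (v x + σ n * φ x))
      (fun x => t n * (v x + σ n * φ x))) atTop
      (𝓝 (energyDeriv N s p W f (fun x => t₀ * v x) (fun x => t₀ * v x))) := by
  have ht₀0 : 0 ≤ t₀ := ge_of_tendsto' ht₀ fun n => (ht n).1
  rw [h.energyDeriv_const_mul hW ht₀0]
  have e := fun n => h.energyDeriv_const_mul hW (ht n).1 (fun x => v x + σ n * φ x)
  simp only [e]
  refine ((ht₀.rpow_const (Or.inr h.p_pos.le)).mul
    (tendsto_normPow_add h.one_lt hW hv hφ hσ0 hσ1 hσ)).sub ?_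
  refine h.tendsto_integral_comp h.isSubDensity_mul_self
    (w := fun n x => t n * (v x + σ n * φ x)) (g := fun x => b * (|v x| + |φ x|)) (fun n => ?_)
    (h.integrable_twoPower_add hv.1 hφ.1 b) (Eventually.of_forall fun n x => ?_)
    (ae_of_all _ fun x => ?_)
  · exact (hv.1.1.1.add (hφ.1.1.1.const_mul (σ n))).const_mul (t n)
  · have hb : 0 ≤ b := (ht n).1.trans (ht n).2
    rw [abs_mul, abs_mul, abs_of_nonneg (ht n).1, abs_of_nonneg hb,
      abs_of_nonneg (show 0 ≤ |v x| + |φ x| by positivity)]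
    refine mul_le_mul (ht n).2 ((abs_add_le _ _).trans (add_le_add_right ?_ _)) (abs_nonneg _) hb
    rw [abs_mul, abs_of_pos (hσ0 n)]
    exact mul_le_of_le_one_left (abs_nonneg _) (hσ1 n)
  · have := ht₀.mul ((hσ.mul_const (φ x)).const_add (v x))
    simpa using this

/-- On the ray through a point of the Nehari manifold the energy is maximal at that point. -/
theorem IsSetting.energy_const_mul_le (h : IsSetting N s p q f) (hW : IsPotential W w₀)
    (hv : v ∈ nehari N s p W f) {t : ℝ} (ht : 0 < t) :
    energy N s p W f (fun x => t * v x) ≤ energy N s p W f v := by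
  have hvS := hv.1.1
  have htS := hvS.const_mul h.one_lt t
  have i1 := h.integrable_comp h.isSubDensity_primitive hvS
  have i2 := h.integrable_comp h.isSubDensity_primitive htS
  have i3 := h.integrable_comp h.isSubDensity_mul_self hvS
  have hJ := hv.2.2
  rw [energyDeriv_self h.one_lt hW, sub_eq_zero] at hJ
  have h1 : (∫ x, primitive f (v x)) - ∫ x, primitive f (t * v x) ≤
      (1 - t ^ p) / p * normPow N s p W v := by
    rw [hJ, ← integral_const_mul, ← integral_sub i1 i2]
    exact integral_mono (i1.sub i2) (i3.const_mul _) fun x =>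
      h.nonlin.primitive_sub_mul_le h.one_lt ht _
  unfold energy
  rw [normPow_const_mul h.one_lt hW, abs_of_pos ht]
  have e : (1 - t ^ p) / p * normPow N s p W v =
    1 / p * normPow N s p W v - 1 / p * (t ^ p * normPow N s p W v) := by ring
  linarith

/-- If a ray meets the Nehari manifold at two points, then `f` is homogeneous of degree `p - 1`
along the ray: monotonicity of `f(t) / t^{p-1}` leaves no other possibility. -/
theorem IsSetting.ae_apply_mul_eq (h : IsSetting N s p q f) (hW : IsPotential W w₀)
    (hv : v ∈ nehari N s p W f) {t : ℝ} (ht : 0 < t)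
    (htv : energyDeriv N s p W f (fun x => t * v x) (fun x => t * v x) = 0) :
    ∀ᵐ x, f (t * v x) = t ^ (p - 1) * f (v x) := by
  have hvS := hv.1.1
  have i1 := h.integrable_comp h.isSubDensity_mul_self (hvS.const_mul h.one_lt t)
  have i2 := (h.integrable_comp h.isSubDensity_mul_self hvS).const_mul (t ^ p)
  have hJ := hv.2.2
  rw [energyDeriv_self h.one_lt hW, sub_eq_zero] at hJ
  rw [h.energyDeriv_const_mul hW ht.le, sub_eq_zero, hJ, ← integral_const_mul] at htv
  have htp : 0 < t ^ (p - 1) := by positivity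
  -- pointwise comparison on the ray
  have hcmp : ∀ {a b : ℝ}, 0 < a → a ≤ b → ∀ r, 0 < r →
      f (a * r) / a ^ (p - 1) ≤ f (b * r) / b ^ (p - 1) := by
    intro a b ha hab r hr
    have hb := ha.trans_le hab
    have h1 := h.nonlin.div_rpow_le (mul_pos ha hr) (mul_le_mul_of_nonneg_right hab hr.le)
    rw [Real.mul_rpow ha.le hr.le, Real.mul_rpow hb.le hr.le, ← div_div, ← div_div] at h1
    exact (div_le_div_iff_of_pos_right (by positivity)).1 h1
  have heq : ∀ᵐ x, f (t * v x) * (t * v x) = t ^ p * (f (v x) * v x) := by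
    have e : ∀ r : ℝ, t ^ p * (f r * r) = t ^ (p - 1) * f r * (t * r) := fun r => by
      rw [← rpow_mul_eq ht]; ring
    rcases le_total t 1 with h1 | h1
    · have hle : ∀ x, f (t * v x) * (t * v x) ≤ t ^ p * (f (v x) * v x) := by
        intro x
        rcases le_or_gt (v x) 0 with hx | hx
        · simp [h.nonlin.apply_of_nonpos hx,
            h.nonlin.apply_of_nonpos (mul_nonpos_of_nonneg_of_nonpos ht.le hx)]
        · have := hcmp ht h1 _ hx
          rw [Real.one_rpow, one_mul, div_one, div_le_iff₀ htp] at this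
          rw [e]
          exact mul_le_mul_of_nonneg_right (by linarith) (by positivity)
      exact (integral_eq_iff_of_ae_le i1 i2 (ae_of_all _ hle)).1 htv.symm
    · have hle : ∀ x, t ^ p * (f (v x) * v x) ≤ f (t * v x) * (t * v x) := by
        intro x
        rcases le_or_gt (v x) 0 with hx | hx
        · simp [h.nonlin.apply_of_nonpos hx,
            h.nonlin.apply_of_nonpos (mul_nonpos_of_nonneg_of_nonpos ht.le hx)]
        · have := hcmp one_pos h1 _ hx
          rw [Real.one_rpow, one_mul, div_one, le_div_iff₀ htp] at this
          rw [e]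
          exact mul_le_mul_of_nonneg_right (by linarith) (by positivity)
      filter_upwards [(integral_eq_iff_of_ae_le i2 i1 (ae_of_all _ hle)).1 htv] with x hx
      exact hx.symm
  filter_upwards [heq] with x hx
  rcases le_or_gt (v x) 0 with h0 | h0
  · simp [h.nonlin.apply_of_nonpos h0,
      h.nonlin.apply_of_nonpos (mul_nonpos_of_nonneg_of_nonpos ht.le h0)]
  · rw [← rpow_mul_eq ht,
      show t ^ (p - 1) * t * (f (v x) * v x) = t ^ (p - 1) * f (v x) * (t * v x) by ring] at hx
    exact mul_right_cancel₀ (mul_pos ht h0).ne' hx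

/-- Limit of the difference quotients of `∫ F(t(v + σφ))` in `σ`, with `t` converging. -/
theorem IsSetting.tendsto_slope_integral_primitive (h : IsSetting N s p q f)
    (hv : MemSobolev N s p v) (hφ : MemSobolev N s p φ) {σ t : ℕ → ℝ} {b t₀ : ℝ}
    (hσ0 : ∀ n, 0 < σ n) (hσ1 : ∀ n, σ n ≤ 1) (hσ : Tendsto σ atTop (𝓝 0))
    (ht : ∀ n, t n ∈ Set.Icc 0 b) (ht₀ : Tendsto t atTop (𝓝 t₀)) :
    Tendsto (fun n => ((∫ x, primitive f (t n * (v x + σ n * φ x))) -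
      ∫ x, primitive f (t n * v x)) / σ n) atTop (𝓝 (t₀ * ∫ x, f (t₀ * v x) * φ x)) := by
  have hp := h.one_lt
  have hS : ∀ n, MemSobolev N s p (fun x => t n * (v x + σ n * φ x)) := fun n => by
    have hW1 := isPotential_const (N := N) one_pos
    exact (((hv.memEnergySpace_const hp 1).add hp hW1
      ((hφ.memEnergySpace_const hp 1).const_mul hp hW1 (σ n))).const_mul hp hW1 (t n)).1
  have i1 := fun n => h.integrable_comp h.isSubDensity_primitive (hS n)
  have i2 := fun n => h.integrable_comp h.isSubDensity_primitive (hv.const_mul hp (t n))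
  have e : ∀ n, ((∫ x, primitive f (t n * (v x + σ n * φ x))) -
      ∫ x, primitive f (t n * v x)) / σ n =
      ∫ x, (primitive f (t n * (v x + σ n * φ x)) - primitive f (t n * v x)) / σ n := fun n => by
    rw [integral_div, integral_sub (i1 n) (i2 n)]
  simp only [e]
  rw [← integral_const_mul]
  have hξ := fun n x => h.nonlin.exists_primitive_sub_eq (t n * v x) (t n * (v x + σ n * φ x))
  choose ξ hξm hξe using hξ
  have hquot : ∀ n x, (primitive f (t n * (v x + σ n * φ x)) - primitive f (t n * v x)) / σ n =
      f (ξ n x) * (t n * φ x) := fun n x => by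
    rw [hξe]
    have := (hσ0 n).ne'
    field_simp
    ring
  obtain ⟨C, hC, hgr⟩ := h.nonlin.growth hp h.p_lt h.subcritical one_pos
  have hb : 0 ≤ b := (ht 0).1.trans (ht 0).2
  have hbnd : ∀ n x, |ξ n x| ≤ b * (|v x| + |φ x|) := by
    intro n x
    refine abs_le_of_mem_uIcc (hξm n x) ?_ ?_
    · rw [abs_mul, abs_of_nonneg (ht n).1]
      exact mul_le_mul (ht n).2 (by linarith [abs_nonneg (φ x)]) (abs_nonneg _) hb
    · rw [abs_mul, abs_of_nonneg (ht n).1]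
      refine mul_le_mul (ht n).2 ((abs_add_le _ _).trans (add_le_add_right ?_ _))
        (abs_nonneg _) hb
      rw [abs_mul, abs_of_pos (hσ0 n)]
      exact mul_le_of_le_one_left (abs_nonneg _) (hσ1 n)
  refine tendsto_integral_of_dominated_convergence
    (fun x => (1 + C) * twoPower p q (b * (|v x| + |φ x|)))
    (fun n => (((i1 n).sub (i2 n)).div_const _).aestronglyMeasurable)
    ((h.integrable_twoPower_add hv hφ b).const_mul _) (fun n => ae_of_all _ fun x => ?_)
    (ae_of_all _ fun x => ?_)
  · rw [hquot, Real.norm_eq_abs, abs_mul, abs_of_nonneg (h.nonlin.nonneg hp _), abs_mul,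
      abs_of_nonneg (ht n).1]
    set g := b * (|v x| + |φ x|) with hg
    have hg0 : 0 ≤ g := by positivity
    have h1 : t n * |φ x| ≤ |g| := by
      rw [abs_of_nonneg hg0]
      exact mul_le_mul (ht n).2 (by linarith [abs_nonneg (v x)]) (abs_nonneg _) hb
    have hξg : |ξ n x| ≤ |g| := (hbnd n x).trans (le_abs_self _)
    have h2 : f (ξ n x) ≤ 1 * |g| ^ (p - 1) + C * |g| ^ (q - 1) := by
      refine (hgr _).trans (add_le_add ?_ ?_)
      · exact mul_le_mul_of_nonneg_left
          (Real.rpow_le_rpow (abs_nonneg _) hξg (by linarith)) zero_le_one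
      · exact mul_le_mul_of_nonneg_left
          (Real.rpow_le_rpow (abs_nonneg _) hξg (by linarith [h.p_lt])) hC.le
    refine (mul_le_mul h2 h1 (mul_nonneg (ht n).1 (abs_nonneg _)) (by positivity)).trans ?_
    rw [add_mul, mul_assoc, mul_assoc, abs_rpow_sub_one_mul h.p_pos.ne',
      abs_rpow_sub_one_mul h.q_pos.ne']
    have n1 : 0 ≤ |g| ^ p := by positivity
    have n2 : 0 ≤ |g| ^ q := by positivity
    unfold twoPower
    nlinarith
  · simp only [hquot]
    have l1 : Tendsto (fun n => t n * v x) atTop (𝓝 (t₀ * v x)) := ht₀.mul_const _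
    have l2 : Tendsto (fun n => t n * (v x + σ n * φ x)) atTop (𝓝 (t₀ * v x)) := by
      have := ht₀.mul ((hσ.mul_const (φ x)).const_add (v x))
      simpa using this
    have l3 : Tendsto (fun n => ξ n x) atTop (𝓝 (t₀ * v x)) := by
      have m1 := l1.min l2
      have m2 := l1.max l2
      rw [min_self] at m1
      rw [max_self] at m2
      exact tendsto_of_tendsto_of_tendsto_of_le_of_le m1 m2 (fun n => (hξm n x).1)
        fun n => (hξm n x).2
    have := ((h.nonlin.continuous.tendsto _).comp l3).mul (ht₀.mul_const (φ x))
    refine this.trans_eq ?_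
    congr 1; ring

/-- Nonpositive functions other than `0` satisfy `⟨I'(v), v⟩ = ‖v‖^p > 0`. -/
theorem IsSetting.not_ae_nonpos_of_energyDeriv_nonpos (h : IsSetting N s p q f)
    (hW : IsPotential W w₀) (hv : MemEnergySpace N s p W v) (hne : ¬ v =ᵐ[volume] 0)
    (hle : energyDeriv N s p W f v v ≤ 0) : ¬ ∀ᵐ x, v x ≤ 0 := by
  intro hae
  rw [energyDeriv_self h.one_lt hW] at hle
  have h0 : ∫ x, f (v x) * v x = 0 := by
    rw [← integral_zero (Space N) ℝ]
    refine integral_congr_ae ?_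
    filter_upwards [hae] with x hx
    rw [h.nonlin.apply_of_nonpos hx, zero_mul]
  linarith [normPow_pos h.one_lt hW hv hne]

/-- One-sided Euler–Lagrange inequality for a minimiser of the energy on the Nehari manifold. The
functional need not be twice differentiable and `f(t) / t^{p-1}` need not be strictly increasing,
so the projection of `v + σφ` to the Nehari manifold may be neither unique nor smooth. Any choice
`t(v + σφ)` of it satisfies `I(t(v + σφ)) ≥ I(v) ≥ I(tv)`; dividing by `σ` and letting `σ → 0` along
a sequence with `t → t₀` gives `⟨I'(t₀ v), φ⟩ ≥ 0`, and `f(t₀ v) = t₀^{p-1} f(v)`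
turns this into `⟨I'(v), φ⟩ ≥ 0`. -/
theorem IsSetting.energyDeriv_nonneg_of_minimal (h : IsSetting N s p q f) (hW : IsPotential W w₀)
    (hv : v ∈ nehari N s p W f)
    (hmin : ∀ w ∈ nehari N s p W f, energy N s p W f v ≤ energy N s p W f w)
    (hφ : MemEnergySpace N s p W φ) : 0 ≤ energyDeriv N s p W f v φ := by
  have hp := h.one_lt
  have hvE := hv.1
  obtain ⟨a, ha0, ha1, ha⟩ := h.exists_energyDeriv_pos hW hvE hv.2.1 one_pos
  obtain ⟨b, hb1, hb⟩ := h.exists_energyDeriv_neg hW hvE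
    (h.not_ae_nonpos_of_energyDeriv_nonpos hW hvE hv.2.1 hv.2.2.le)
  have hb0 : 0 < b := by linarith
  set σ : ℕ → ℝ := fun n => 1 / ((n : ℝ) + 1) with hσd
  have hσ0 : ∀ n, 0 < σ n := fun n => by positivity
  have hσ1 : ∀ n, σ n ≤ 1 := fun n => by
    rw [hσd, div_le_one (by positivity)]
    linarith [(Nat.cast_nonneg n : (0 : ℝ) ≤ n)]
  have hσ : Tendsto σ atTop (𝓝 0) := tendsto_one_div_add_atTop_nhds_zero_nat
  have hwE : ∀ r, MemEnergySpace N s p W (fun x => v x + r * φ x) := fun r =>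
    hvE.add hp hW (hφ.const_mul hp hW r)
  have la := h.tendsto_energyDeriv hW hvE hφ (t := fun _ => a) (b := b) hσ0 hσ1 hσ
    (fun _ => ⟨ha0.le, by linarith⟩) tendsto_const_nhds
  have lb := h.tendsto_energyDeriv hW hvE hφ (t := fun _ => b) (b := b) hσ0 hσ1 hσ
    (fun _ => ⟨hb0.le, le_rfl⟩) tendsto_const_nhds
  obtain ⟨n₀, hn₀⟩ := eventually_atTop.1
    ((la.eventually (lt_mem_nhds ha)).and (lb.eventually (gt_mem_nhds hb)))
  -- the rays through `v + σφ` meet the Nehari manifold at parameters in `[a, b]`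
  have hex : ∀ n, ∃ t ∈ Set.Icc a b,
      (fun x => t * (v x + σ (n + n₀) * φ x)) ∈ nehari N s p W f := by
    intro n
    obtain ⟨h1, h2⟩ := hn₀ (n + n₀) (Nat.le_add_left _ _)
    have hc := (h.continuousOn_energyDeriv_const_mul hW (hwE (σ (n + n₀))).1 b).mono
      (Set.Icc_subset_Icc_left ha0.le)
    obtain ⟨t, ht, ht0⟩ := intermediate_value_Icc' (show a ≤ b by linarith) hc ⟨h2.le, h1.le⟩
    refine ⟨t, ht, (hwE _).const_mul hp hW t, fun hz => ?_, ht0⟩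
    have hz' := ae_eq_zero_of_const_mul (ha0.trans_le ht.1).ne' hz
    rw [h.energyDeriv_const_mul hW hb0.le] at h2
    have h3 : ∫ x, f (b * (v x + σ (n + n₀) * φ x)) * (b * (v x + σ (n + n₀) * φ x)) = 0 := by
      rw [← integral_zero (Space N) ℝ]
      refine integral_congr_ae ?_
      filter_upwards [hz'] with x hx
      have hx' : v x + σ (n + n₀) * φ x = 0 := hx
      rw [hx', mul_zero, mul_zero]
    rw [h3, sub_zero] at h2
    have h4 : 0 ≤ b ^ p * normPow N s p W (fun x => v x + σ (n + n₀) * φ x) :=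
      mul_nonneg (by positivity) (normPow_nonneg hp hW)
    linarith
  choose t ht htN using hex
  obtain ⟨t₀, ht₀, ψ, hψ, hlim⟩ := (isCompact_Icc (a := a) (b := b)).tendsto_subseq ht
  set τ : ℕ → ℝ := fun n => t (ψ n) with hτ
  set ς : ℕ → ℝ := fun n => σ (ψ n + n₀) with hς
  have hς0 : ∀ n, 0 < ς n := fun n => hσ0 _
  have hς1 : ∀ n, ς n ≤ 1 := fun n => hσ1 _
  have hςl : Tendsto ς atTop (𝓝 0) :=
    hσ.comp (tendsto_atTop_mono (fun n => Nat.le_add_right (ψ n) n₀) hψ.tendsto_atTop)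
  have hτm : ∀ n, τ n ∈ Set.Icc 0 b := fun n => ⟨ha0.le.trans (ht _).1, (ht _).2⟩
  have ht₀pos : 0 < t₀ := ha0.trans_le ht₀.1
  -- `t₀ v` also lies on the Nehari manifold; `t₀` need not be `1`
  have hJ0 : energyDeriv N s p W f (fun x => t₀ * v x) (fun x => t₀ * v x) = 0 := by
    have l := h.tendsto_energyDeriv hW hvE hφ hς0 hς1 hςl hτm hlim
    refine tendsto_nhds_unique l (tendsto_const_nhds.congr fun n => ?_)
    exact (htN (ψ n)).2.2.symm
  -- divide `I(t(v + σφ)) - I(tv) ≥ 0` by `σ`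
  have l1 := tendsto_slope_normPow (f := f) hp hW hvE hφ hς0 hς1 hςl
  have l2 := h.tendsto_slope_integral_primitive hvE.1 hφ.1 hς0 hς1 hςl hτm hlim
  have l3 := (((hlim.rpow_const (p := p) (Or.inr h.p_pos.le)).mul l1).const_mul (1 / p)).sub l2
  have hge := ge_of_tendsto' (b := 0) l3 fun n => by
    have k1 := (h.energy_const_mul_le hW hv (ha0.trans_le (ht (ψ n)).1)).trans
      (hmin _ (htN (ψ n)))
    unfold energy at k1
    rw [normPow_const_mul hp hW, normPow_const_mul hp hW, abs_of_nonneg (hτm n).1] at k1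
    have k2 : 1 / p * (τ n ^ p * ((normPow N s p W (fun x => v x + ς n * φ x) -
        normPow N s p W v) / ς n)) - ((∫ x, primitive f (τ n * (v x + ς n * φ x))) -
        ∫ x, primitive f (τ n * v x)) / ς n =
        ((1 / p * (τ n ^ p * normPow N s p W (fun x => v x + ς n * φ x)) -
          ∫ x, primitive f (τ n * (v x + ς n * φ x))) -
        (1 / p * (τ n ^ p * normPow N s p W v) - ∫ x, primitive f (τ n * v x))) / ς n := by
      ring
    refine le_of_le_of_eq (div_nonneg (sub_nonneg.2 k1) (hς0 n).le) k2.symm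
  have hae := h.ae_apply_mul_eq hW hv ht₀pos hJ0
  have hI : ∫ x, f (t₀ * v x) * φ x = t₀ ^ (p - 1) * ∫ x, f (v x) * φ x := by
    rw [← integral_const_mul]
    refine integral_congr_ae ?_
    filter_upwards [hae] with x hx
    rw [hx, mul_assoc]
  have htp : 0 < t₀ ^ p := by positivity
  have hp0 := h.p_pos.ne'
  have e : t₀ * (t₀ ^ (p - 1) * ∫ x, f (v x) * φ x) = t₀ ^ p * ∫ x, f (v x) * φ x := by
    rw [← rpow_mul_eq ht₀pos p]; ring
  rw [hI, e] at hge
  have e2 : 1 / p * (t₀ ^ p * (p * (energyDeriv N s p W f v φ + ∫ x, f (v x) * φ x))) -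
      t₀ ^ p * ∫ x, f (v x) * φ x = t₀ ^ p * energyDeriv N s p W f v φ := by
    field_simp; ring
  rw [e2] at hge
  exact (mul_nonneg_iff_of_pos_left htp).1 hge

/-- A minimiser of the energy on the Nehari manifold is a weak solution. -/
theorem IsSetting.energyDeriv_eq_zero_of_minimal (h : IsSetting N s p q f)
    (hW : IsPotential W w₀) (hv : v ∈ nehari N s p W f)
    (hmin : ∀ w ∈ nehari N s p W f, energy N s p W f v ≤ energy N s p W f w)
    (hφ : MemEnergySpace N s p W φ) : energyDeriv N s p W f v φ = 0 := by
  refine le_antisymm ?_ (h.energyDeriv_nonneg_of_minimal hW hv hmin hφ)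
  have h1 := h.energyDeriv_nonneg_of_minimal hW hv hmin (hφ.const_mul h.one_lt hW (-1))
  have e : energyDeriv N s p W f v (fun x => -1 * φ x) = - energyDeriv N s p W f v φ := by
    rw [energyDeriv_eq h.one_lt hW, energyDeriv_eq h.one_lt hW]
    simp only [diffQuotient_const_mul, weighted_const_mul]
    simp only [neg_mul, one_mul, mul_neg, integral_neg]
    ring
  linarith

end

end

/-! ### The strong maximum principle -/

section

variable {N : ℕ} {s p q : ℝ} {f : ℝ → ℝ}

/-- Fatou's lemma for real integrals of nonnegative functions. -/
theorem integrable_of_tendsto_of_integral_tendsto {α : Type*} [MeasurableSpace α] {μ : Measure α}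
    {g : ℕ → α → ℝ} {g₀ : α → ℝ} (hg : ∀ n, Integrable (g n) μ) (hg0 : ∀ n, ∀ᵐ x ∂μ, 0 ≤ g n x)
    {M : ℝ} (hM : Tendsto (fun n => ∫ x, g n x ∂μ) atTop (𝓝 M))
    (hlim : ∀ᵐ x ∂μ, Tendsto (fun n => g n x) atTop (𝓝 (g₀ x))) :
    Integrable g₀ μ ∧ ∫ x, g₀ x ∂μ ≤ M := by
  have hm : AEStronglyMeasurable g₀ μ :=
    aestronglyMeasurable_of_tendsto_ae atTop (fun n => (hg n).1) hlim
  have h0 : ∀ᵐ x ∂μ, 0 ≤ g₀ x := by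
    filter_upwards [hlim, ae_all_iff.2 hg0] with x hx hx0
    exact ge_of_tendsto' hx hx0
  have hM0 : 0 ≤ M := ge_of_tendsto' hM fun n => integral_nonneg_of_ae (hg0 n)
  have hle : ∫⁻ x, ENNReal.ofReal (g₀ x) ∂μ ≤ ENNReal.ofReal M := by
    calc ∫⁻ x, ENNReal.ofReal (g₀ x) ∂μ
        = ∫⁻ x, liminf (fun n => ENNReal.ofReal (g n x)) atTop ∂μ := by
          refine lintegral_congr_ae ?_
          filter_upwards [hlim] with x hx
          exact ((ENNReal.continuous_ofReal.tendsto _).comp hx).liminf_eq.symm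
      _ ≤ liminf (fun n => ∫⁻ x, ENNReal.ofReal (g n x) ∂μ) atTop :=
          lintegral_liminf_le' fun n => (hg n).1.aemeasurable.ennreal_ofReal
      _ = ENNReal.ofReal M := by
          refine Tendsto.liminf_eq (((ENNReal.continuous_ofReal.tendsto _).comp hM).congr
            fun n => ?_)
          exact ofReal_integral_eq_lintegral_ofReal (hg n) (hg0 n)
  have hint : Integrable g₀ μ := by
    refine ⟨hm, ?_⟩
    rw [hasFiniteIntegral_iff_ofReal h0]
    exact hle.trans_lt ENNReal.ofReal_lt_top
  refine ⟨hint, ?_⟩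
  rw [← ofReal_integral_eq_lintegral_ofReal hint h0] at hle
  exact (ENNReal.ofReal_le_ofReal_iff hM0).1 hle

/-- The profile `max(0, 1 - (k + 1) |t|)`, decreasing to the indicator of `{0}`. -/
def zeroProfile (k : ℕ) (t : ℝ) : ℝ := max 0 (1 - ((k : ℝ) + 1) * |t|)

theorem zeroProfile_nonneg (k : ℕ) (t : ℝ) : 0 ≤ zeroProfile k t := le_max_left _ _

theorem zeroProfile_le_one (k : ℕ) (t : ℝ) : zeroProfile k t ≤ 1 :=
  max_le zero_le_one (sub_le_self _ (by positivity))

theorem continuous_zeroProfile (k : ℕ) : Continuous (zeroProfile k) := by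
  unfold zeroProfile; fun_prop

theorem zeroProfile_anti (k : ℕ) {a b : ℝ} (ha : 0 ≤ a) (hab : a ≤ b) :
    zeroProfile k b ≤ zeroProfile k a := by
  unfold zeroProfile
  rw [abs_of_nonneg ha, abs_of_nonneg (ha.trans hab)]
  exact max_le_max le_rfl (sub_le_sub_left (mul_le_mul_of_nonneg_left hab (by positivity)) _)

theorem abs_zeroProfile_sub_le (k : ℕ) (a b : ℝ) :
    |zeroProfile k a - zeroProfile k b| ≤ ((k : ℝ) + 1) * |a - b| := by
  unfold zeroProfile
  refine (abs_max_sub_max_le_max _ _ _ _).trans (max_le (by simp; positivity) ?_)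
  rw [sub_sub_sub_cancel_left, ← mul_sub, abs_mul,
    abs_of_nonneg (show (0 : ℝ) ≤ k + 1 by positivity), abs_sub_comm a b]
  exact mul_le_mul_of_nonneg_left (abs_abs_sub_abs_le _ _) (by positivity)

theorem zeroProfile_zero (k : ℕ) : zeroProfile k 0 = 1 := by simp [zeroProfile]

theorem tendsto_zeroProfile (t : ℝ) :
    Tendsto (fun k => zeroProfile k t) atTop (𝓝 (if t = 0 then 1 else 0)) := by
  split_ifs with h
  · simp [h, zeroProfile_zero]
  · refine tendsto_const_nhds.congr' ?_
    have h1 : Tendsto (fun k : ℕ => ((k : ℝ) + 1) * |t|) atTop atTop :=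
      (tendsto_atTop_add_const_right _ _ tendsto_natCast_atTop_atTop).atTop_mul_const
        (abs_pos.2 h)
    filter_upwards [h1.eventually_ge_atTop 1] with k hk
    exact (max_eq_left (by linarith)).symm

section

variable {W : Space N → ℝ} {w₀ : ℝ} {v : Space N → ℝ}

theorem ae_prod_of_ae {P : Space N → Prop} (h : ∀ᵐ x, P x) :
    ∀ᵐ z : Space N × Space N, P z.1 ∧ P z.2 :=
  (Measure.quasiMeasurePreserving_fst.ae h).and (Measure.quasiMeasurePreserving_snd.ae h)

theorem memEnergySpace_mul_zeroProfile (hp : 1 < p) (hW : IsPotential W w₀)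
    {η : Space N → ℝ} (hη : IsCutoff η) (hηE : MemEnergySpace N s p W η)
    (hv : MemEnergySpace N s p W v) (k : ℕ) :
    MemEnergySpace N s p W (fun x => η x * zeroProfile k (v x)) := by
  have hp0 : 0 < p := by linarith
  rw [memEnergySpace_iff hp hW] at *
  have hm : AEStronglyMeasurable (fun x => η x * zeroProfile k (v x)) volume :=
    hη.continuous.aestronglyMeasurable.mul
      ((continuous_zeroProfile k).comp_aestronglyMeasurable hv.1.1)
  have hle : ∀ x, |η x * zeroProfile k (v x)| ≤ |η x| := fun x => by
    rw [abs_mul, abs_of_nonneg (zeroProfile_nonneg k (v x))]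
    exact mul_le_of_le_one_right (abs_nonneg _) (zeroProfile_le_one _ _)
  refine ⟨hηE.1.mono hm (ae_of_all _ hle), ?_, ?_⟩
  · refine MemLp.mono' ((hv.2.1.abs.const_mul ((k : ℝ) + 1)).add hηE.2.1.abs)
      (aestronglyMeasurable_diffQuotient hm) (ae_of_all _ fun z => ?_)
    rw [IsCutoff.diffQuotient_mul]
    rw [Real.norm_eq_abs]
    refine (abs_add_le _ _).trans (add_le_add ?_ ?_)
    · rw [abs_mul, abs_of_nonneg (hη.nonneg _)]
      refine (mul_le_of_le_one_left (abs_nonneg _) (hη.le_one _)).trans ?_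
      change |diffQuotient N s p (fun x => zeroProfile k (v x)) z| ≤
        ((k : ℝ) + 1) * |diffQuotient N s p v z|
      unfold diffQuotient
      rw [abs_div, abs_div, mul_div_assoc']
      exact div_le_div_of_nonneg_right (abs_zeroProfile_sub_le _ _ _) (abs_nonneg _)
    · rw [abs_mul, abs_of_nonneg (zeroProfile_nonneg _ _)]
      exact mul_le_of_le_one_left (abs_nonneg _) (zeroProfile_le_one _ _)
  · refine hηE.2.2.mono (aestronglyMeasurable_weighted hp0 hW hm) (ae_of_all _ fun x => ?_)
    change |W x ^ (1 / p) * (η x * zeroProfile k (v x))| ≤ |W x ^ (1 / p) * η x|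
    rw [abs_mul (W x ^ (1 / p)) (η x), abs_mul (W x ^ (1 / p))]
    exact mul_le_mul_of_nonneg_left (hle x) (abs_nonneg _)

/-- For `v ≥ 0` the nonlocal pairing of `v` with `η ψ(v)`, `ψ` nonincreasing with values in
`[0, 1]`, is bounded above by a function independent of `ψ`. -/
theorem pairing_mul_zeroProfile_le (hp : 1 < p) (η : Space N → ℝ)
    (hη0 : ∀ x, 0 ≤ η x) (k : ℕ) (z : Space N × Space N)
    (h1 : 0 ≤ v z.1) (h2 : 0 ≤ v z.2) :
    |diffQuotient N s p v z| ^ (p - 2) * diffQuotient N s p v z *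
      diffQuotient N s p (fun x => η x * zeroProfile k (v x)) z ≤
    |diffQuotient N s p v z| ^ (p - 1) * |diffQuotient N s p η z| := by
  have hk : 0 ≤ ‖z.1 - z.2‖ ^ (((N : ℝ) + s * p) / p) := by positivity
  rw [← abs_abs_rpow_sub_two_mul hp]
  have n1 := zeroProfile_nonneg k (v z.1)
  have n2 := zeroProfile_nonneg k (v z.2)
  have m1 := zeroProfile_le_one k (v z.1)
  have m2 := zeroProfile_le_one k (v z.2)
  have hA : 0 ≤ |diffQuotient N s p v z| ^ (p - 2) := by positivity
  have ha := abs_nonneg (η z.1 - η z.2)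
  rcases le_total (v z.2) (v z.1) with h | h
  · have hD : 0 ≤ diffQuotient N s p v z := div_nonneg (sub_nonneg.2 h) hk
    rw [abs_of_nonneg (mul_nonneg hA hD)]
    refine mul_le_mul_of_nonneg_left ?_ (mul_nonneg hA hD)
    unfold diffQuotient
    rw [abs_div, abs_of_nonneg hk]
    refine div_le_div_of_nonneg_right ?_ hk
    have hmono := zeroProfile_anti k h2 h
    have h3 : η z.1 * zeroProfile k (v z.1) - η z.2 * zeroProfile k (v z.2) ≤
        (η z.1 - η z.2) * zeroProfile k (v z.2) := by
      nlinarith [mul_le_mul_of_nonneg_left hmono (hη0 z.1)]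
    have h4 := mul_le_mul_of_nonneg_right (le_abs_self (η z.1 - η z.2)) n2
    nlinarith
  · have hD : diffQuotient N s p v z ≤ 0 :=
      div_nonpos_of_nonpos_of_nonneg (sub_nonpos.2 h) hk
    have hAD : |diffQuotient N s p v z| ^ (p - 2) * diffQuotient N s p v z ≤ 0 :=
      mul_nonpos_of_nonneg_of_nonpos hA hD
    rw [abs_of_nonpos hAD]
    have key : -|diffQuotient N s p η z| ≤
        diffQuotient N s p (fun x => η x * zeroProfile k (v x)) z := by
      unfold diffQuotient
      rw [abs_div, abs_of_nonneg hk, ← neg_div]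
      refine div_le_div_of_nonneg_right ?_ hk
      have hmono := zeroProfile_anti k h1 h
      have h3 : (η z.1 - η z.2) * zeroProfile k (v z.1) ≤
          η z.1 * zeroProfile k (v z.1) - η z.2 * zeroProfile k (v z.2) := by
        nlinarith [mul_le_mul_of_nonneg_left hmono (hη0 z.2)]
      have h4 := mul_le_mul_of_nonneg_right (neg_abs_le (η z.1 - η z.2)) n1
      nlinarith
    nlinarith

/-- Strong maximum principle: a nonnegative nonzero weak solution is positive almost everywhere.
Testing with `η ψ_k(v)`, where `ψ_k(v)` decreases to the indicator of `{v = 0}`, and letting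
`k → ∞` leaves only the interaction of `{v = 0}` with `{v > 0}`, which has a sign. -/
theorem IsSetting.ae_pos_of_weak_solution (h : IsSetting N s p q f) (hW : IsPotential W w₀)
    (hv : MemEnergySpace N s p W v) (hv0 : ∀ᵐ x, 0 ≤ v x) (hne : ¬ v =ᵐ[volume] 0)
    (hweak : ∀ φ, MemEnergySpace N s p W φ → energyDeriv N s p W f v φ = 0) :
    ∀ᵐ x, 0 < v x := by
  have hp := h.one_lt
  have hv' := (memEnergySpace_iff hp hW).1 hv
  have hz0 := ae_prod_of_ae hv0
  suffices hn : ∀ n : ℕ, ∀ᵐ x, ‖x‖ < (n : ℝ) + 1 → 0 < v x by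
    filter_upwards [ae_all_iff.2 hn] with x hx
    obtain ⟨n, hn⟩ := exists_nat_gt ‖x‖
    exact hx n (by linarith)
  intro n
  set η := tent N n with hη
  have hηc : IsCutoff η := isCutoff_tent n
  have hηE : MemEnergySpace N s p W η := h.memEnergySpace_tent hW n
  have hη' := (memEnergySpace_iff hp hW).1 hηE
  set φ : ℕ → Space N → ℝ := fun k x => η x * zeroProfile k (v x) with hφ
  have hφE : ∀ k, MemEnergySpace N s p W (φ k) := fun k =>
    memEnergySpace_mul_zeroProfile hp hW hηc hηE hv k
  have hφη : ∀ k x, |φ k x| ≤ |η x| := fun k x => by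
    simp only [hφ]
    rw [abs_mul, abs_of_nonneg (zeroProfile_nonneg k (v x))]
    exact mul_le_of_le_one_right (abs_nonneg _) (zeroProfile_le_one _ _)
  set φ₀ : Space N → ℝ := fun x => η x * (if v x = 0 then 1 else 0) with hφ₀
  have hφlim : ∀ x, Tendsto (fun k => φ k x) atTop (𝓝 (φ₀ x)) := fun x =>
    (tendsto_zeroProfile (v x)).const_mul (η x)
  set T : ℕ → Space N × Space N → ℝ := fun k z =>
    |diffQuotient N s p v z| ^ (p - 2) * diffQuotient N s p v z * diffQuotient N s p (φ k) z
  set T₀ : Space N × Space N → ℝ := fun z =>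
    |diffQuotient N s p v z| ^ (p - 2) * diffQuotient N s p v z * diffQuotient N s p φ₀ z with hT₀
  set B : Space N × Space N → ℝ := fun z =>
    |diffQuotient N s p v z| ^ (p - 1) * |diffQuotient N s p η z|
  have hTint : ∀ k, Integrable (T k) := fun k =>
    integrable_abs_rpow_sub_two_mul_mul hp hv'.2.1 ((memEnergySpace_iff hp hW).1 (hφE k)).2.1
  have hBint : Integrable B := by
    have := (integrable_abs_rpow_sub_two_mul_mul hp hv'.2.1 hη'.2.1).abs
    refine this.congr (ae_of_all _ fun z => ?_)
    simp only [abs_mul, B]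
    rw [← abs_abs_rpow_sub_two_mul hp, abs_mul]
  have hTlim : ∀ z, Tendsto (fun k => T k z) atTop (𝓝 (T₀ z)) := fun z => by
    refine Tendsto.const_mul _ ?_
    unfold diffQuotient
    exact ((hφlim z.1).sub (hφlim z.2)).div_const _
  -- the local terms tend to zero, since `φ_k → η 1_{v = 0}`
  have hloc1 : Tendsto (fun k => ∫ x, |weighted p W v x| ^ (p - 2) * weighted p W v x *
      weighted p W (φ k) x) atTop (𝓝 (∫ _ : Space N, (0 : ℝ))) := by
    refine tendsto_integral_of_dominated_convergence
      (fun x => |(|weighted p W v x| ^ (p - 2) * weighted p W v x * weighted p W η x)|)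
      (fun k => (integrable_abs_rpow_sub_two_mul_mul hp hv'.2.2
        ((memEnergySpace_iff hp hW).1 (hφE k)).2.2).aestronglyMeasurable)
      (integrable_abs_rpow_sub_two_mul_mul hp hv'.2.2 hη'.2.2).abs
      (fun k => ae_of_all _ fun x => ?_) (ae_of_all _ fun x => ?_)
    · have h1 : |weighted p W (φ k) x| ≤ |weighted p W η x| := by
        change |W x ^ (1 / p) * φ k x| ≤ |W x ^ (1 / p) * η x|
        rw [abs_mul (W x ^ (1 / p)) (φ k x), abs_mul (W x ^ (1 / p)) (η x)]
        exact mul_le_mul_of_nonneg_left (hφη k x) (abs_nonneg _)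
      rw [Real.norm_eq_abs, abs_mul _ (weighted p W (φ k) x), abs_mul _ (weighted p W η x)]
      exact mul_le_mul_of_nonneg_left h1 (abs_nonneg _)
    · have h1 := ((hφlim x).const_mul (W x ^ (1 / p))).const_mul
        (|weighted p W v x| ^ (p - 2) * weighted p W v x)
      refine h1.trans_eq ?_
      by_cases hx : v x = 0
      · simp [weighted, hx]
      · simp [hφ₀, hx]
  have hloc2 : Tendsto (fun k => ∫ x, f (v x) * φ k x) atTop (𝓝 (∫ _ : Space N, (0 : ℝ))) := by
    refine tendsto_integral_of_dominated_convergence (fun x => |f (v x) * η x|)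
      (fun k => (h.integrable_mul hv.1 (hφE k).1).aestronglyMeasurable)
      (h.integrable_mul hv.1 hηE.1).abs
      (fun k => ae_of_all _ fun x => ?_) (ae_of_all _ fun x => ?_)
    · rw [Real.norm_eq_abs, abs_mul (f (v x)) (φ k x), abs_mul (f (v x)) (η x)]
      exact mul_le_mul_of_nonneg_left (hφη k x) (abs_nonneg _)
    · refine ((hφlim x).const_mul (f (v x))).trans_eq ?_
      by_cases hx : v x = 0
      · simp [hx, h.nonlin.map_zero]
      · simp [hφ₀, hx]
  rw [integral_zero] at hloc1 hloc2
  have hTI : Tendsto (fun k => ∫ z, T k z) atTop (𝓝 0) := by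
    have h1 := hloc2.sub hloc1
    rw [sub_zero] at h1
    refine h1.congr fun k => ?_
    have h2 := hweak _ (hφE k)
    rw [energyDeriv_eq hp hW] at h2
    change (∫ z, T k z) + _ - _ = 0 at h2
    linarith
  have hBT : Tendsto (fun k => ∫ z, (B z - T k z)) atTop (𝓝 (∫ z, B z)) := by
    have h1 := hTI.const_sub (∫ z, B z)
    rw [sub_zero] at h1
    exact h1.congr fun k => (integral_sub hBint (hTint k)).symm
  -- Fatou's lemma for `B - T k ≥ 0`
  obtain ⟨hi, hle⟩ := integrable_of_tendsto_of_integral_tendsto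
    (fun k => hBint.sub (hTint k)) (fun k => by
      filter_upwards [hz0] with z hz
      exact sub_nonneg.2 (pairing_mul_zeroProfile_le hp η hηc.nonneg k z hz.1 hz.2)) hBT
    (ae_of_all _ fun z => (hTlim z).const_sub (B z))
  have hT₀int : Integrable T₀ := by
    refine (hBint.sub hi).congr (ae_of_all _ fun z => ?_)
    simp
  rw [integral_sub hBint hT₀int] at hle
  -- `T₀` is nonpositive, as `φ₀` is supported where `v` attains its minimum `0`
  have hT₀le : ∀ᵐ z, T₀ z ≤ 0 := by
    filter_upwards [hz0] with z hz
    have hk : 0 ≤ ‖z.1 - z.2‖ ^ (((N : ℝ) + s * p) / p) := by positivity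
    have hA : 0 ≤ |diffQuotient N s p v z| ^ (p - 2) := by positivity
    rcases le_total (v z.2) (v z.1) with h1 | h1
    · have hD : 0 ≤ diffQuotient N s p v z := div_nonneg (sub_nonneg.2 h1) hk
      rcases h1.eq_or_lt with h2 | h2
      · have : diffQuotient N s p v z = 0 := by unfold diffQuotient; rw [h2, sub_self, zero_div]
        simp [hT₀, this]
      · have h3 : v z.1 ≠ 0 := (hz.2.trans_lt h2).ne'
        refine mul_nonpos_of_nonneg_of_nonpos (mul_nonneg hA hD) ?_
        refine div_nonpos_of_nonpos_of_nonneg ?_ hk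
        have := hηc.nonneg z.2
        simp only [hφ₀, h3, if_false, mul_zero, zero_sub]
        split_ifs <;> simp [this]
    · have hD : diffQuotient N s p v z ≤ 0 :=
        div_nonpos_of_nonpos_of_nonneg (sub_nonpos.2 h1) hk
      rcases h1.eq_or_lt with h2 | h2
      · have : diffQuotient N s p v z = 0 := by unfold diffQuotient; rw [h2, sub_self, zero_div]
        simp [hT₀, this]
      · have h3 : v z.2 ≠ 0 := (hz.1.trans_lt h2).ne'
        refine mul_nonpos_of_nonpos_of_nonneg (mul_nonpos_of_nonneg_of_nonpos hA hD) ?_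
        refine div_nonneg ?_ hk
        have := hηc.nonneg z.1
        simp only [hφ₀, h3, if_false, mul_zero, sub_zero]
        split_ifs <;> simp [this]
  have hT₀z : T₀ =ᵐ[volume] 0 := by
    have h1 : ∫ z, -T₀ z = 0 := by
      refine le_antisymm ?_ (integral_nonneg_of_ae ?_)
      · rw [integral_neg]; linarith
      · filter_upwards [hT₀le] with z hz
        simpa using hz
    have h2 := (integral_eq_zero_iff_of_nonneg_ae (f := fun z => -T₀ z) (by
      filter_upwards [hT₀le] with z hz
      simpa using hz) hT₀int.neg).1 h1
    filter_upwards [h2] with z hz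
    simpa using hz
  -- the zero set of `v` in the ball does not interact with `{v > 0}`
  have hprod : (volume : Measure (Space N × Space N))
      ({x | v x = 0 ∧ ‖x‖ < (n : ℝ) + 1} ×ˢ {y | 0 < v y}) = 0 := by
    refine measure_mono_null ?_ hT₀z
    rintro z ⟨⟨h1, h2⟩, h3⟩
    have h3' : 0 < v z.2 := h3
    have hη1 : 0 < η z.1 := tent_pos n h2
    have hne' : z.1 ≠ z.2 := fun he => by rw [he] at h1; exact h3'.ne' h1
    have hk : 0 < ‖z.1 - z.2‖ ^ (((N : ℝ) + s * p) / p) :=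
      Real.rpow_pos_of_pos (norm_pos_iff.2 (sub_ne_zero.2 hne')) _
    have hD : diffQuotient N s p v z ≠ 0 := by
      unfold diffQuotient
      rw [h1, zero_sub]
      exact div_ne_zero (neg_ne_zero.2 h3'.ne') hk.ne'
    have hDφ : diffQuotient N s p φ₀ z ≠ 0 := by
      unfold diffQuotient
      simp only [hφ₀, h1, if_true, h3'.ne', if_false, mul_one, mul_zero, sub_zero]
      exact div_ne_zero hη1.ne' hk.ne'
    have : T₀ z ≠ 0 := mul_ne_zero (mul_ne_zero
      (Real.rpow_pos_of_pos (abs_pos.2 hD) _).ne' hD) hDφ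
    exact this
  rw [Measure.volume_eq_prod, Measure.prod_prod, mul_eq_zero] at hprod
  rcases hprod with h1 | h1
  · have h2 : ∀ᵐ x, ¬ (v x = 0 ∧ ‖x‖ < (n : ℝ) + 1) := by
      rw [ae_iff]; simpa using h1
    filter_upwards [h2, hv0] with x hx hx0 hxn
    exact lt_of_le_of_ne hx0 fun he => hx ⟨he.symm, hxn⟩
  · exfalso
    refine hne ?_
    have h2 : ∀ᵐ x, ¬ 0 < v x := by
      rw [ae_iff]; simpa using h1
    filter_upwards [h2, hv0] with x hx hx0
    exact le_antisymm (not_lt.1 hx) hx0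

end

end

/-! ### Existence of minimisers -/

section

variable {N : ℕ} {s p q : ℝ} {f : ℝ → ℝ}

section

variable {W : Space N → ℝ} {w₀ : ℝ}

theorem normPow_sub_le (hp : 1 < p) (hW : IsPotential W w₀) {u v : Space N → ℝ}
    (hu : MemEnergySpace N s p W u) (hv : MemEnergySpace N s p W v) :
    normPow N s p W (fun x => u x - v x) ≤
      2 ^ p * (normPow N s p W u + normPow N s p W v) := by
  have hp0 : 0 < p := by linarith
  have hd := (memEnergySpace_iff hp hW).1 (hu.sub hp hW hv)
  rw [memEnergySpace_iff hp hW] at hu hv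
  have key : ∀ {α : Type} [MeasurableSpace α] {μ : Measure α} {a b : α → ℝ},
      MemLp a (ENNReal.ofReal p) μ → MemLp b (ENNReal.ofReal p) μ →
      ∫ x, |a x - b x| ^ p ∂μ ≤ 2 ^ p * (∫ x, |a x| ^ p ∂μ + ∫ x, |b x| ^ p ∂μ) := by
    intro α _ μ a b ha hb
    rw [← integral_add (integrable_abs_rpow hp0 ha) (integrable_abs_rpow hp0 hb),
      ← integral_const_mul]
    refine integral_mono (integrable_abs_rpow hp0 (ha.sub hb))
      (((integrable_abs_rpow hp0 ha).add (integrable_abs_rpow hp0 hb)).const_mul _) fun x => ?_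
    have := abs_add_rpow_le hp0.le (a x) (-b x)
    rwa [abs_neg, ← sub_eq_add_neg] at this
  simp only [normPow_eq hp hW, diffQuotient_sub, weighted_sub]
  linarith [key hu.2.1 hv.2.1, key hu.2.2 hv.2.2]

/-- Norm balls of the energy space are closed under almost everywhere convergence. -/
theorem memEnergySpace_of_tendsto (hp : 1 < p) (hW : IsPotential W w₀) {w : ℕ → Space N → ℝ}
    {u : Space N → ℝ} (hw : ∀ n, MemEnergySpace N s p W (w n)) {K : ℝ}
    (hK : ∀ n, normPow N s p W (w n) ≤ K)
    (hlim : ∀ᵐ x, Tendsto (fun n => w n x) atTop (𝓝 (u x))) : MemEnergySpace N s p W u := by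
  have hw' := fun n => (memEnergySpace_iff hp hW).1 (hw n)
  have hA : ∀ n, ∫ x, |w n x| ^ p ≤ K / w₀ := fun n => by
    rw [le_div_iff₀ hW.pos, mul_comm]
    linarith [hK n, le_normPow hp hW (hw n), integral_gagliardo_nonneg (s := s) (p := p) (w n)]
  have hB : ∀ n, (∫ z, |diffQuotient N s p (w n) z| ^ p) ≤ K ∧
      ∫ x, |weighted p W (w n) x| ^ p ≤ K := fun n => by
    have h1 := hK n
    rw [normPow_eq hp hW] at h1
    have h2 := integral_abs_rpow_nonneg (p := p) (μ := volume) (diffQuotient N s p (w n))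
    have h3 := integral_abs_rpow_nonneg (p := p) (μ := volume) (weighted p W (w n))
    exact ⟨by linarith, by linarith⟩
  refine (memEnergySpace_iff hp hW).2
    ⟨(memLp_of_tendsto_of_integral_le hp (fun n => (hw' n).1) hA hlim).1,
      (memLp_of_tendsto_of_integral_le hp (fun n => (hw' n).2.1) (fun n => (hB n).1) ?_).1,
      (memLp_of_tendsto_of_integral_le hp (fun n => (hw' n).2.2) (fun n => (hB n).2) ?_).1⟩
  · filter_upwards [ae_prod_of_ae hlim] with z hz
    exact (hz.1.sub hz.2).div_const _
  · filter_upwards [hlim] with x hx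
    exact hx.const_mul _

/-- Brezis–Lieb splitting of the `p`-th power of the norm. -/
theorem tendsto_normPow_sub (hp : 1 < p) (hW : IsPotential W w₀) {w : ℕ → Space N → ℝ}
    {u : Space N → ℝ} (hw : ∀ n, MemEnergySpace N s p W (w n)) (hu : MemEnergySpace N s p W u)
    {K : ℝ} (hK : ∀ n, normPow N s p W (w n) ≤ K)
    (hlim : ∀ᵐ x, Tendsto (fun n => w n x) atTop (𝓝 (u x))) :
    Tendsto (fun n => normPow N s p W (w n) - normPow N s p W (fun x => w n x - u x)) atTop
      (𝓝 (normPow N s p W u)) := by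
  have hp0 : 0 < p := by linarith
  have hw' := fun n => (memEnergySpace_iff hp hW).1 (hw n)
  have hu' := (memEnergySpace_iff hp hW).1 hu
  have hBd : ∀ n, normPow N s p W (fun x => w n x - u x) ≤
      2 ^ p * (K + normPow N s p W u) := fun n =>
    (normPow_sub_le hp hW (hw n) hu).trans (mul_le_mul_of_nonneg_left
      (by linarith [hK n]) (by positivity))
  set M := 2 ^ p * (K + normPow N s p W u)
  have hBd' : ∀ n, (∫ z, |diffQuotient N s p (w n) z - diffQuotient N s p u z| ^ p) ≤ M ∧
      ∫ x, |weighted p W (w n) x - weighted p W u x| ^ p ≤ M := fun n => by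
    have h1 := hBd n
    simp only [normPow_eq hp hW, diffQuotient_sub, weighted_sub] at h1
    have h2 := integral_abs_rpow_nonneg (p := p) (μ := volume)
      (fun z => diffQuotient N s p (w n) z - diffQuotient N s p u z)
    have h3 := integral_abs_rpow_nonneg (p := p) (μ := volume)
      (fun x => weighted p W (w n) x - weighted p W u x)
    exact ⟨by linarith, by linarith⟩
  have hz : |(0 : ℝ)| ^ p = 0 := by rw [abs_zero, Real.zero_rpow hp0.ne']
  have hc := continuous_abs_rpow hp0
  have h1 := tendsto_integral_sub_of_brezisLieb hc (fun t => by positivity) hz hc hz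
    (brezisLiebCondition_rpow hp) (fun n => (hw' n).2.1.1) hu'.2.1.1
    (by
      filter_upwards [ae_prod_of_ae hlim] with z hz
      exact (hz.1.sub hz.2).div_const _)
    (fun n => integrable_abs_rpow hp0 (hw' n).2.1)
    (fun n => integrable_abs_rpow hp0 ((hw' n).2.1.sub hu'.2.1))
    (integrable_abs_rpow hp0 hu'.2.1) (fun n => (hBd' n).1)
  have h2 := tendsto_integral_sub_of_brezisLieb hc (fun t => by positivity) hz hc hz
    (brezisLiebCondition_rpow hp) (fun n => (hw' n).2.2.1) hu'.2.2.1
    (by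
      filter_upwards [hlim] with x hx
      exact hx.const_mul _)
    (fun n => integrable_abs_rpow hp0 (hw' n).2.2)
    (fun n => integrable_abs_rpow hp0 ((hw' n).2.2.sub hu'.2.2))
    (integrable_abs_rpow hp0 hu'.2.2) (fun n => (hBd' n).2)
  rw [normPow_eq hp hW]
  refine (h1.add h2).congr fun n => ?_
  simp only [normPow_eq hp hW, diffQuotient_sub, weighted_sub]
  ring

theorem IsSetting.exists_integral_twoPower_le (h : IsSetting N s p q f) (hW : IsPotential W w₀)
    (K : ℝ) : ∃ B, ∀ u, MemEnergySpace N s p W u → normPow N s p W u ≤ K →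
      ∫ x, twoPower p q (u x) ≤ B := by
  obtain ⟨C, hC, hGN⟩ := exists_integral_rpow_le h.s_pos h.one_lt h.lt_dim h.p_lt h.q_lt one_pos
  have hm : 0 < min 1 w₀ := lt_min one_pos hW.pos
  set S₀ := K / min 1 w₀
  refine ⟨S₀ + S₀ ^ ((q - p) / p) * (1 * S₀ + C * S₀), fun u hu hK => ?_⟩
  have hS : (∫ z, gagliardoIntegrand N s p u z) + ∫ x, |u x| ^ p ≤ S₀ := by
    rw [le_div_iff₀ hm, mul_comm]
    exact (min_mul_le_normPow h.one_lt hW hu).trans hK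
  have h1 := integral_gagliardo_nonneg (s := s) (p := p) u
  have h2 := integral_abs_rpow_nonneg (p := p) (μ := volume) u
  have h3 : ∫ x, |u x| ^ p ≤ S₀ := by linarith
  have he : 0 ≤ (q - p) / p := div_nonneg (by linarith [h.p_lt]) h.p_pos.le
  obtain ⟨h4, h5⟩ := hGN u hu.1
  unfold twoPower
  rw [integral_add (integrable_abs_rpow h.p_pos hu.1.1) h4]
  refine add_le_add h3 (h5.trans ?_)
  have h6 := Real.rpow_le_rpow (by linarith) hS he
  have h7 : 0 ≤ (∫ z, gagliardoIntegrand N s p u z) + ∫ x, |u x| ^ p := by linarith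
  exact mul_le_mul h6 (by nlinarith) (by positivity)
    (Real.rpow_nonneg (h7.trans hS) _)

/-- Brezis–Lieb splitting of the nonlinear terms. -/
theorem IsSetting.tendsto_integral_comp_sub (h : IsSetting N s p q f) (hW : IsPotential W w₀)
    {j : ℝ → ℝ} (hj : IsSubDensity f j) {w : ℕ → Space N → ℝ}
    {u : Space N → ℝ} (hw : ∀ n, MemEnergySpace N s p W (w n)) (hu : MemEnergySpace N s p W u)
    {K : ℝ} (hK : ∀ n, normPow N s p W (w n) ≤ K)
    (hlim : ∀ᵐ x, Tendsto (fun n => w n x) atTop (𝓝 (u x))) :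
    Tendsto (fun n => (∫ x, j (w n x)) - ∫ x, j (w n x - u x)) atTop (𝓝 (∫ x, j (u x))) := by
  have hp := h.one_lt
  obtain ⟨B, hB⟩ := h.exists_integral_twoPower_le hW (2 ^ p * (K + normPow N s p W u))
  have hj0 : j 0 = 0 := le_antisymm (by simpa using hj.le 0) (hj.nonneg 0)
  have hz : twoPower p q 0 = 0 := by
    unfold twoPower
    rw [abs_zero, Real.zero_rpow h.p_pos.ne', Real.zero_rpow h.q_pos.ne', add_zero]
  refine tendsto_integral_sub_of_brezisLieb (continuous_twoPower h.p_pos h.q_pos)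
    (twoPower_nonneg p q) hz hj.continuous hj0
    (h.nonlin.brezisLiebCondition hp h.p_lt h.subcritical hj.continuous hj.nonneg hj.le)
    (fun n => (hw n).1.1.1) hu.1.1.1 hlim (fun n => h.integrable_twoPower (hw n).1)
    (fun n => h.integrable_twoPower ((hw n).sub hp hW hu).1) (h.integrable_twoPower hu.1)
    (fun n => hB _ ((hw n).sub hp hW hu) ((normPow_sub_le hp hW (hw n) hu).trans
      (mul_le_mul_of_nonneg_left (by linarith [hK n]) (by positivity))))

theorem IsSetting.energyDeriv_pos_part_le (h : IsSetting N s p q f) (hW : IsPotential W w₀)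
    {u : Space N → ℝ} (hu : MemEnergySpace N s p W u) :
    energyDeriv N s p W f (fun x => max (u x) 0) (fun x => max (u x) 0) ≤
      energyDeriv N s p W f u u := by
  rw [energyDeriv_self h.one_lt hW, energyDeriv_self h.one_lt hW]
  have e : ∀ x, f (max (u x) 0) * max (u x) 0 = f (u x) * u x := fun x => by
    rcases le_total (u x) 0 with hx | hx
    · rw [max_eq_right hx, h.nonlin.apply_of_nonpos hx]; simp
    · rw [max_eq_left hx]
  simp only [e]
  linarith [(hu.pos_part h.one_lt hW).2]

theorem IsSubcriticalNonlinearity.nehariDensity_max_zero (hf : IsSubcriticalNonlinearity N s p f)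
    (t : ℝ) : nehariDensity p f (max t 0) = nehariDensity p f t := by
  rcases le_total t 0 with ht | ht
  · rw [max_eq_right ht, hf.nehariDensity_of_nonpos ht, hf.nehariDensity_of_nonpos le_rfl]
  · rw [max_eq_left ht]

/-- A nonzero function with `⟨I'(u), u⟩ ≤ 0` has a nonzero positive part. -/
theorem IsSetting.pos_part_ne_zero (h : IsSetting N s p q f) (hW : IsPotential W w₀)
    {u : Space N → ℝ} (hu : MemEnergySpace N s p W u) (hne : ¬ u =ᵐ[volume] 0)
    (hle : energyDeriv N s p W f u u ≤ 0) : ¬ (fun x => max (u x) 0) =ᵐ[volume] 0 := by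
  intro h0
  refine h.not_ae_nonpos_of_energyDeriv_nonpos hW hu hne hle ?_
  filter_upwards [h0] with x hx
  exact (le_max_left _ _).trans hx.le

/-- A minimising sequence for the ground state level made of nonnegative functions, which need
only satisfy `⟨I'(w), w⟩ ≤ 0`. -/
theorem IsSetting.exists_minimizing_seq (h : IsSetting N s p q f) (hW : IsPotential W w₀) :
    ∃ w : ℕ → Space N → ℝ, (∀ n, MemEnergySpace N s p W (w n)) ∧ (∀ n x, 0 ≤ w n x) ∧
      (∀ n, ¬ w n =ᵐ[volume] 0) ∧ (∀ n, energyDeriv N s p W f (w n) (w n) ≤ 0) ∧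
      Tendsto (fun n => ∫ x, nehariDensity p f (w n x)) atTop (𝓝 (groundLevel N s p W f)) := by
  obtain ⟨a, -, ha, hmem⟩ := exists_seq_tendsto_sInf ((h.nehari_nonempty hW).image _)
    (h.bddBelow hW)
  choose u hu hue using hmem
  refine ⟨fun n x => max (u n x) 0, fun n => ((hu n).1.pos_part h.one_lt hW).1,
    fun n x => le_max_right _ _, fun n => h.pos_part_ne_zero hW (hu n).1 (hu n).2.1 (hu n).2.2.le,
    fun n => (h.energyDeriv_pos_part_le hW (hu n).1).trans (hu n).2.2.le, ?_⟩
  refine ha.congr fun n => ?_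
  rw [← hue, h.energy_eq_of_mem_nehari hW (hu n)]
  simp only [h.nonlin.nehariDensity_max_zero]

theorem sub_setIntegral_le_integral_mul (hp : 1 < p) (hW : IsPotential W w₀) {μ' R : ℝ}
    (hR : {x | W x < μ'} ⊆ Metric.ball 0 R) {u : Space N → ℝ}
    (hu : MemEnergySpace N s p W u) :
    μ' * (∫ x, |u x| ^ p) - μ' * (∫ x in Metric.ball 0 R, |u x| ^ p) ≤ ∫ x, W x * |u x| ^ p := by
  have hi := (integrable_abs_rpow (by linarith : 0 < p) hu.1.1).const_mul μ'
  rw [← integral_const_mul, ← integral_const_mul, ← integral_indicator measurableSet_ball,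
    ← integral_sub hi (hi.indicator measurableSet_ball)]
  refine integral_mono (hi.sub (hi.indicator measurableSet_ball)) hu.2 fun x => ?_
  have hnn : 0 ≤ |u x| ^ p := by positivity
  by_cases hx : x ∈ Metric.ball (0 : Space N) R
  · simp only [Set.indicator_of_mem hx, sub_self]
    exact mul_nonneg (hW.nonneg x) hnn
  · simp only [Set.indicator_of_notMem hx, sub_zero]
    exact mul_le_mul_of_nonneg_right (not_lt.1 fun hc => hx (hR hc)) hnn

/-- If the potential is at least `μ' > μ` outside a ball and the ground state level lies below
that of the constant potential `μ`, minimising sequences do not vanish locally. -/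
theorem IsSetting.groundLevel_const_le_of_vanishing (h : IsSetting N s p q f)
    (hW : IsPotential W w₀) {μ μ' R : ℝ} (hμ : 0 < μ) (hμμ' : μ < μ')
    (hR : {x | W x < μ'} ⊆ Metric.ball 0 R)
    {w : ℕ → Space N → ℝ} (hw : ∀ n, MemEnergySpace N s p W (w n))
    (hne : ∀ n, ¬ w n =ᵐ[volume] 0) (hle : ∀ n, energyDeriv N s p W f (w n) (w n) ≤ 0)
    {c δ : ℝ} (hc : Tendsto (fun n => ∫ x, nehariDensity p f (w n x)) atTop (𝓝 c))
    (hδ : 0 < δ) (hδw : ∀ n, δ ≤ ∫ x, |w n x| ^ p)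
    (hvan : Tendsto (fun n => ∫ x in Metric.ball 0 R, |w n x| ^ p) atTop (𝓝 0)) :
    groundLevel N s p (fun _ => μ) f ≤ c := by
  have hp := h.one_lt
  have hκ := isPotential_const (N := N) hμ
  have h1 := hvan.const_mul μ'
  rw [mul_zero] at h1
  have hpos : 0 < (μ' - μ) * δ := mul_pos (by linarith) hδ
  refine ge_of_tendsto hc ?_
  filter_upwards [h1.eventually_le_const hpos] with n hn
  refine h.groundLevel_le_integral hκ ((hw n).1.memEnergySpace_const hp μ) (hne n)
    (le_trans ?_ (hle n))
  rw [energyDeriv_self hp hκ, energyDeriv_self hp hW]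
  have h2 := sub_setIntegral_le_integral_mul hp hW hR (hw n)
  have h3 := mul_le_mul_of_nonneg_left (hδw n) (by linarith : 0 ≤ μ' - μ)
  unfold normPow
  rw [integral_const_mul]
  linarith

/-- Existence of a nonnegative minimiser on the Nehari manifold, when the ground state level lies
below that of a constant potential which the given one exceeds near infinity. -/
theorem IsSetting.exists_minimizer (h : IsSetting N s p q f) (hW : IsPotential W w₀)
    {μ μ' R : ℝ} (hμ : 0 < μ) (hμμ' : μ < μ') (hR : {x | W x < μ'} ⊆ Metric.ball 0 R)
    (hlt : groundLevel N s p W f < groundLevel N s p (fun _ => μ) f) :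
    ∃ v ∈ nehari N s p W f, (∀ᵐ x, 0 ≤ v x) ∧ energy N s p W f v = groundLevel N s p W f := by
  have hp := h.one_lt
  obtain ⟨w, hw, hw0, hwne, hwJ, hwc⟩ := h.exists_minimizing_seq hW
  obtain ⟨M, hM⟩ := hwc.bddAbove_range
  obtain ⟨δ, hδ, K, hbd⟩ := h.exists_lower_bound hW.pos M
  have hbd' := fun n => hbd W (w n) hW (hw n) (hwne n) (hwJ n) (hM ⟨n, rfl⟩)
  have hS : ∀ n, (∫ z, gagliardoIntegrand N s p (w n) z) ≤ K / min 1 w₀ ∧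
      ∫ x, |w n x| ^ p ≤ K / min 1 w₀ := fun n => by
    have h1 : (∫ z, gagliardoIntegrand N s p (w n) z) + ∫ x, |w n x| ^ p ≤ K / min 1 w₀ := by
      rw [le_div_iff₀ (lt_min one_pos hW.pos), mul_comm]
      exact (min_mul_le_normPow hp hW (hw n)).trans (hbd' n).2
    have h2 := integral_gagliardo_nonneg (s := s) (p := p) (w n)
    have h3 := integral_abs_rpow_nonneg (p := p) (μ := volume) (w n)
    exact ⟨by linarith, by linarith⟩
  obtain ⟨φ, u, hφ, hlim, hloc⟩ := exists_subseq_tendsto h.s_pos hp h.dim_ne_zero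
    (fun n => (hw n).1) (fun n => (hS n).1) (fun n => (hS n).2)
  have hc : Tendsto (fun n => ∫ x, nehariDensity p f (w (φ n) x)) atTop
    (𝓝 (groundLevel N s p W f)) := hwc.comp hφ.tendsto_atTop
  have hu0 : ∀ᵐ x, 0 ≤ u x := by
    filter_upwards [hlim] with x hx
    exact ge_of_tendsto' hx fun n => hw0 _ _
  have hune : ¬ u =ᵐ[volume] 0 := by
    intro hz
    refine hlt.not_ge (h.groundLevel_const_le_of_vanishing hW hμ hμμ' hR (fun n => hw (φ n))
      (fun n => hwne _) (fun n => hwJ _) hc hδ (fun n => (hbd' _).1) ?_)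
    refine (hloc R).congr fun n => ?_
    refine setIntegral_congr_ae measurableSet_ball ?_
    filter_upwards [hz] with x hx _
    rw [hx, Pi.zero_apply, sub_zero]
  have hu : MemEnergySpace N s p W u :=
    memEnergySpace_of_tendsto hp hW (fun n => hw (φ n)) (fun n => (hbd' (φ n)).2) hlim
  have hH := h.tendsto_integral_comp_sub hW h.isSubDensity_nehariDensity (fun n => hw (φ n)) hu
    (fun n => (hbd' (φ n)).2) hlim
  have hJ : Tendsto (fun n => energyDeriv N s p W f (w (φ n)) (w (φ n)) -
      energyDeriv N s p W f (fun x => w (φ n) x - u x) (fun x => w (φ n) x - u x)) atTop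
      (𝓝 (energyDeriv N s p W f u u)) := by
    have h1 := tendsto_normPow_sub hp hW (fun n => hw (φ n)) hu (fun n => (hbd' (φ n)).2) hlim
    have h2 := h.tendsto_integral_comp_sub hW h.isSubDensity_mul_self (fun n => hw (φ n)) hu
      (fun n => (hbd' (φ n)).2) hlim
    rw [energyDeriv_self hp hW]
    refine (h1.sub h2).congr fun n => ?_
    rw [energyDeriv_self hp hW, energyDeriv_self hp hW]
    ring
  have hrest : Tendsto (fun n => ∫ x, nehariDensity p f (w (φ n) x - u x)) atTop
      (𝓝 (groundLevel N s p W f - ∫ x, nehariDensity p f (u x))) :=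
    (hc.sub hH).congr fun n => by ring
  -- otherwise the remainders `w - u` would be admissible, and `u` would carry no energy
  have huJ : energyDeriv N s p W f u u ≤ 0 := by
    by_contra hpos
    rw [not_le] at hpos
    have h1 : groundLevel N s p W f ≤
        groundLevel N s p W f - ∫ x, nehariDensity p f (u x) := by
      refine ge_of_tendsto hrest ?_
      filter_upwards [hJ.eventually_const_lt hpos] with n hn
      have h2 := hwJ (φ n)
      have hneg : energyDeriv N s p W f (fun x => w (φ n) x - u x)
        (fun x => w (φ n) x - u x) < 0 := by linarith
      refine h.groundLevel_le_integral hW ((hw (φ n)).sub hp hW hu) (fun hz => ?_) hneg.le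
      have h3 : ∫ x, f (w (φ n) x - u x) * (w (φ n) x - u x) = 0 :=
        integral_eq_zero_of_ae (by
          filter_upwards [hz] with x hx
          simp only [Pi.zero_apply] at hx ⊢
          rw [hx, mul_zero])
      rw [energyDeriv_self hp hW, h3, sub_zero] at hneg
      exact hneg.not_ge (normPow_nonneg hp hW)
    have h2 := ae_nonpos_of_integral_comp_le h h.isSubDensity_nehariDensity
      (fun t ht => h.nonlin.nehariDensity_pos hp ht) hu.1 (by linarith)
    refine hune ?_
    filter_upwards [h2, hu0] with x hx hx0
    exact le_antisymm hx hx0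
  obtain ⟨t, ht0, -, htm, hte⟩ := h.exists_mem_nehari_energy_le hW hu hune huJ
  refine ⟨_, htm, ?_, le_antisymm (hte.trans ?_) (h.groundLevel_le hW htm)⟩
  · filter_upwards [hu0] with x hx
    exact mul_nonneg ht0.le hx
  -- the remainders carry nonnegative energy density, so `u` does not exceed the level
  · exact sub_nonneg.1 (ge_of_tendsto' hrest fun n => h.integral_nehariDensity_nonneg)

end

end

/-! ### Ground state solutions -/

section

variable {N : ℕ} {s p q : ℝ} {f : ℝ → ℝ}

section

variable {W : Space N → ℝ} {w₀ : ℝ}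

theorem gagliardoIntegrand_ae_congr {u v : Space N → ℝ} (huv : u =ᵐ[volume] v) :
    gagliardoIntegrand N s p u =ᵐ[volume] gagliardoIntegrand N s p v := by
  filter_upwards [ae_prod_of_ae huv] with z hz
  unfold gagliardoIntegrand
  rw [hz.1, hz.2]

theorem MemEnergySpace.congr {u v : Space N → ℝ} (hu : MemEnergySpace N s p W u)
    (huv : u =ᵐ[volume] v) : MemEnergySpace N s p W v := by
  refine ⟨⟨hu.1.1.ae_eq huv, hu.1.2.congr (gagliardoIntegrand_ae_congr huv)⟩, hu.2.congr ?_⟩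
  filter_upwards [huv] with x hx
  rw [hx]

theorem energy_congr {u v : Space N → ℝ} (huv : u =ᵐ[volume] v) :
    energy N s p W f u = energy N s p W f v := by
  have h1 : ∫ x, W x * |u x| ^ p = ∫ x, W x * |v x| ^ p := integral_congr_ae (by
    filter_upwards [huv] with x hx
    rw [hx])
  have h2 : ∫ x, primitive f (u x) = ∫ x, primitive f (v x) := integral_congr_ae (by
    filter_upwards [huv] with x hx
    rw [hx])
  unfold energy normPow
  rw [integral_congr_ae (gagliardoIntegrand_ae_congr huv), h1, h2]

theorem energyDeriv_congr {u v φ ψ : Space N → ℝ} (huv : u =ᵐ[volume] v)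
    (hφψ : φ =ᵐ[volume] ψ) : energyDeriv N s p W f u φ = energyDeriv N s p W f v ψ := by
  have h1 : ∫ x, W x * (|u x| ^ (p - 2) * u x) * φ x =
      ∫ x, W x * (|v x| ^ (p - 2) * v x) * ψ x := integral_congr_ae (by
    filter_upwards [huv, hφψ] with x hx hx'
    rw [hx, hx'])
  have h2 : ∫ x, f (u x) * φ x = ∫ x, f (v x) * ψ x := integral_congr_ae (by
    filter_upwards [huv, hφψ] with x hx hx'
    rw [hx, hx'])
  unfold energyDeriv
  rw [h1, h2]
  congr 2
  refine integral_congr_ae ?_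
  filter_upwards [ae_prod_of_ae huv, ae_prod_of_ae hφψ] with z hz hz'
  rw [hz.1, hz.2, hz'.1, hz'.2]

/-- A nonnegative minimiser on the Nehari manifold is, up to a null set, a ground state
solution. -/
theorem IsSetting.exists_groundState_of_minimizer (h : IsSetting N s p q f)
    (hW : IsPotential W w₀) {v : Space N → ℝ} (hv : v ∈ nehari N s p W f)
    (hv0 : ∀ᵐ x, 0 ≤ v x) (hve : energy N s p W f v = groundLevel N s p W f) :
    ∃ u, IsGroundStateSolution N s p W f u := by
  have hmin : ∀ w ∈ nehari N s p W f, energy N s p W f v ≤ energy N s p W f w := fun w hw =>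
    hve.trans_le (h.groundLevel_le hW hw)
  have hweak : ∀ φ, MemEnergySpace N s p W φ → energyDeriv N s p W f v φ = 0 := fun φ hφ =>
    h.energyDeriv_eq_zero_of_minimal hW hv hmin hφ
  have hpos := h.ae_pos_of_weak_solution hW hv.1 hv0 hv.2.1 hweak
  -- positivity is asked for at every point, so `v` is changed on the null set `{v ≤ 0}`
  set u : Space N → ℝ := fun x => if 0 < v x then v x else 1 with hu
  have huv : v =ᵐ[volume] u := by
    filter_upwards [hpos] with x hx
    simp [hu, hx]
  have hupos : ∀ x, 0 < u x := fun x => by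
    simp only [hu]
    split_ifs with hx
    exacts [hx, one_pos]
  refine ⟨u, ⟨⟨hv.1.congr huv, fun φ hφ => ?_, hupos⟩, ⟨hv.1.congr huv,
    fun h0 => hv.2.1 (huv.trans h0), ?_⟩, fun w hw => ?_⟩⟩
  · rw [← energyDeriv_congr huv (EventuallyEq.refl _ φ)]
    exact hweak φ hφ
  · rw [← energyDeriv_congr huv huv]
    exact hv.2.2
  · rw [← energy_congr huv]
    exact hmin w hw

end

/-! ### Comparison of ground state levels -/

section Comparison

theorem normPow_const (μ : ℝ) (u : Space N → ℝ) :
    normPow N s p (fun _ => μ) u =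
      (∫ z, gagliardoIntegrand N s p u z) + μ * ∫ x, |u x| ^ p := by
  unfold normPow
  rw [integral_const_mul]

theorem energyDeriv_const_sub (hp : 1 < p) {μ ν : ℝ} (hμ : 0 < μ) (hν : 0 < ν)
    (u : Space N → ℝ) :
    energyDeriv N s p (fun _ => μ) f u u =
      energyDeriv N s p (fun _ => ν) f u u - (ν - μ) * ∫ x, |u x| ^ p := by
  rw [energyDeriv_self hp (isPotential_const hμ), energyDeriv_self hp (isPotential_const hν),
    normPow_const, normPow_const]
  ring

theorem energyDeriv_const_mono (hp : 1 < p) {μ ν : ℝ} (hμ : 0 < μ) (hμν : μ ≤ ν)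
    (u : Space N → ℝ) :
    energyDeriv N s p (fun _ => μ) f u u ≤ energyDeriv N s p (fun _ => ν) f u u := by
  rw [energyDeriv_const_sub hp hμ (hμ.trans_le hμν)]
  linarith [mul_nonneg (sub_nonneg.2 hμν) (integral_abs_rpow_nonneg (p := p) (μ := volume) u)]

/-- The ground state level of constant potentials is monotone in the constant. -/
theorem IsSetting.groundLevel_const_mono (h : IsSetting N s p q f) {μ ν : ℝ} (hμ : 0 < μ)
    (hμν : μ ≤ ν) :
    groundLevel N s p (fun _ => μ) f ≤ groundLevel N s p (fun _ => ν) f := by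
  have hν := isPotential_const (N := N) (hμ.trans_le hμν)
  refine le_csInf ((h.nehari_nonempty hν).image _) ?_
  rintro _ ⟨u, hu, rfl⟩
  rw [h.energy_eq_of_mem_nehari hν hu]
  exact h.groundLevel_le_integral (isPotential_const hμ)
    (hu.1.1.memEnergySpace_const h.one_lt μ) hu.2.1
    ((energyDeriv_const_mono h.one_lt hμ hμν u).trans_eq hu.2.2)

/-- Lowering a constant potential from `ν` to `μ` leaves room for a function which satisfies
`⟨I'(v), v⟩ < 0` for the potential `μ` and lies strictly below the level of `ν`: a point of the
Nehari manifold of an intermediate constant on the ray of a near-minimiser for `ν`. -/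
theorem IsSetting.exists_below_const (h : IsSetting N s p q f) {μ ν : ℝ} (hμ : 0 < μ)
    (hμν : μ < ν) :
    ∃ v, MemSobolev N s p v ∧ energyDeriv N s p (fun _ => μ) f v v < 0 ∧
      ∫ x, nehariDensity p f (v x) < groundLevel N s p (fun _ => ν) f := by
  have hp := h.one_lt
  set c := groundLevel N s p (fun _ => ν) f with hc
  obtain ⟨m, hμm, hmν⟩ := exists_between hμν
  have hm0 : 0 < m := hμ.trans hμm
  have hPm := isPotential_const (N := N) hm0
  have hPν := isPotential_const (N := N) (hμ.trans hμν)
  obtain ⟨δ, hδ, K, hbd⟩ := h.exists_lower_bound hm0 (c + 1)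
  have hgap : 0 < (ν - m) * δ / p := div_pos (mul_pos (by linarith) hδ) h.p_pos
  obtain ⟨_, ⟨w, hw, rfl⟩, hwc⟩ := exists_lt_of_csInf_lt ((h.nehari_nonempty hPν).image _)
    (show c < c + min 1 ((ν - m) * δ / p) by linarith [lt_min one_pos hgap])
  have hwm := hw.1.1.memEnergySpace_const hp m
  obtain ⟨t, ht0, -, htm, hte⟩ := h.exists_mem_nehari_energy_le hPm hwm hw.2.1
    ((energyDeriv_const_mono hp hm0 hmν.le w).trans_eq hw.2.2)
  rw [← h.energy_eq_of_mem_nehari hPν hw] at hte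
  have htH := h.energy_eq_of_mem_nehari hPm htm
  have hδv := (hbd _ _ hPm htm.1 htm.2.1 htm.2.2.le (by
    rw [← htH]
    linarith [min_le_left 1 ((ν - m) * δ / p)])).1
  refine ⟨_, htm.1.1, ?_, ?_⟩
  · rw [energyDeriv_const_sub hp hμ hm0, htm.2.2]
    linarith [mul_pos (sub_pos.2 hμm) (hδ.trans_le hδv)]
  · have h1 := h.energy_const_mul_le hPν hw ht0
    have h2 : energy N s p (fun _ => ν) f (fun x => t * w x) =
        energy N s p (fun _ => m) f (fun x => t * w x) +
          (ν - m) * (∫ x, |t * w x| ^ p) / p := by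
      unfold energy
      rw [normPow_const, normPow_const]
      ring
    have h3 : (ν - m) * δ / p ≤ (ν - m) * (∫ x, |t * w x| ^ p) / p :=
      div_le_div_of_nonneg_right (mul_le_mul_of_nonneg_left hδv (by linarith)) h.p_pos.le
    rw [← htH]
    linarith [min_le_right 1 ((ν - m) * δ / p)]

/-- The functions of `IsSetting.exists_below_const` may be taken with bounded support. -/
theorem IsSetting.exists_below_const_bounded (h : IsSetting N s p q f) {μ ν : ℝ} (hμ : 0 < μ)
    (hμν : μ < ν) :
    ∃ v, ∃ R : ℝ, 0 < R ∧ MemSobolev N s p v ∧ (∀ x, R ≤ ‖x‖ → v x = 0) ∧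
      energyDeriv N s p (fun _ => μ) f v v < 0 ∧
      ∫ x, nehariDensity p f (v x) < groundLevel N s p (fun _ => ν) f := by
  have hp := h.one_lt
  have hPμ := isPotential_const (N := N) hμ
  obtain ⟨v, hv, hJ, hH⟩ := h.exists_below_const hμ hμν
  have hmem : ∀ n, MemSobolev N s p (fun x => tent N n x * v x) := fun n =>
    ((isCutoff_tent n).memSobolev_mul h.s_pos h.s_lt_one hp h.dim_ne_zero hv)
  have hlim : ∀ x, Tendsto (fun n => tent N n x * v x) atTop (𝓝 (v x)) := fun x => by
    simpa using (tendsto_tent x).mul_const (v x)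
  have hle : ∀ n x, |tent N n x * v x| ≤ |v x| := fun n x => by
    rw [abs_mul, abs_of_nonneg ((isCutoff_tent n).nonneg x)]
    exact mul_le_of_le_one_left (abs_nonneg _) ((isCutoff_tent n).le_one x)
  have hcomp : ∀ {j : ℝ → ℝ}, IsSubDensity f j →
      Tendsto (fun n => ∫ x, j (tent N n x * v x)) atTop (𝓝 (∫ x, j (v x))) := fun hj =>
    h.tendsto_integral_comp hj (fun n => (hmem n).1.1) (h.integrable_twoPower hv)
      (Eventually.of_forall hle) (ae_of_all _ hlim)
  have hpow : Tendsto (fun n => ∫ x, |tent N n x * v x| ^ p) atTop (𝓝 (∫ x, |v x| ^ p)) := by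
    refine tendsto_integral_of_dominated_convergence (fun x => |v x| ^ p)
      (fun n => (integrable_abs_rpow h.p_pos (hmem n).1).1) (integrable_abs_rpow h.p_pos hv.1)
      (fun n => ae_of_all _ fun x => ?_) (ae_of_all _ fun x => ?_)
    · rw [Real.norm_eq_abs, abs_of_nonneg (by positivity)]
      exact Real.rpow_le_rpow (abs_nonneg _) (hle n x) h.p_pos.le
    · exact ((continuous_abs_rpow h.p_pos).tendsto _).comp (hlim x)
  have hJlim : Tendsto (fun n => energyDeriv N s p (fun _ => μ) f (fun x => tent N n x * v x)
      (fun x => tent N n x * v x)) atTop (𝓝 (energyDeriv N s p (fun _ => μ) f v v)) := by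
    simp only [energyDeriv_self hp hPμ, normPow_const]
    exact ((tendsto_gagliardo_tent_mul h.s_pos h.s_lt_one hp h.dim_ne_zero hv).add
      (hpow.const_mul μ)).sub (hcomp h.isSubDensity_mul_self)
  obtain ⟨n, h1, h2⟩ := ((hJlim.eventually_lt_const hJ).and
    ((hcomp h.isSubDensity_nehariDensity).eventually_lt_const hH)).exists
  refine ⟨_, (n : ℝ) + 1, by positivity, hmem n, fun x hx => ?_, h1, h2⟩
  rw [tent_eq_zero n hx, zero_mul]

theorem gagliardoIntegrand_comp_sub (v : Space N → ℝ) (y : Space N) (z : Space N × Space N) :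
    gagliardoIntegrand N s p (fun x => v (x - y)) z = gagliardoIntegrand N s p v (z - (y, y)) := by
  simp [gagliardoIntegrand]

theorem MemSobolev.comp_sub {v : Space N → ℝ} (hv : MemSobolev N s p v) (y : Space N) :
    MemSobolev N s p fun x => v (x - y) := by
  refine ⟨hv.1.comp_measurePreserving (measurePreserving_sub_right volume y), ?_⟩
  rw [funext (gagliardoIntegrand_comp_sub v y)]
  have : (volume : Measure (Space N × Space N)).IsAddRightInvariant := by
    rw [Measure.volume_eq_prod]; infer_instance
  exact hv.2.comp_sub_right (y, y)

theorem integral_gagliardo_comp_sub (v : Space N → ℝ) (y : Space N) :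
    ∫ z, gagliardoIntegrand N s p (fun x => v (x - y)) z = ∫ z, gagliardoIntegrand N s p v z := by
  rw [funext (gagliardoIntegrand_comp_sub v y)]
  have : (volume : Measure (Space N × Space N)).IsAddRightInvariant := by
    rw [Measure.volume_eq_prod]; infer_instance
  exact integral_sub_right_eq_self (gagliardoIntegrand N s p v) (y, y)

/-- A function supported in a ball, admissible for the constant potential `μ`, is admissible for
`V(ε ·)` with small `ε` after translation towards a point where `V < μ`. -/
theorem IsSetting.exists_groundLevel_le (h : IsSetting N s p q f) {V : Space N → ℝ}
    (hV : IsPotential V w₀) {μ R : ℝ} (hμ : 0 < μ) (hR : 0 < R) {x₀ : Space N} (hx₀ : V x₀ < μ)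
    {v : Space N → ℝ} (hv : MemSobolev N s p v) (hvR : ∀ x, R ≤ ‖x‖ → v x = 0)
    (hJ : energyDeriv N s p (fun _ => μ) f v v < 0) :
    ∃ ε₀ : ℝ, 0 < ε₀ ∧ ∀ ε : ℝ, 0 < ε → ε < ε₀ →
      groundLevel N s p (fun x => V (ε • x)) f ≤ ∫ x, nehariDensity p f (v x) := by
  have hp := h.one_lt
  obtain ⟨ρ, hρ, hball⟩ := Metric.eventually_nhds_iff.1
    (hV.continuous.continuousAt.eventually_lt_const hx₀)
  -- the ball of radius `R` around `x₀ / ε` is scaled into the ball of radius `ε R < ρ` around `x₀`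
  refine ⟨ρ / R, div_pos hρ hR, fun ε hε hερ => ?_⟩
  rw [lt_div_iff₀ hR] at hερ
  have hVε : IsPotential (fun x => V (ε • x)) w₀ :=
    ⟨hV.continuous.comp (continuous_const_smul ε), hV.pos, fun x => hV.le _⟩
  set y := ε⁻¹ • x₀ with hy
  set u : Space N → ℝ := fun x => v (x - y) with hu
  have huS : MemSobolev N s p u := hv.comp_sub y
  have hpt : ∀ x, V (ε • x) * |u x| ^ p ≤ μ * |u x| ^ p := by
    intro x
    rcases le_or_gt R ‖x - y‖ with hx | hx
    · simp [hu, hvR _ hx, Real.zero_rpow h.p_pos.ne']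
    · refine mul_le_mul_of_nonneg_right (hball ?_).le (by positivity)
      have e : ε • x - x₀ = ε • (x - y) := by rw [hy, smul_sub, smul_inv_smul₀ hε.ne']
      rw [dist_eq_norm, e, norm_smul, Real.norm_eq_abs, abs_of_pos hε]
      exact (mul_lt_mul_of_pos_left hx hε).trans hερ
  have huμ := (huS.memEnergySpace_const hp μ).2
  have huE : MemEnergySpace N s p (fun x => V (ε • x)) u := by
    refine ⟨huS, huμ.mono' ?_ (ae_of_all _ fun x => ?_)⟩
    · exact hVε.continuous.aestronglyMeasurable.mul (integrable_abs_rpow h.p_pos huS.1).1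
    · rw [Real.norm_eq_abs, abs_of_nonneg (mul_nonneg (hVε.nonneg x) (by positivity))]
      exact hpt x
  have huJ : energyDeriv N s p (fun x => V (ε • x)) f u u < 0 := by
    refine lt_of_le_of_lt ?_ hJ
    rw [energyDeriv_self hp hVε, energyDeriv_self hp (isPotential_const hμ)]
    have e1 : ∫ x, f (u x) * u x = ∫ x, f (v x) * v x :=
      integral_sub_right_eq_self (fun x => f (v x) * v x) y
    have e2 : normPow N s p (fun _ => μ) u = normPow N s p (fun _ => μ) v := by
      rw [normPow_const, normPow_const, integral_gagliardo_comp_sub,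
        integral_sub_right_eq_self (fun x => |v x| ^ p) y]
    rw [e1, ← e2]
    exact sub_le_sub_right (add_le_add_right (integral_mono huE.2 huμ hpt) _) _
  have hne : ¬ u =ᵐ[volume] 0 := fun h0 => by
    rw [energyDeriv_self hp hVε, integral_eq_zero_of_ae (by
      filter_upwards [h0] with x hx
      rw [hx, Pi.zero_apply, mul_zero]), sub_zero] at huJ
    exact huJ.not_ge (normPow_nonneg hp hVε)
  refine (h.groundLevel_le_integral hVε huE hne huJ.le).trans_eq ?_
  exact integral_sub_right_eq_self (fun x => nehariDensity p f (v x)) y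

end Comparison

/-- Where the rescaled potential lies below a level under its liminf is bounded. -/
theorem exists_setOf_lt_subset_ball {V : Space N → ℝ} {μ : ℝ}
    (hμ : (μ : EReal) < liminfAtInfinity V) {ε : ℝ} (hε : 0 < ε) :
    ∃ R, {x | V (ε • x) < μ} ⊆ Metric.ball 0 R := by
  obtain ⟨t, ht, hts⟩ := mem_cocompact.1 (eventually_lt_of_lt_liminf hμ)
  obtain ⟨R, hR⟩ := ht.isBounded.subset_ball 0
  refine ⟨R / ε, fun x hx => ?_⟩
  have h1 : ε • x ∈ t := by
    by_contra hc
    exact (EReal.coe_lt_coe_iff.1 (hts hc)).not_gt hx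
  have h2 := hR h1
  rw [mem_ball_zero_iff, norm_smul, Real.norm_eq_abs, abs_of_pos hε] at h2
  rw [mem_ball_zero_iff, lt_div_iff₀ hε, mul_comm]
  exact h2

end

end FracSchrodinger

end

theorem theorem3p1 (N : ℕ) (s p : ℝ) (hs0 : 0 < s) (hs1 : s < 1) (hp : 1 < p)
    (hN : s * p < N)
    (V : FracSchrodinger.Space N → ℝ) (hV : FracSchrodinger.IsRabinowitzPotential V)
    (f : ℝ → ℝ) (hf : FracSchrodinger.IsSubcriticalNonlinearity N s p f) :
    ∃ ε₀ : ℝ, 0 < ε₀ ∧ ∀ ε : ℝ, 0 < ε → ε < ε₀ →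
      (∃ u : FracSchrodinger.Space N → ℝ,
        FracSchrodinger.IsGroundStateSolution N s p (fun x => V (ε • x)) f u) ∧
      (∀ Vinf : ℝ, FracSchrodinger.liminfAtInfinity V = (Vinf : EReal) →
        FracSchrodinger.groundLevel N s p (fun x => V (ε • x)) f
          < FracSchrodinger.groundLevel N s p (fun _ => Vinf) f) := by
  obtain ⟨q, hpq, hq, hfq⟩ := hf.limit_infinity
  have h : FracSchrodinger.IsSetting N s p q f := ⟨hs0, hs1, hp, hN, hf, hpq, hq, hfq⟩
  -- real levels `inf V < μ₁ < μ₂ < μ₃ < liminf V`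
  obtain ⟨μ₃, hμ₃, hμ₃L⟩ := EReal.lt_iff_exists_real_btwn.1 hV.inf_lt_liminf
  obtain ⟨μ₂, hμ₂, hμ₂₃⟩ := EReal.lt_iff_exists_real_btwn.1 hμ₃
  obtain ⟨μ₁, hμ₁, hμ₁₂⟩ := EReal.lt_iff_exists_real_btwn.1 hμ₂
  obtain ⟨w₀, hw₀, hw₀V⟩ := EReal.lt_iff_exists_real_btwn.1 hV.inf_pos
  rw [EReal.coe_lt_coe_iff] at hμ₂₃ hμ₁₂
  obtain ⟨x₀, hx₀⟩ := iInf_lt_iff.1 hμ₁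
  rw [EReal.coe_lt_coe_iff] at hx₀
  have hw₀' : 0 < w₀ := by exact_mod_cast hw₀
  have hVle : ∀ x, w₀ ≤ V x := fun x => EReal.coe_le_coe_iff.1 (hw₀V.le.trans (iInf_le _ x))
  have hVP : FracSchrodinger.IsPotential V w₀ := ⟨hV.continuous, hw₀', hVle⟩
  have hμ₁0 : 0 < μ₁ := (hw₀'.trans_le (hVle x₀)).trans hx₀
  obtain ⟨v, R, hR, hv, hvR, hJ, hH⟩ := h.exists_below_const_bounded hμ₁0 hμ₁₂
  obtain ⟨ε₀, hε₀, hle⟩ := h.exists_groundLevel_le hVP hμ₁0 hR hx₀ hv hvR hJ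
  refine ⟨ε₀, hε₀, fun ε hε hεε₀ => ?_⟩
  have hlt := (hle ε hε hεε₀).trans_lt hH
  have hVε : FracSchrodinger.IsPotential (fun x => V (ε • x)) w₀ :=
    ⟨hV.continuous.comp (continuous_const_smul ε), hw₀', fun x => hVle _⟩
  refine ⟨?_, fun Vinf hVinf => ?_⟩
  · obtain ⟨R', hR'⟩ := FracSchrodinger.exists_setOf_lt_subset_ball hμ₃L hε
    obtain ⟨u, hu, hu0, hue⟩ := h.exists_minimizer hVε (hμ₁0.trans hμ₁₂) hμ₂₃ hR' hlt
    exact h.exists_groundState_of_minimizer hVε hu hu0 hue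
  · rw [hVinf, EReal.coe_lt_coe_iff] at hμ₃L
    exact hlt.trans_le (h.groundLevel_const_mono (hμ₁0.trans hμ₁₂) (hμ₂₃.trans hμ₃L).le)
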